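/- **Theorem.** All graphs are finite and simple. A graph is *planar* if it can be drawn in the plane without crossings: the vertices are represented by distinct points, each edge by a Jordan arc joining its two end vertices, an arc contains no vertices other than its two end vertices, and two different arcs have no points in common except common end vertices. For integers $k, g$, a *planar $(k,g)$-graph* is a $k$-regular planar graph of girth exactly $g$ (the girth is the length of a shortest cycle), and a *planar $(k,g)$-cage* is a planar $(k,g)$-graph with the minimum number of vertices among all planar $(k,g)$-graphs. Let $k \ge 3$. A planar $(k,g)$-cage exists if and only if $$(k,g)\in\{(3,3),\,(3,4),\,(3,5),\,(4,3),\,(5,3)\}.$$ In each of these cases the cage is unique up to isomorphism, and it is the graph of a Platonic solid: - a graph is a planar $(3,3)$-cage if and only if it is isomorphic to the graph of the tetrahedron, and it then has $4$ vertices; - a graph is a planar $(3,4)$-cage if and only if it is isomorphic to the graph of the cube, and it then has $8$ vertices; - a graph is a planar $(3,5)$-cage if and only if it is isomorphic to the graph of the dodecahedron, and it then has $20$ vertices; - a graph is a planar $(4,3)$-cage if and only if it is isomorphic to the graph of the octahedron, and it then has $6$ vertices; - a graph is a planar $(5,3)$-cage if and only if it is isomorphic to the graph of the icosahedron, and it then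 has $12$ vertices. -/

import Mathlib

/-- A drawing of a simple graph in the plane without crossings: distinct vertices are distinct
points, every edge is a Jordan arc joining its end vertices, an arc contains no vertices other than
its own end vertices, and two different arcs meet only in common end vertices.
(The values of `arc` on pairs that are not edges play no role.) -/
structure PlaneDrawing {V : Type*} (G : SimpleGraph V) where
  point : V → ℝ × ℝ
  point_injective : Function.Injective point
  arc : Sym2 V → Set (ℝ × ℝ)
  isArc : ∀ u v : V, G.Adj u v →
    ∃ γ : Path (point u) (point v), Function.Injective γ ∧ Set.range γ = arc s(u, v)
  mem_of_point_mem_arc : ∀ e ∈ G.edgeSet, ∀ w : V, point w ∈ arc e → w ∈ e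
  arc_inter_arc : ∀ e ∈ G.edgeSet, ∀ f ∈ G.edgeSet, e ≠ f →
    arc e ∩ arc f ⊆ point '' {w | w ∈ e ∧ w ∈ f}

/-- A graph is planar if it has a drawing in the plane without crossings. -/
def IsPlanarGraph {V : Type*} (G : SimpleGraph V) : Prop :=
  Nonempty (PlaneDrawing G)

open Classical in
/-- A planar `(k, g)`-graph: a finite simple planar graph that is `k`-regular and has girth
(length of a shortest cycle, which in particular exists) equal to `g`. -/
def IsPlanarKGGraph {V : Type*} [Fintype V] (G : SimpleGraph V) (k g : ℕ) : Prop :=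
  G.IsRegularOfDegree k ∧ G.egirth = (g : ℕ∞) ∧ IsPlanarGraph G

/-- A planar `(k, g)`-cage: a planar `(k, g)`-graph of minimum order. -/
def IsPlanarCage {V : Type*} [Fintype V] (G : SimpleGraph V) (k g : ℕ) : Prop :=
  IsPlanarKGGraph G k g ∧
    ∀ (n : ℕ) (H : SimpleGraph (Fin n)), IsPlanarKGGraph H k g → Fintype.card V ≤ n

/-- The graph of the tetrahedron: four mutually adjacent vertices. -/
def tetrahedronGraph : SimpleGraph (Fin 4) := ⊤

/-- The graph of the cube: the vertices are the points of `{0, 1} ^ 3`, and two of them are adjacent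
if they differ in exactly one coordinate. -/
def cubeGraph : SimpleGraph (Fin 3 → Bool) where
  Adj x y := hammingDist x y = 1
  symm := ⟨fun x y h => by rw [hammingDist_comm]; exact h⟩
  loopless := ⟨fun x h => by simp at h⟩

/-- The graph of the octahedron: the vertices are the points `± eᵢ` for `i < 3`, and two of them are
adjacent if they are neither equal nor antipodal. -/
def octahedronGraph : SimpleGraph (Fin 3 × Bool) where
  Adj x y := x.1 ≠ y.1
  symm := ⟨fun _ _ h => h.symm⟩
  loopless := ⟨fun _ h => h rfl⟩

/-- The graph of the dodecahedron. Its vertices lie in four levels of five vertices each. The five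
vertices of the top level `0` and those of the bottom level `3` form a pentagon, every vertex of
these two levels has one neighbour in the level next to it, and the levels `1` and `2` form a cycle
of length ten. -/
def dodecahedronGraph : SimpleGraph (Fin 4 × ZMod 5) :=
  SimpleGraph.fromRel fun x y =>
    (x.1 = 0 ∧ y.1 = 0 ∧ y.2 = x.2 + 1) ∨
    (x.1 = 0 ∧ y.1 = 1 ∧ y.2 = x.2) ∨
    (x.1 = 1 ∧ y.1 = 2 ∧ (y.2 = x.2 ∨ y.2 = x.2 + 1)) ∨
    (x.1 = 2 ∧ y.1 = 3 ∧ y.2 = x.2) ∨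
    (x.1 = 3 ∧ y.1 = 3 ∧ y.2 = x.2 + 1)

/-- The graph of the icosahedron: a pentagonal antiprism on `Bool × ZMod 5` (two pentagons, joined
by a zigzag of ten edges), with one apex `Sum.inl b` over each pentagon `b`. -/
def icosahedronGraph : SimpleGraph (Bool ⊕ (Bool × ZMod 5)) :=
  SimpleGraph.fromRel fun x y =>
    match x, y with
    | Sum.inl b, Sum.inr p => p.1 = b
    | Sum.inr p, Sum.inr q =>
        (p.1 = q.1 ∧ q.2 = p.2 + 1) ∨
        (p.1 = false ∧ q.1 = true ∧ (q.2 = p.2 ∨ q.2 = p.2 + 1))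
    | _, _ => False

/-! The heart is Euler's inequality E + 2 ≤ F + V for a planar (k, g)-graph with k ≥ 3, with faces
understood homologically, so that the Jordan curve theorem is not needed. Faces are elements of the
mod 2 cycle space that span it, cover every edge at most twice and add up to zero (`FaceFamily`).
The zero sum bounds the dimension of the cycle space by F - 1; on the other hand that dimension is
at least E - (V - 1), because every boundary has even total. A nonzero element of the cycle space
has at least g edges, so gF ≤ 2E = kV, and together V·gk + 4g ≤ V(2k + 2g) (`card_bound`). Hence (k
- 2)(g - 2) < 4, which leaves five pairs, and for each of them V is at least the order of the
Platonic graph.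

The faces are obtained by discretising a drawing. Its arcs are cut into thirds and covered by the
squares of a fine mesh, which presents the graph as a minor of the square grid. Faces are the unit
squares modulo crossing grid edges that the minor does not use. They generate the cycle space
because the grid has no first homology: a closed chain is the jump of a function on squares
(`exists_jump_eq`).

At the Platonic order all these inequalities are equalities (`TightFaces`): the graph is connected,
every face has g edges, every edge lies on exactly two faces, and the total sum is the only
relation. For the cube, the dodecahedron and the icosahedron the graph is then rebuilt face by face,
as a homomorphic image of the model that is closed under adjacency and is therefore everything. The
tetrahedron and the octahedron are determined by degree and order alone. Planarity of the five
models comes from straight-line drawings with integer coordinates, checked through signs of areas.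
-/

/-! ### Mod 2 homology of the square grid -/

section GridHomology

/-- The neighbours of a point of the square grid, in the order east, north, west, south. -/
def gridStep (p : ℤ × ℤ) : Fin 4 → ℤ × ℤ :=
  ![(p.1 + 1, p.2), (p.1, p.2 + 1), (p.1 - 1, p.2), (p.1, p.2 - 1)]

/-- A directed edge of the square grid, given by its source and its direction. -/
abbrev GridDart : Type := (ℤ × ℤ) × Fin 4

namespace GridDart

def target (d : GridDart) : ℤ × ℤ := gridStep d.1 d.2

def reverse (d : GridDart) : GridDart := (d.target, d.2 + 2)

/-- The unit square on the left of a dart; a square is named by its lower left corner. -/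
def left (d : GridDart) : ℤ × ℤ :=
  ![(d.1.1, d.1.2), (d.1.1 - 1, d.1.2), (d.1.1 - 1, d.1.2 - 1), (d.1.1, d.1.2 - 1)] d.2

/-- The unit square on the right of a dart. -/
def right (d : GridDart) : ℤ × ℤ :=
  ![(d.1.1, d.1.2 - 1), (d.1.1, d.1.2), (d.1.1 - 1, d.1.2), (d.1.1 - 1, d.1.2 - 1)] d.2

@[simp] theorem reverse_reverse (d : GridDart) : d.reverse.reverse = d := by
  obtain ⟨⟨x, y⟩, i⟩ := d
  fin_cases i <;> simp [reverse, target, gridStep]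

@[simp] theorem target_reverse (d : GridDart) : d.reverse.target = d.1 := by
  have h := congrArg Prod.fst d.reverse_reverse
  exact h

@[simp] theorem reverse_fst (d : GridDart) : d.reverse.1 = d.target := rfl

theorem left_reverse (d : GridDart) : d.reverse.left = d.right := by
  obtain ⟨⟨x, y⟩, i⟩ := d
  fin_cases i <;> simp [reverse, target, gridStep, left, right]

theorem right_reverse (d : GridDart) : d.reverse.right = d.left := by
  rw [← left_reverse, reverse_reverse]

theorem target_ne (d : GridDart) : d.target ≠ d.1 := by
  obtain ⟨⟨x, y⟩, i⟩ := d
  fin_cases i <;> simp [target, gridStep]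

theorem reverse_ne (d : GridDart) : d.reverse ≠ d := fun h =>
  d.target_ne (congrArg Prod.fst h)

/-- The jump of a function on squares across a dart. -/
def jump (f : ℤ × ℤ → ZMod 2) (d : GridDart) : ZMod 2 := f d.left + f d.right

theorem jump_reverse (f : ℤ × ℤ → ZMod 2) (d : GridDart) : jump f d.reverse = jump f d := by
  rw [jump, jump, left_reverse, right_reverse, add_comm]

/-- Each of the four squares around `p` lies beside two of the four darts out of `p`, so it is
counted twice. -/
theorem sum_jump (f : ℤ × ℤ → ZMod 2) (p : ℤ × ℤ) : ∑ i, jump f (p, i) = 0 := by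
  simp only [Fin.sum_univ_four, jump, left, right, Matrix.cons_val]
  have h := fun x : ZMod 2 => CharTwo.add_self_eq_zero x
  linear_combination h (f (p.1, p.2)) + h (f (p.1 - 1, p.2)) + h (f (p.1 - 1, p.2 - 1)) +
    h (f (p.1, p.2 - 1))

/-- A symmetric closed chain of the grid that vanishes far to the left is a jump function. -/
theorem exists_jump_eq (c : GridDart → ZMod 2) (hc : ∀ d : GridDart, c d.reverse = c d)
    (N : ℤ) (hN : ∀ p i, p.1 < N → c (p, i) = 0) (h0 : ∀ p, ∑ i, c (p, i) = 0) :
    ∃ f, ∀ d, jump f d = c d := by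
  have two := fun x : ZMod 2 => CharTwo.add_self_eq_zero x
  -- The value at a square adds up `c` over the vertical edges crossed by a horizontal ray from the
  -- far left; starting at `N` loses nothing, since `c` vanishes before it.
  let f : ℤ × ℤ → ZMod 2 := fun q => ∑ x ∈ Finset.Icc N q.1, c ((x, q.2), 1)
  have hlow : ∀ x y, x < N → f (x, y) = 0 := fun x y hx => by
    simp [f, Finset.Icc_eq_empty (not_le.2 hx)]
  have hstep : ∀ x y, f (x, y) = f (x - 1, y) + c ((x, y), 1) := by
    intro x y
    rcases lt_or_ge x N with hx | hx
    · rw [hlow _ _ hx, hlow _ _ (by lia), hN _ _ hx, add_zero]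
    · have : Finset.Icc N x = insert x (Finset.Icc N (x - 1)) := by
        ext z; simp only [Finset.mem_Icc, Finset.mem_insert]; lia
      simp only [f]
      rw [this, Finset.sum_insert (by simp), add_comm]
  have hW : ∀ x y, c ((x, y), 2) = c ((x - 1, y), 0) := fun x y => by
    have := hc ((x, y), 2)
    simpa [reverse, target, gridStep] using this.symm
  have hS : ∀ x y, c ((x, y), 3) = c ((x, y - 1), 1) := fun x y => by
    have := hc ((x, y), 3)
    simpa [reverse, target, gridStep] using this.symm
  -- Jumps across vertical darts are right by construction. For horizontal ones, closedness of `c`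
  -- at a grid point carries the identity one step to the right, from `N - 1`, where everything
  -- vanishes.
  have hE : ∀ x y, f (x, y) + f (x, y - 1) = c ((x, y), 0) := by
    intro x y
    rcases lt_or_ge x N with hx | hx
    · rw [hlow _ _ hx, hlow _ _ hx, hN _ _ hx, add_zero]
    · have key : ∀ x, N - 1 ≤ x → f (x, y) + f (x, y - 1) = c ((x, y), 0) := by
        intro x hx
        induction x, hx using Int.leInduction with
        | base => rw [hlow _ _ (by lia), hlow _ _ (by lia), hN _ _ (by simp), add_zero]
        | succ x _ ih =>
          have h := h0 (x + 1, y)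
          rw [Fin.sum_univ_four, hW, hS] at h
          rw [hstep (x + 1) y, hstep (x + 1) (y - 1)]
          simp only [add_sub_cancel_right] at h ⊢
          linear_combination ih + h - two (c ((x + 1, y), 0))
      exact key x (by lia)
  refine ⟨f, ?_⟩
  rintro ⟨⟨x, y⟩, i⟩
  fin_cases i
  · exact hE x y
  · change f (x - 1, y) + f (x, y) = c ((x, y), 1)
    rw [hstep x y]
    linear_combination two (f (x - 1, y))
  · change f (x - 1, y - 1) + f (x - 1, y) = _
    rw [add_comm, hE]
    exact (hW x y).symm
  · change f (x, y - 1) + f (x - 1, y - 1) = c ((x, y), 3)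
    rw [hstep x (y - 1)]
    have := hS x y
    linear_combination two (f (x - 1, y - 1)) - this

end GridDart

/-- A set of grid points is connected if any two of its points are joined by a path of unit steps
inside the set. -/
def GridConnected (S : Set (ℤ × ℤ)) : Prop :=
  ∀ p ∈ S, ∀ q ∈ S, Relation.ReflTransGen (fun a b => b ∈ S ∧ ∃ i, b = gridStep a i) p q

/-- The chain adds every step of the path together with its reverse; inner points of the path cancel
modulo two. -/
theorem exists_chain_of_path {S : Set (ℤ × ℤ)} {p q : ℤ × ℤ} (hp : p ∈ S)
    (h : Relation.ReflTransGen (fun a b => b ∈ S ∧ ∃ i, b = gridStep a i) p q) :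
    q ∈ S ∧ ∃ c : GridDart → ZMod 2, (∀ d : GridDart, c d.reverse = c d) ∧
      (∀ d : GridDart, c d ≠ 0 → d.1 ∈ S ∧ d.target ∈ S) ∧
      ∀ x, ∑ i, c (x, i) = (if x = p then 1 else 0) + (if x = q then 1 else 0) := by
  have two := fun x : ZMod 2 => CharTwo.add_self_eq_zero x
  induction h with
  | refl => exact ⟨hp, 0, by simp, by simp, fun x => by simp [two]⟩
  | @tail a b _ hab ih =>
    obtain ⟨ha, c, hc, hS, hb⟩ := ih
    obtain ⟨hbS, i, rfl⟩ := hab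
    let e : GridDart := (a, i)
    refine ⟨hbS, fun d => c d + ((if d = e then 1 else 0) + (if d = e.reverse then 1 else 0)),
      ?_, ?_, ?_⟩
    · intro d
      have h1 : d.reverse = e.reverse ↔ d = e :=
        ⟨fun h => by simpa using congrArg GridDart.reverse h, fun h => by rw [h]⟩
      have h2 : d.reverse = e ↔ d = e.reverse :=
        ⟨fun h => by rw [← h]; simp, fun h => by rw [h]; simp⟩
      simp only [hc, h1, h2, add_comm (if d = e then (1 : ZMod 2) else 0)]
    · intro d hd
      by_cases h1 : d = e
      · rw [h1]; exact ⟨ha, hbS⟩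
      by_cases h2 : d = e.reverse
      · rw [h2, GridDart.target_reverse]; exact ⟨hbS, ha⟩
      · exact hS d (by simpa [h1, h2] using hd)
    · intro x
      have single : ∀ d : GridDart,
          ∑ j, (if (x, j) = d then (1 : ZMod 2) else 0) = if x = d.1 then 1 else 0 := by
        rintro ⟨y, k⟩
        by_cases hxy : x = y <;> simp [hxy]
      simp only [Finset.sum_add_distrib, hb, single]
      change _ + ((if x = a then 1 else 0) + (if x = gridStep a i then 1 else 0)) = _
      linear_combination two (if x = a then 1 else 0)

/-- Every even `0`-chain on a finite connected set of grid points bounds inside the set. -/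
theorem exists_chain_of_sum_eq_zero {S : Finset (ℤ × ℤ)} (hS : GridConnected (S : Set (ℤ × ℤ)))
    (r : ℤ × ℤ → ZMod 2) (hr : ∑ p ∈ S, r p = 0) :
    ∃ c : GridDart → ZMod 2, (∀ d : GridDart, c d.reverse = c d) ∧
      (∀ d : GridDart, c d ≠ 0 → d.1 ∈ S ∧ d.target ∈ S) ∧
      ∀ x ∈ S, ∑ i, c (x, i) = r x := by
  rcases S.eq_empty_or_nonempty with rfl | ⟨b, hb⟩
  · exact ⟨0, by simp, by simp, by simp⟩
  -- Every point is joined to a base point `b`; the contributions at `b` add up to `∑ r`, which is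
  -- zero.
  have H := fun p (hp : p ∈ S) => (exists_chain_of_path hp (hS p hp b hb)).2
  choose! C hC hCS hCb using H
  refine ⟨fun d => ∑ p ∈ S, r p * C p d, ?_, ?_, ?_⟩
  · exact fun d => Finset.sum_congr rfl fun p hp => by rw [hC p hp]
  · intro d hd
    obtain ⟨p, hp, hpd⟩ := Finset.exists_ne_zero_of_sum_ne_zero hd
    exact hCS p hp d (right_ne_zero_of_mul hpd)
  · intro x hx
    rw [Finset.sum_comm]
    simp_rw [← Finset.mul_sum]
    rw [Finset.sum_congr rfl fun p hp => by rw [hCb p hp x]]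
    simp_rw [mul_add]
    rw [Finset.sum_add_distrib, ← Finset.sum_mul, hr]
    simp [hx]

end GridHomology

/-! ### Abstract duals of grid minors -/

section Dual

open Classical in
/-- The boundary map, modulo two, from edge chains to vertex chains of a finite graph. Its kernel is
the cycle space. -/
noncomputable def edgeBoundary {V : Type*} [Fintype V] (G : SimpleGraph V) :
    (G.edgeSet → ZMod 2) →ₗ[ZMod 2] (V → ZMod 2) where
  toFun y v := ∑ e : G.edgeSet, if v ∈ e.1 then y e else 0
  map_add' y z := by
    ext v
    simp only [Pi.add_apply, ← Finset.sum_add_distrib]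
    exact Finset.sum_congr rfl fun e _ => by split_ifs <;> simp
  map_smul' a y := by
    ext v
    simp only [Pi.smul_apply, smul_eq_mul, RingHom.id_apply, Finset.mul_sum]
    exact Finset.sum_congr rfl fun e _ => by split_ifs <;> simp

/-- An abstract dual of a graph: every edge gets two sides among the faces, in such a way that the
cycle space consists of the edge sets across which some set of faces changes. -/
structure AbstractDual {V : Type*} [Fintype V] (G : SimpleGraph V) (ι : Type*) where
  left : G.edgeSet → ι
  right : G.edgeSet → ι
  boundary_eq_zero : ∀ f : ι → ZMod 2, edgeBoundary G (fun e => f (left e) + f (right e)) = 0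
  exists_eq : ∀ z, edgeBoundary G z = 0 → ∃ f : ι → ZMod 2, ∀ e, f (left e) + f (right e) = z e

/-- A presentation of a graph as a minor of the square grid. -/
structure GridMinor {V : Type*} (G : SimpleGraph V) where
  branch : V → Finset (ℤ × ℤ)
  disjoint : ∀ v w p, p ∈ branch v → p ∈ branch w → v = w
  connected : ∀ v, GridConnected (branch v : Set (ℤ × ℤ))
  dart : G.edgeSet → GridDart
  dart_mem : ∀ e, ∃ u v, e.1 = s(u, v) ∧ (dart e).1 ∈ branch u ∧ (dart e).target ∈ branch v

namespace GridMinor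

variable {V : Type*} {G : SimpleGraph V} (M : GridMinor G)

/-- The darts of the grid that are used by the minor. -/
def Used (d : GridDart) : Prop :=
  (∃ v, d.1 ∈ M.branch v ∧ d.target ∈ M.branch v) ∨ ∃ e, d = M.dart e ∨ d = (M.dart e).reverse

open Classical in
/-- The dart of an edge, directed out of a given end. -/
noncomputable def outDart (v : V) (e : G.edgeSet) : GridDart :=
  if (M.dart e).1 ∈ M.branch v then M.dart e else (M.dart e).reverse

theorem outDart_spec {v : V} {e : G.edgeSet} (h : v ∈ e.1) :
    ∃ w, e.1 = s(v, w) ∧ v ≠ w ∧ (M.outDart v e).1 ∈ M.branch v ∧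
      (M.outDart v e).target ∈ M.branch w := by
  obtain ⟨a, b, he, ha, hb⟩ := M.dart_mem e
  have hab : a ≠ b := by
    have := e.2; rw [he] at this; exact G.ne_of_adj this
  rw [he, Sym2.mem_iff] at h
  rcases h with rfl | rfl
  · exact ⟨b, he, hab, by rw [outDart, if_pos ha]; exact ⟨ha, hb⟩⟩
  · have : (M.dart e).1 ∉ M.branch v := fun h => hab (M.disjoint _ _ _ ha h)
    refine ⟨a, by rw [he, Sym2.eq_swap], hab.symm, ?_⟩
    rw [outDart, if_neg this, GridDart.target_reverse]
    exact ⟨hb, ha⟩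

theorem jump_outDart (f : ℤ × ℤ → ZMod 2) (v : V) (e : G.edgeSet) :
    (M.outDart v e).jump f = (M.dart e).jump f := by
  unfold outDart
  split_ifs
  · rfl
  · exact GridDart.jump_reverse f _

theorem outDart_injOn (v : V) : Set.InjOn (M.outDart v) {e | v ∈ e.1} := by
  intro e he e' he' h
  obtain ⟨w, hw, -, -, h2⟩ := M.outDart_spec he
  obtain ⟨w', hw', -, -, h2'⟩ := M.outDart_spec he'
  rw [← h] at h2'
  have := M.disjoint _ _ _ h2 h2'
  exact Subtype.ext (by rw [hw, hw', this])

theorem dart_injective : Function.Injective M.dart := by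
  intro e e' h
  obtain ⟨a, b, he, ha, hb⟩ := M.dart_mem e
  obtain ⟨a', b', he', ha', hb'⟩ := M.dart_mem e'
  rw [← h] at ha' hb'
  exact Subtype.ext (by rw [he, he', M.disjoint _ _ _ ha ha', M.disjoint _ _ _ hb hb'])

theorem dart_ne_reverse (e e' : G.edgeSet) : M.dart e ≠ (M.dart e').reverse := by
  intro h
  obtain ⟨a, b, he, ha, hb⟩ := M.dart_mem e
  obtain ⟨a', b', he', ha', hb'⟩ := M.dart_mem e'
  have h1 : (M.dart e).1 = (M.dart e').target := congrArg Prod.fst h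
  have h2 : (M.dart e).target = (M.dart e').1 := by rw [h, GridDart.target_reverse]
  rw [h1] at ha
  rw [h2] at hb
  have : e = e' := Subtype.ext (by
    rw [he, he', M.disjoint _ _ _ ha hb', M.disjoint _ _ _ hb ha', Sym2.eq_swap])
  subst this
  exact GridDart.reverse_ne _ h.symm

theorem not_internal (e : G.edgeSet) (v : V) :
    ¬ ((M.dart e).1 ∈ M.branch v ∧ (M.dart e).target ∈ M.branch v) := by
  rintro ⟨h1, h2⟩
  obtain ⟨a, b, he, ha, hb⟩ := M.dart_mem e
  have := e.2
  rw [he, M.disjoint _ _ _ ha h1, M.disjoint _ _ _ hb h2] at this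
  exact G.loopless.irrefl _ this

variable [Fintype V]

/-- The jumps of all darts out of the points of `branch v` add up to zero. Darts inside the branch
cancel against their reverses, unused darts contribute nothing, and the remaining ones represent the
edges at `v`. -/
theorem edgeBoundary_jump (f : ℤ × ℤ → ZMod 2) (hf : ∀ d, ¬ M.Used d → d.jump f = 0) :
    edgeBoundary G (fun e => (M.dart e).jump f) = 0 := by
  classical
  ext v
  change (∑ e : G.edgeSet, if v ∈ e.1 then (M.dart e).jump f else 0) = 0
  let D : Finset GridDart := M.branch v ×ˢ Finset.univ
  have hD : ∑ d ∈ D, d.jump f = 0 := by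
    rw [Finset.sum_product]
    exact Finset.sum_eq_zero fun p _ => GridDart.sum_jump f p
  rw [← Finset.sum_filter_add_sum_filter_not D (fun d => d.target ∈ M.branch v)] at hD
  have hint : ∑ d ∈ D with d.target ∈ M.branch v, d.jump f = 0 := by
    refine Finset.sum_involution (fun d _ => d.reverse) ?_ ?_ ?_ ?_
    · intro d _
      rw [GridDart.jump_reverse]
      exact CharTwo.add_self_eq_zero _
    · intro d _ _
      exact d.reverse_ne
    · intro d hd
      simp only [D, Finset.mem_filter, Finset.mem_product, Finset.mem_univ, and_true] at hd ⊢
      rw [GridDart.target_reverse]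
      exact ⟨hd.2, hd.1⟩
    · intro d _
      exact d.reverse_reverse
  rw [hint, zero_add] at hD
  rw [← Finset.sum_filter, ← hD]
  refine Finset.sum_of_injOn (M.outDart v) ?_ ?_ ?_ ?_
  · intro e he e' he' h
    exact M.outDart_injOn v (by simpa using he) (by simpa using he') h
  · intro e he
    obtain ⟨w, -, hvw, h1, h2⟩ := M.outDart_spec (v := v) (e := e) (by simpa using he)
    simp only [D, Finset.coe_filter, Finset.mem_product, Finset.mem_univ, and_true,
      Set.mem_ofPred_eq]
    exact ⟨h1, fun h => hvw (M.disjoint _ _ _ h h2)⟩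
  · intro d hd hd'
    simp only [D, Finset.mem_filter, Finset.mem_product, Finset.mem_univ, and_true] at hd
    apply hf
    rintro (⟨w, h1, h2⟩ | ⟨e, h⟩)
    · rw [M.disjoint _ _ _ h1 hd.1] at h2
      exact hd.2 h2
    · apply hd'
      obtain ⟨a, b, he, ha, hb⟩ := M.dart_mem e
      rcases h with rfl | rfl
      · refine ⟨e, ?_, by rw [outDart, if_pos hd.1]⟩
        simp [he, M.disjoint _ _ _ ha hd.1]
      · have hbv := M.disjoint _ _ _ hb hd.1
        refine ⟨e, by simp [he, hbv], ?_⟩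
        rw [outDart, if_neg]
        rw [← GridDart.target_reverse]
        exact hd.2
  · intro e _
    exact (M.jump_outDart f v e).symm

/-- Put `z` on the darts of the edges. Since `z` is a cycle, the boundary of this chain has even
total on each branch set, so a chain inside the connected branch set cancels it. The sum is closed,
hence a jump function, and the corrections do not touch the darts of the edges. -/
theorem exists_jump_dart_eq (z : G.edgeSet → ZMod 2) (hz : edgeBoundary G z = 0) :
    ∃ f, (∀ d, ¬ M.Used d → d.jump f = 0) ∧ ∀ e, (M.dart e).jump f = z e := by
  classical
  let c₀ : GridDart → ZMod 2 := fun d => ∑ e, z e *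
    ((if d = M.dart e then 1 else 0) + (if d = (M.dart e).reverse then 1 else 0))
  have hc₀ : ∀ d : GridDart, c₀ d.reverse = c₀ d := by
    intro d
    refine Finset.sum_congr rfl fun e _ => ?_
    have h1 : d.reverse = (M.dart e).reverse ↔ d = M.dart e :=
      ⟨fun h => by simpa using congrArg GridDart.reverse h, fun h => by rw [h]⟩
    have h2 : d.reverse = M.dart e ↔ d = (M.dart e).reverse :=
      ⟨fun h => by rw [← h]; simp, fun h => by rw [h]; simp⟩
    simp only [h1, h2, add_comm (if d = M.dart e then (1 : ZMod 2) else 0)]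
  have hb₀ : ∀ p, ∑ i, c₀ (p, i) = ∑ e, z e *
      ((if p = (M.dart e).1 then 1 else 0) + (if p = (M.dart e).target then 1 else 0)) := by
    intro p
    have single : ∀ d : GridDart,
        ∑ j, (if (p, j) = d then (1 : ZMod 2) else 0) = if p = d.1 then 1 else 0 := by
      rintro ⟨y, k⟩
      by_cases hxy : p = y <;> simp [hxy]
    simp only [c₀]
    rw [Finset.sum_comm]
    refine Finset.sum_congr rfl fun e _ => ?_
    rw [← Finset.mul_sum, Finset.sum_add_distrib, single, single, GridDart.reverse_fst]
  have hsum : ∀ v, ∑ p ∈ M.branch v, ∑ i, c₀ (p, i) = 0 := by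
    intro v
    have := congrFun hz v
    change (∑ e : G.edgeSet, if v ∈ e.1 then z e else 0) = 0 at this
    rw [← this]
    simp_rw [hb₀]
    rw [Finset.sum_comm]
    refine Finset.sum_congr rfl fun e _ => ?_
    rw [← Finset.mul_sum, Finset.sum_add_distrib, Finset.sum_ite_eq', Finset.sum_ite_eq']
    obtain ⟨a, b, he, ha, hb⟩ := M.dart_mem e
    have hab : a ≠ b := by
      have := e.2; rw [he] at this; exact G.ne_of_adj this
    have h1 : (M.dart e).1 ∈ M.branch v ↔ v = a :=
      ⟨fun h => M.disjoint _ _ _ h ha, fun h => h ▸ ha⟩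
    have h2 : (M.dart e).target ∈ M.branch v ↔ v = b :=
      ⟨fun h => M.disjoint _ _ _ h hb, fun h => h ▸ hb⟩
    rw [he]
    simp only [h1, h2, Sym2.mem_iff]
    by_cases hva : v = a
    · have : v ≠ b := fun h => hab (hva ▸ h)
      simp [hva, hab]
    · by_cases hvb : v = b <;> simp [hva, hvb, hab.symm]
  choose c hc hcB hcb using fun v =>
    exists_chain_of_sum_eq_zero (M.connected v) (fun p => ∑ i, c₀ (p, i)) (hsum v)
  have hc₀U : ∀ d, c₀ d ≠ 0 → ∃ e, d = M.dart e ∨ d = (M.dart e).reverse := by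
    intro d hd
    obtain ⟨e, -, he⟩ := Finset.exists_ne_zero_of_sum_ne_zero hd
    refine ⟨e, ?_⟩
    by_contra! hne
    simp [hne] at he
  have hsupp : ∀ d, ¬ M.Used d → c₀ d + ∑ v, c v d = 0 := by
    intro d hd
    have h1 : c₀ d = 0 := by
      by_contra h
      exact hd (Or.inr (hc₀U d h))
    rw [h1, zero_add]
    refine Finset.sum_eq_zero fun v _ => ?_
    by_contra h
    exact hd (Or.inl ⟨v, hcB v d h⟩)
  have hmem : ∀ d, M.Used d → ∃ v, d.1 ∈ M.branch v := by
    rintro d (⟨v, h, -⟩ | ⟨e, rfl | rfl⟩)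
    · exact ⟨v, h⟩
    · obtain ⟨a, b, he, ha, hb⟩ := M.dart_mem e
      exact ⟨a, ha⟩
    · obtain ⟨a, b, he, ha, hb⟩ := M.dart_mem e
      exact ⟨b, hb⟩
  obtain ⟨N, hN⟩ := ((Finset.univ.biUnion M.branch).image Prod.fst).bddBelow
  have hleft : ∀ p i, p.1 < N → c₀ (p, i) + ∑ v, c v (p, i) = 0 := by
    intro p i hp
    refine hsupp _ fun hU => ?_
    obtain ⟨v, hv⟩ := hmem _ hU
    exact absurd hp (not_lt.2 (hN (Finset.mem_image_of_mem _
      (Finset.mem_biUnion.2 ⟨v, Finset.mem_univ v, hv⟩))))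
  have hclosed : ∀ p, ∑ i, (c₀ (p, i) + ∑ v, c v (p, i)) = 0 := by
    intro p
    by_cases hp : ∃ v, p ∈ M.branch v
    · obtain ⟨v, hv⟩ := hp
      have h : ∑ i, ∑ w, c w (p, i) = ∑ i, c₀ (p, i) := by
        rw [Finset.sum_comm, Finset.sum_eq_single v, hcb v p hv]
        · intro w _ hwv
          refine Finset.sum_eq_zero fun i _ => ?_
          by_contra h
          exact hwv (M.disjoint _ _ _ (hcB w _ h).1 hv)
        · simp
      rw [Finset.sum_add_distrib, h]
      exact CharTwo.add_self_eq_zero _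
    · exact Finset.sum_eq_zero fun i _ => hsupp _ fun hU => hp (hmem _ hU)
  obtain ⟨f, hf⟩ := GridDart.exists_jump_eq (fun d => c₀ d + ∑ v, c v d)
    (fun d => by simp only [hc₀, hc]) N hleft hclosed
  refine ⟨f, fun d hd => by rw [hf, hsupp d hd], fun e => ?_⟩
  rw [hf]
  have h1 : ∑ v, c v (M.dart e) = 0 := Finset.sum_eq_zero fun v _ => by
    by_contra h
    exact M.not_internal e v (hcB v _ h)
  rw [h1, add_zero]
  simp [c₀, M.dart_ne_reverse, M.dart_injective.eq_iff]

/-- Faces are unit squares modulo crossing unused darts; a function on squares descends to them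
exactly when it has no jump across unused darts. -/
theorem exists_abstractDual (M : GridMinor G) : ∃ ι : Type, Nonempty (AbstractDual G ι) := by
  let r : ℤ × ℤ → ℤ × ℤ → Prop := fun a b => ∃ d, ¬ M.Used d ∧ a = d.left ∧ b = d.right
  refine ⟨Quot r, ⟨fun e => Quot.mk r (M.dart e).left, fun e => Quot.mk r (M.dart e).right,
    fun f => ?_, fun z hz => ?_⟩⟩
  · refine M.edgeBoundary_jump (fun a => f (Quot.mk r a)) fun d hd => ?_
    have : Quot.mk r d.left = Quot.mk r d.right := Quot.sound ⟨d, hd, rfl, rfl⟩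
    simp only [GridDart.jump, this]
    exact CharTwo.add_self_eq_zero _
  · obtain ⟨f, hf, hfz⟩ := M.exists_jump_dart_eq z hz
    refine ⟨Quot.lift f ?_, hfz⟩
    rintro a b ⟨d, hd, rfl, rfl⟩
    have := hf d hd
    rw [GridDart.jump, CharTwo.add_eq_zero] at this
    exact this

end GridMinor

end Dual

/-! ### From overlapping vertex and edge sets to a grid minor -/

section GridModel

theorem GridConnected.symm_path {S : Set (ℤ × ℤ)} {p q : ℤ × ℤ} (hp : p ∈ S)
    (h : Relation.ReflTransGen (fun a b => b ∈ S ∧ ∃ i, b = gridStep a i) p q) :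
    q ∈ S ∧ Relation.ReflTransGen (fun a b => b ∈ S ∧ ∃ i, b = gridStep a i) q p := by
  induction h with
  | refl => exact ⟨hp, .refl⟩
  | @tail a b _ hab ih =>
    obtain ⟨hb, i, rfl⟩ := hab
    refine ⟨hb, ih.2.head ⟨ih.1, i + 2, ?_⟩⟩
    exact (GridDart.target_reverse (a, i)).symm

theorem GridConnected.of_core {X S : Set (ℤ × ℤ)} (hX : GridConnected X) (hXS : X ⊆ S)
    (h : ∀ p ∈ S, ∃ x ∈ X,
      Relation.ReflTransGen (fun a b => b ∈ S ∧ ∃ i, b = gridStep a i) x p) :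
    GridConnected S := by
  intro p hp q hq
  obtain ⟨x, hx, hxp⟩ := h p hp
  obtain ⟨y, hy, hyq⟩ := h q hq
  have h1 := (GridConnected.symm_path (hXS hx) hxp).2
  have h2 : Relation.ReflTransGen (fun a b => b ∈ S ∧ ∃ i, b = gridStep a i) x y :=
    Relation.ReflTransGen.mono (fun a b hab => ⟨hXS hab.1, hab.2⟩) _ _ (hX x hx y hy)
  exact (h1.trans h2).trans hyq

/-- A presentation of a graph by connected sets of grid points, one for every vertex and one for
every edge, that meet exactly as vertices and edges do. -/
structure GridModel {V : Type*} (G : SimpleGraph V) where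
  vert : V → Finset (ℤ × ℤ)
  edge : G.edgeSet → Finset (ℤ × ℤ)
  vert_connected : ∀ v, GridConnected (vert v : Set (ℤ × ℤ))
  edge_connected : ∀ e, GridConnected (edge e : Set (ℤ × ℤ))
  vert_disjoint : ∀ v w p, p ∈ vert v → p ∈ vert w → v = w
  edge_disjoint : ∀ e f p, p ∈ edge e → p ∈ edge f → e = f
  mem_of_mem : ∀ e v p, p ∈ edge e → p ∈ vert v → v ∈ e.1
  exists_mem : ∀ (e : G.edgeSet), ∀ v ∈ e.1, ∃ p ∈ edge e, p ∈ vert v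

namespace GridModel

variable {V : Type*} {G : SimpleGraph V} (M : GridModel G)

/-- The points of an edge that can be reached from its end `a` without touching its end `b`. -/
def Reach (e : G.edgeSet) (a b : V) (p : ℤ × ℤ) : Prop :=
  p ∈ M.edge e ∧ p ∉ M.vert b ∧ ∃ q ∈ M.vert a, q ∈ M.edge e ∧ q ∉ M.vert b ∧
    Relation.ReflTransGen
      (fun x y => (y ∈ M.edge e ∧ y ∉ M.vert b) ∧ ∃ i, y = gridStep x i) q p

/-- Otherwise no walk along the edge set from the side of `a` could step into `vert b`; as the edge
set is connected, all of it would avoid `vert b`, which it meets. -/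
theorem exists_exit {e : G.edgeSet} {a b : V} (he : e.1 = s(a, b)) :
    ∃ p i, M.Reach e a b p ∧ gridStep p i ∈ M.vert b := by
  have hab : a ≠ b := by
    have := e.2; rw [he] at this; exact G.ne_of_adj this
  obtain ⟨p, hpe, hpa⟩ := M.exists_mem e a (by simp [he])
  obtain ⟨q, hqe, hqb⟩ := M.exists_mem e b (by simp [he])
  have hpb : p ∉ M.vert b := fun h => hab (M.vert_disjoint _ _ _ hpa h)
  by_contra! hno
  have key : ∀ x, Relation.ReflTransGen
      (fun x y => y ∈ (M.edge e : Set (ℤ × ℤ)) ∧ ∃ i, y = gridStep x i) p x →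
      M.Reach e a b x := by
    intro x hx
    induction hx with
    | refl => exact ⟨hpe, hpb, p, hpa, hpe, hpb, .refl⟩
    | @tail x y _ hxy ih =>
      obtain ⟨hy, i, rfl⟩ := hxy
      have hyb := hno x i ih
      obtain ⟨-, -, q, hq1, hq2, hq3, hq⟩ := ih
      exact ⟨hy, hyb, q, hq1, hq2, hq3, hq.tail ⟨⟨hy, hyb⟩, i, rfl⟩⟩
  exact (key q (M.edge_connected e p hpe q hqe)).2.1 hqb

open Classical in
theorem nonempty_gridMinor [Fintype V] (M : GridModel G) : Nonempty (GridMinor G) := by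
  have H : ∀ e : G.edgeSet, ∃ a b, e.1 = s(a, b) := fun e => by
    obtain ⟨e, he⟩ := e
    induction e using Sym2.ind with
    | _ a b => exact ⟨a, b, rfl⟩
  choose a b hab using H
  choose x i hx hxb using fun e => M.exists_exit (hab e)
  -- The part of an edge set reachable from `a e` off `vert (b e)` is absorbed into the branch of `a
  -- e`; the step from that part into `vert (b e)` becomes the dart of the edge.
  let B : V → Finset (ℤ × ℤ) := fun v => M.vert v ∪
    (Finset.univ.filter fun e => a e = v).biUnion fun e =>
      (M.edge e).filter (M.Reach e (a e) (b e))
  have hB : ∀ v p, p ∈ B v ↔ p ∈ M.vert v ∨ ∃ e, a e = v ∧ M.Reach e (a e) (b e) p := by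
    intro v p
    simp only [B, Finset.mem_union, Finset.mem_biUnion, Finset.mem_filter, Finset.mem_univ,
      true_and]
    exact or_congr_right ⟨fun ⟨e, h1, h2⟩ => ⟨e, h1, h2.2⟩, fun ⟨e, h1, h2⟩ => ⟨e, h1, h2.1, h2⟩⟩
  have hmix : ∀ v p e, p ∈ M.vert v → M.Reach e (a e) (b e) p → a e = v := by
    intro v p e hp hr
    have hv := M.mem_of_mem e v p hr.1 hp
    rw [hab e, Sym2.mem_iff] at hv
    rcases hv with h | h
    · exact h.symm
    · exact absurd (h ▸ hp) hr.2.1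
  refine ⟨⟨B, ?_, ?_, fun e => (x e, i e), ?_⟩⟩
  · intro v w p hv hw
    rcases (hB _ _).1 hv with hv | ⟨e, rfl, he⟩ <;> rcases (hB _ _).1 hw with hw | ⟨f, rfl, hf⟩
    · exact M.vert_disjoint _ _ _ hv hw
    · exact (hmix _ _ _ hv hf).symm
    · exact hmix _ _ _ hw he
    · rw [M.edge_disjoint _ _ _ he.1 hf.1]
  · intro v
    refine (M.vert_connected v).of_core (fun p hp => (hB _ _).2 (Or.inl hp)) ?_
    intro p hp
    rcases (hB _ _).1 hp with hp | ⟨e, rfl, he⟩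
    · exact ⟨p, hp, .refl⟩
    · obtain ⟨-, -, q, hq1, hq2, hq3, hq⟩ := he
      refine ⟨q, hq1, ?_⟩
      clear hp
      induction hq with
      | refl => exact .refl
      | @tail y z hqy hyz ih =>
        exact ih.tail ⟨(hB _ _).2 (Or.inr ⟨e, rfl, hyz.1.1, hyz.1.2, q, hq1, hq2, hq3,
          hqy.tail hyz⟩), hyz.2⟩
  · intro e
    exact ⟨a e, b e, hab e, (hB _ _).2 (Or.inr ⟨e, rfl, hx e⟩), (hB _ _).2 (Or.inl (hxb e))⟩

end GridModel

end GridModel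

/-! ### Approximation of compact plane sets by grid squares -/

section Pixels

open Filter Topology

/-- The closed square of side `1 / N` with lower left corner `q / N`. -/
def pixelSquare (N : ℕ) (q : ℤ × ℤ) : Set (ℝ × ℝ) :=
  {x | (q.1 ≤ N * x.1 ∧ N * x.1 ≤ q.1 + 1) ∧ (q.2 ≤ N * x.2 ∧ N * x.2 ≤ q.2 + 1)}

/-- The closed squares of side `1 / N` that meet a given set. -/
def pixels (N : ℕ) (K : Set (ℝ × ℝ)) : Set (ℤ × ℤ) :=
  {q | ∃ x ∈ K, x ∈ pixelSquare N q}

theorem isClosed_pixelSquare (N : ℕ) (q : ℤ × ℤ) : IsClosed (pixelSquare N q) := by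
  refine .and (.and ?_ ?_) (.and ?_ ?_) <;> exact isClosed_le (by fun_prop) (by fun_prop)

theorem mem_pixelSquare_floor (N : ℕ) (x : ℝ × ℝ) :
    x ∈ pixelSquare N (⌊N * x.1⌋, ⌊N * x.2⌋) :=
  ⟨⟨Int.floor_le _, (Int.lt_floor_add_one _).le⟩, ⟨Int.floor_le _, (Int.lt_floor_add_one _).le⟩⟩

theorem finite_pixels (N : ℕ) {K : Set (ℝ × ℝ)} (hK : IsCompact K) : (pixels N K).Finite := by
  obtain ⟨R, hR⟩ := hK.isBounded.exists_norm_le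
  refine Set.Finite.subset ((Set.finite_Icc ⌊-(N * R) - 1⌋ ⌈N * R⌉).prod
    (Set.finite_Icc ⌊-(N * R) - 1⌋ ⌈N * R⌉)) ?_
  rintro q ⟨x, hx, ⟨h1, h2⟩, h3, h4⟩
  have hx' := hR x hx
  have hN : (0 : ℝ) ≤ N := Nat.cast_nonneg N
  have key : ∀ (m : ℤ) (t : ℝ), ‖t‖ ≤ ‖x‖ → m ≤ N * t → N * t ≤ m + 1 →
      m ∈ Set.Icc ⌊-(N * R) - 1⌋ ⌈N * R⌉ := by
    intro m t ht hm1 hm2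
    have := abs_le.1 ((Real.norm_eq_abs t ▸ ht).trans hx')
    have hl := mul_le_mul_of_nonneg_left this.1 hN
    have hu := mul_le_mul_of_nonneg_left this.2 hN
    constructor
    · have : (⌊-(N * R) - 1⌋ : ℝ) ≤ m := (Int.floor_le _).trans (by linarith)
      exact_mod_cast this
    · have : (m : ℝ) ≤ ⌈N * R⌉ := le_trans (by linarith) (Int.le_ceil _)
      exact_mod_cast this
  exact ⟨key _ _ (norm_fst_le x) h1 h2, key _ _ (norm_snd_le x) h3 h4⟩

/-- If the pixels split into two parts, the squares of each part would form closed sets covering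
`K`; by connectedness a square of one part and a square of the other share a point of `K`. -/
theorem gridConnected_pixels (N : ℕ) {K : Set (ℝ × ℝ)} (hK : IsCompact K)
    (hc : IsPreconnected K) : GridConnected (pixels N K) := by
  intro p hp q hq
  set R := fun a b : ℤ × ℤ => b ∈ pixels N K ∧ ∃ i, b = gridStep a i with hR
  by_contra hpq
  let S₁ := {a ∈ pixels N K | Relation.ReflTransGen R p a}
  let S₂ := {a ∈ pixels N K | ¬ Relation.ReflTransGen R p a}
  have closed : ∀ S ⊆ pixels N K, IsClosed (⋃ a ∈ S, pixelSquare N a) := fun S hS =>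
    ((finite_pixels N hK).subset hS).isClosed_biUnion fun a _ => isClosed_pixelSquare N a
  have hcover : K ⊆ (⋃ a ∈ S₁, pixelSquare N a) ∪ ⋃ a ∈ S₂, pixelSquare N a := by
    intro x hx
    have hm := mem_pixelSquare_floor N x
    set a : ℤ × ℤ := (⌊N * x.1⌋, ⌊N * x.2⌋)
    have ha : a ∈ pixels N K := ⟨x, hx, hm⟩
    by_cases h : Relation.ReflTransGen R p a
    · exact Or.inl (Set.mem_biUnion (show a ∈ S₁ from ⟨ha, h⟩) hm)
    · exact Or.inr (Set.mem_biUnion (show a ∈ S₂ from ⟨ha, h⟩) hm)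
  have hne : ∀ S ⊆ pixels N K, S.Nonempty → (K ∩ ⋃ a ∈ S, pixelSquare N a).Nonempty := by
    rintro S hS ⟨a, ha⟩
    obtain ⟨x, hx, hxa⟩ := hS ha
    exact ⟨x, hx, Set.mem_biUnion ha hxa⟩
  obtain ⟨x, hx, hx1, hx2⟩ := isPreconnected_closed_iff.1 hc _ _
    (closed S₁ (Set.sep_subset _ _)) (closed S₂ (Set.sep_subset _ _)) hcover
    (hne S₁ (Set.sep_subset _ _) ⟨p, hp, .refl⟩) (hne S₂ (Set.sep_subset _ _) ⟨q, hq, hpq⟩)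
  simp only [Set.mem_iUnion, exists_prop] at hx1 hx2
  obtain ⟨⟨a₁, a₂⟩, ha, ⟨ha1, ha2⟩, ha3, ha4⟩ := hx1
  obtain ⟨⟨b₁, b₂⟩, hb, ⟨hb1, hb2⟩, hb3, hb4⟩ := hx2
  apply hb.2
  simp only at ha1 ha2 ha3 ha4 hb1 hb2 hb3 hb4
  -- The two squares may touch at a corner only. The square with mixed coordinates contains the same
  -- point of `K`, so it is a pixel and links them by unit steps.
  have hm : ((b₁, a₂) : ℤ × ℤ) ∈ pixels N K := ⟨x, hx, ⟨hb1, hb2⟩, ha3, ha4⟩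
  have e1 : a₁ = b₁ ∨ b₁ = a₁ + 1 ∨ b₁ = a₁ - 1 := by
    have h1 : a₁ ≤ b₁ + 1 := by exact_mod_cast ha1.trans hb2
    have h2 : b₁ ≤ a₁ + 1 := by exact_mod_cast hb1.trans ha2
    lia
  have e2 : a₂ = b₂ ∨ b₂ = a₂ + 1 ∨ b₂ = a₂ - 1 := by
    have h1 : a₂ ≤ b₂ + 1 := by exact_mod_cast ha3.trans hb4
    have h2 : b₂ ≤ a₂ + 1 := by exact_mod_cast hb3.trans ha4
    lia
  have s1 : Relation.ReflTransGen R p (b₁, a₂) := by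
    rcases e1 with rfl | h | h
    · exact ha.2
    · exact ha.2.tail ⟨hm, 0, by simp [gridStep, h]⟩
    · exact ha.2.tail ⟨hm, 2, by simp [gridStep, h]⟩
  rcases e2 with rfl | h | h
  · exact s1
  · exact s1.tail ⟨hb.1, 1, by simp [gridStep, h]⟩
  · exact s1.tail ⟨hb.1, 3, by simp [gridStep, h]⟩

/-- Points of one pixel are at sup distance at most `1 / N`, while disjoint compact sets are a
positive distance apart. -/
theorem eventually_disjoint_pixels {K L : Set (ℝ × ℝ)} (hK : IsCompact K) (hL : IsCompact L)
    (h : Disjoint K L) : ∀ᶠ N : ℕ in atTop, Disjoint (pixels N K) (pixels N L) := by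
  obtain ⟨δ, hδ, hd⟩ := h.exists_thickenings hK hL.isClosed
  obtain ⟨N₀, hN₀⟩ := exists_nat_gt δ⁻¹
  filter_upwards [eventually_ge_atTop N₀] with N hN
  rw [Set.disjoint_left]
  rintro q ⟨x, hx, ⟨h1, h2⟩, h3, h4⟩ ⟨y, hy, ⟨h5, h6⟩, h7, h8⟩
  have hNδ : 1 < N * δ := by
    have : δ⁻¹ < N := hN₀.trans_le (by exact_mod_cast hN)
    rwa [inv_lt_iff_one_lt_mul₀ hδ] at this
  have hN0 : (0 : ℝ) < N := by
    by_contra h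
    have : (N : ℝ) * δ ≤ 0 := mul_nonpos_of_nonpos_of_nonneg (not_lt.1 h) hδ.le
    linarith
  have key : ∀ s t : ℝ, N * s ≤ N * t + 1 → N * t ≤ N * s + 1 → |s - t| < δ := by
    intro s t hs ht
    rw [abs_lt]
    constructor <;> refine lt_of_mul_lt_mul_left ?_ hN0.le <;> linarith
  have hxy : dist x y < δ := by
    rw [Prod.dist_eq, Real.dist_eq, Real.dist_eq]
    exact max_lt (key _ _ (by linarith) (by linarith)) (key _ _ (by linarith) (by linarith))
  exact Set.disjoint_left.1 hd (Metric.self_subset_thickening hδ K hx)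
    (Metric.mem_thickening_iff.2 ⟨y, hy, hxy⟩)

end Pixels

/-! ### From a drawing to an abstract dual -/

section Drawing

open Filter Topology unitInterval

variable {V : Type*} {G : SimpleGraph V}

namespace PlaneDrawing

variable (D : PlaneDrawing G)

/-- A parametrized arc of a drawing that represents a given edge. -/
structure ParamArc (e : G.edgeSet) where
  src : V
  tgt : V
  eq : e.1 = s(src, tgt)
  path : Path (D.point src) (D.point tgt)
  injective : Function.Injective path
  range_eq : Set.range path = D.arc e.1

theorem nonempty_paramArc (e : G.edgeSet) : Nonempty (D.ParamArc e) := by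
  obtain ⟨e, he⟩ := e
  induction e using Sym2.ind with
  | _ a b =>
    obtain ⟨γ, hγ, hr⟩ := D.isArc a b he
    exact ⟨⟨a, b, rfl, γ, hγ, hr⟩⟩

end PlaneDrawing

namespace PlaneDrawing.ParamArc

variable {D : PlaneDrawing G} {e : G.edgeSet} (A : D.ParamArc e)

theorem src_ne_tgt : A.src ≠ A.tgt := by
  have := e.2; rw [A.eq] at this; exact G.ne_of_adj this

noncomputable def third : I := ⟨1 / 3, by norm_num, by norm_num⟩

noncomputable def twoThirds : I := ⟨2 / 3, by norm_num, by norm_num⟩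

open Classical in
/-- The third of the arc next to a given end. -/
def near (v : V) : Set (ℝ × ℝ) :=
  if v = A.src then A.path '' Set.Icc 0 third else A.path '' Set.Icc twoThirds 1

/-- The middle third of the arc. -/
def middle : Set (ℝ × ℝ) := A.path '' Set.Icc third twoThirds

theorem near_src : A.near A.src = A.path '' Set.Icc 0 third := if_pos rfl

theorem near_tgt : A.near A.tgt = A.path '' Set.Icc twoThirds 1 := if_neg A.src_ne_tgt.symm

theorem isCompact_near (v : V) : IsCompact (A.near v) := by
  unfold near
  split_ifs <;> exact isCompact_Icc.image A.path.continuous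

theorem isPreconnected_near (v : V) : IsPreconnected (A.near v) := by
  unfold near
  split_ifs <;> exact isPreconnected_Icc.image _ A.path.continuous.continuousOn

theorem isCompact_middle : IsCompact A.middle := isCompact_Icc.image A.path.continuous

theorem isPreconnected_middle : IsPreconnected A.middle :=
  isPreconnected_Icc.image _ A.path.continuous.continuousOn

theorem near_subset (v : V) : A.near v ⊆ D.arc e.1 := by
  rw [← A.range_eq]
  unfold near
  split_ifs <;> exact Set.image_subset_range _ _

theorem middle_subset : A.middle ⊆ D.arc e.1 := by
  rw [← A.range_eq]
  exact Set.image_subset_range _ _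

theorem zero_lt_third : (0 : I) < third := Subtype.mk_lt_mk.2 (by norm_num)

theorem third_lt_twoThirds : third < twoThirds := Subtype.mk_lt_mk.2 (by norm_num)

theorem twoThirds_lt_one : twoThirds < (1 : I) := Subtype.mk_lt_mk.2 (by norm_num)

theorem eq_src_or_tgt {v : V} (hv : v ∈ e.1) : v = A.src ∨ v = A.tgt := by
  rwa [A.eq, Sym2.mem_iff] at hv

theorem param_of_point {u : V} {t : I} (h : A.path t = D.point u) :
    (u = A.src ∧ t = 0) ∨ (u = A.tgt ∧ t = 1) := by
  have hu : u ∈ e.1 := D.mem_of_point_mem_arc _ e.2 u (by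
    rw [← A.range_eq]; exact ⟨t, h⟩)
  rcases A.eq_src_or_tgt hu with rfl | rfl
  · exact Or.inl ⟨rfl, A.injective (by rw [h, A.path.source])⟩
  · exact Or.inr ⟨rfl, A.injective (by rw [h, A.path.target])⟩

theorem point_mem_near {v : V} (hv : v ∈ e.1) : D.point v ∈ A.near v := by
  rcases A.eq_src_or_tgt hv with rfl | rfl
  · rw [near_src]
    exact ⟨0, ⟨le_rfl, zero_lt_third.le⟩, A.path.source⟩
  · rw [near_tgt]
    exact ⟨1, ⟨twoThirds_lt_one.le, le_rfl⟩, A.path.target⟩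

theorem eq_of_point_mem_near {u v : V} (hv : v ∈ e.1) (h : D.point u ∈ A.near v) : u = v := by
  rcases A.eq_src_or_tgt hv with rfl | rfl
  · rw [near_src] at h
    obtain ⟨t, ht, h⟩ := h
    rcases A.param_of_point h with h | ⟨-, rfl⟩
    · exact h.1
    · exact absurd (ht.2.trans_lt third_lt_twoThirds) twoThirds_lt_one.le.not_gt
  · rw [near_tgt] at h
    obtain ⟨t, ht, h⟩ := h
    rcases A.param_of_point h with ⟨-, rfl⟩ | h
    · exact absurd (zero_lt_third.trans third_lt_twoThirds) ht.1.not_gt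
    · exact h.1

theorem point_notMem_middle (u : V) : D.point u ∉ A.middle := by
  rintro ⟨t, ht, h⟩
  rcases A.param_of_point h with ⟨-, rfl⟩ | ⟨-, rfl⟩
  · exact ht.1.not_gt zero_lt_third
  · exact ht.2.not_gt twoThirds_lt_one

theorem disjoint_near {v w : V} (hv : v ∈ e.1) (hw : w ∈ e.1) (hvw : v ≠ w) :
    Disjoint (A.near v) (A.near w) := by
  have key : Disjoint (A.near A.src) (A.near A.tgt) := by
    rw [near_src, near_tgt, Set.disjoint_image_iff A.injective, Set.disjoint_left]
    intro t h1 h2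
    exact absurd (h2.1.trans h1.2) third_lt_twoThirds.not_ge
  rcases A.eq_src_or_tgt hv with rfl | rfl <;> rcases A.eq_src_or_tgt hw with rfl | rfl
  · exact absurd rfl hvw
  · exact key
  · exact key.symm
  · exact absurd rfl hvw

theorem exists_mem_near_middle {v : V} (hv : v ∈ e.1) : ∃ x ∈ A.middle, x ∈ A.near v := by
  rcases A.eq_src_or_tgt hv with rfl | rfl
  · rw [near_src]
    exact ⟨A.path third, ⟨third, ⟨le_rfl, third_lt_twoThirds.le⟩, rfl⟩,
      ⟨third, ⟨zero_lt_third.le, le_rfl⟩, rfl⟩⟩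
  · rw [near_tgt]
    exact ⟨A.path twoThirds, ⟨twoThirds, ⟨third_lt_twoThirds.le, le_rfl⟩, rfl⟩,
      ⟨twoThirds, ⟨le_rfl, twoThirds_lt_one.le⟩, rfl⟩⟩

end PlaneDrawing.ParamArc

theorem PlaneDrawing.exists_point_of_mem_arc (D : PlaneDrawing G) {e f : G.edgeSet} (h : e ≠ f)
    {x : ℝ × ℝ} (he : x ∈ D.arc e.1) (hf : x ∈ D.arc f.1) : ∃ u, D.point u = x := by
  obtain ⟨u, -, hu⟩ := D.arc_inter_arc _ e.2 _ f.2 (fun h' => h (Subtype.ext h')) ⟨he, hf⟩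
  exact ⟨u, hu⟩

/-- Whole arcs touch at common ends, so they cannot be separated by a mesh. Instead a vertex takes
its point with the nearest third of each of its arcs, and an edge takes the middle third. These
compact sets are disjoint except for an incident vertex and edge, which share an endpoint of the
middle third, and a fine mesh keeps disjoint pairs disjoint. -/
theorem PlaneDrawing.nonempty_gridModel [Fintype V] (D : PlaneDrawing G) :
    Nonempty (GridModel G) := by
  classical
  have A : ∀ e, D.ParamArc e := fun e => (D.nonempty_paramArc e).some
  let K : V → Set (ℝ × ℝ) := fun v => {D.point v} ∪ ⋃ e ∈ {e : G.edgeSet | v ∈ e.1}, (A e).near v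
  have hK : ∀ v, IsCompact (K v) := fun v => isCompact_singleton.union
    ((Set.toFinite _).isCompact_biUnion fun e _ => (A e).isCompact_near v)
  have hKc : ∀ v, IsPreconnected (K v) := by
    intro v
    refine isPreconnected_of_forall (D.point v) fun y hy => ?_
    rcases hy with rfl | hy
    · exact ⟨{D.point v}, Set.subset_union_left, rfl, rfl, isPreconnected_singleton⟩
    · simp only [Set.mem_iUnion, exists_prop] at hy
      obtain ⟨e, he, hy⟩ := hy
      exact ⟨(A e).near v, Set.subset_union_of_subset_right (Set.subset_biUnion_of_mem
        (u := fun e => (A e).near v) he) _, (A e).point_mem_near he, hy,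
        (A e).isPreconnected_near v⟩
  have memK : ∀ {v x}, x ∈ K v → x = D.point v ∨ ∃ e : G.edgeSet, v ∈ e.1 ∧ x ∈ (A e).near v := by
    intro v x hx
    rcases hx with rfl | hx
    · exact Or.inl rfl
    · simp only [Set.mem_iUnion, exists_prop] at hx
      exact Or.inr hx
  have dVV : ∀ v w, v ≠ w → Disjoint (K v) (K w) := by
    intro v w hvw
    rw [Set.disjoint_left]
    intro x hv hw
    rcases memK hv with rfl | ⟨e, hve, hv⟩ <;> rcases memK hw with h | ⟨f, hwf, hw⟩
    · exact hvw (D.point_injective h)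
    · exact hvw ((A f).eq_of_point_mem_near hwf hw)
    · subst h
      exact hvw ((A e).eq_of_point_mem_near hve hv).symm
    · by_cases hef : e = f
      · subst hef
        exact Set.disjoint_left.1 ((A e).disjoint_near hve hwf hvw) hv hw
      · obtain ⟨u, rfl⟩ := D.exists_point_of_mem_arc hef ((A e).near_subset v hv)
          ((A f).near_subset w hw)
        exact hvw (((A e).eq_of_point_mem_near hve hv).symm.trans
          ((A f).eq_of_point_mem_near hwf hw))
  have dEE : ∀ e f, e ≠ f → Disjoint (A e).middle (A f).middle := by
    intro e f hef
    rw [Set.disjoint_left]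
    intro x he hf
    obtain ⟨u, rfl⟩ := D.exists_point_of_mem_arc hef ((A e).middle_subset he)
      ((A f).middle_subset hf)
    exact (A e).point_notMem_middle u he
  have dEV : ∀ (e : G.edgeSet) v, v ∉ e.1 → Disjoint (A e).middle (K v) := by
    intro e v hve
    rw [Set.disjoint_left]
    intro x he hv
    rcases memK hv with rfl | ⟨f, hvf, hv⟩
    · exact (A e).point_notMem_middle _ he
    · have hef : e ≠ f := by rintro rfl; exact hve hvf
      obtain ⟨u, rfl⟩ := D.exists_point_of_mem_arc hef ((A e).middle_subset he)
        ((A f).near_subset v hv)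
      exact (A e).point_notMem_middle u he
  have ev : ∀ᶠ N : ℕ in atTop, (∀ v w, v ≠ w → Disjoint (pixels N (K v)) (pixels N (K w))) ∧
      (∀ e f, e ≠ f → Disjoint (pixels N (A e).middle) (pixels N (A f).middle)) ∧
      ∀ (e : G.edgeSet) v, v ∉ e.1 → Disjoint (pixels N (A e).middle) (pixels N (K v)) := by
    simp only [eventually_and, eventually_all]
    exact ⟨fun v w h => eventually_disjoint_pixels (hK v) (hK w) (dVV v w h),
      fun e f h => eventually_disjoint_pixels (A e).isCompact_middle (A f).isCompact_middle
        (dEE e f h),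
      fun e v h => eventually_disjoint_pixels (A e).isCompact_middle (hK v) (dEV e v h)⟩
  obtain ⟨N, hVV, hEE, hEV⟩ := ev.exists
  have fV := fun v => finite_pixels N (hK v)
  have fE := fun e => finite_pixels N (A e).isCompact_middle
  refine ⟨⟨fun v => (fV v).toFinset, fun e => (fE e).toFinset, ?_, ?_, ?_, ?_, ?_, ?_⟩⟩
  · intro v
    rw [Set.Finite.coe_toFinset]
    exact gridConnected_pixels N (hK v) (hKc v)
  · intro e
    rw [Set.Finite.coe_toFinset]
    exact gridConnected_pixels N (A e).isCompact_middle (A e).isPreconnected_middle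
  · intro v w p hv hw
    by_contra h
    exact Set.disjoint_left.1 (hVV v w h) ((fV v).mem_toFinset.1 hv) ((fV w).mem_toFinset.1 hw)
  · intro e f p he hf
    by_contra h
    exact Set.disjoint_left.1 (hEE e f h) ((fE e).mem_toFinset.1 he) ((fE f).mem_toFinset.1 hf)
  · intro e v p he hv
    by_contra h
    exact Set.disjoint_left.1 (hEV e v h) ((fE e).mem_toFinset.1 he) ((fV v).mem_toFinset.1 hv)
  · intro e v hv
    obtain ⟨x, hx, hxv⟩ := (A e).exists_mem_near_middle hv
    have hm := mem_pixelSquare_floor N x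
    exact ⟨_, (fE e).mem_toFinset.2 ⟨x, hx, hm⟩, (fV v).mem_toFinset.2
      ⟨x, Or.inr (Set.mem_biUnion (show e ∈ {e : G.edgeSet | v ∈ e.1} from hv) hxv), hm⟩⟩

theorem IsPlanarGraph.exists_abstractDual [Fintype V] (h : IsPlanarGraph G) :
    ∃ ι : Type, Nonempty (AbstractDual G ι) := by
  obtain ⟨D⟩ := h
  obtain ⟨M⟩ := D.nonempty_gridModel
  obtain ⟨M'⟩ := M.nonempty_gridMinor
  exact M'.exists_abstractDual

end Drawing

/-! ### Face families and Euler's formula by linear algebra -/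

section Euler

-- An edge with both ends in `A` is counted twice and cancels, so only the edges leaving `A`
-- survive.
open Classical in
theorem sum_edgeBoundary {V : Type*} [Fintype V] {G : SimpleGraph V} (z : G.edgeSet → ZMod 2)
    (A : Finset V) : ∑ v ∈ A, edgeBoundary G z v =
      ∑ e : G.edgeSet, if (∃ u ∈ e.1, u ∈ A) ∧ ∃ u ∈ e.1, u ∉ A then z e else 0 := by
  change ∑ v ∈ A, (∑ e : G.edgeSet, if v ∈ e.1 then z e else 0) = _
  rw [Finset.sum_comm]
  refine Finset.sum_congr rfl fun e _ => ?_
  obtain ⟨e, he⟩ := e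
  induction e using Sym2.ind with
  | _ a b =>
    have hab : a ≠ b := G.ne_of_adj he
    have key : ∀ v, (if v ∈ s(a, b) then z ⟨s(a, b), he⟩ else 0) =
        (if v = a then z ⟨s(a, b), he⟩ else 0) + if v = b then z ⟨s(a, b), he⟩ else 0 := by
      intro v
      by_cases h1 : v = a
      · have : v ≠ b := fun h => hab (h1 ▸ h)
        simp [h1, hab]
      · simp [h1]
    rw [Finset.sum_congr rfl fun v _ => key v]
    simp only [Finset.sum_add_distrib, Finset.sum_ite_eq', Sym2.mem_iff, exists_eq_or_imp,
      exists_eq_left]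
    by_cases h1 : a ∈ A <;> by_cases h2 : b ∈ A <;> simp [h1, h2, CharTwo.add_self_eq_zero]

open Classical in
/-- A nonzero element of the cycle space has at least as many edges as a shortest cycle. -/
theorem le_card_support_of_edgeBoundary_eq_zero {V : Type*} [Fintype V] {G : SimpleGraph V}
    {g : ℕ} (hg : (g : ℕ∞) ≤ G.egirth) {z : G.edgeSet → ZMod 2} (hz : edgeBoundary G z = 0)
    (hne : z ≠ 0) : g ≤ (Finset.univ.filter fun e => z e ≠ 0).card := by
  let S : Set (Sym2 V) := {e | ∃ h : e ∈ G.edgeSet, z ⟨e, h⟩ ≠ 0}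
  let H := SimpleGraph.fromEdgeSet S
  have hHG : H ≤ G := by
    intro u v huv
    rw [SimpleGraph.fromEdgeSet_adj] at huv
    exact huv.1.1
  have hcyc : ¬ H.IsAcyclic := by
    intro hac
    obtain ⟨⟨e, he⟩, hze⟩ := Function.ne_iff.1 hne
    induction e using Sym2.ind with
    | _ a b =>
      have hab : H.Adj a b := (SimpleGraph.fromEdgeSet_adj S).2 ⟨⟨he, hze⟩, G.ne_of_adj he⟩
      have hbr := SimpleGraph.isAcyclic_iff_forall_adj_isBridge.1 hac hab
      rw [SimpleGraph.isBridge_iff] at hbr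
      set H' := H.deleteEdges {s(a, b)} with hH'
      -- If the support were a forest, `s(a, b)` would be a bridge of it. No other edge of the
      -- support leaves the side `A` of `a`, so the boundary summed over `A` would be the nonzero
      -- value of `z` on `s(a, b)`.
      let A : Finset V := Finset.univ.filter fun w => H'.Reachable a w
      have hsum := sum_edgeBoundary z A
      rw [Finset.sum_eq_zero (fun v _ => congrFun hz v), Finset.sum_eq_single ⟨s(a, b), he⟩] at hsum
      · rw [if_pos] at hsum
        · exact hze hsum.symm
        · refine ⟨⟨a, by simp, by simp [A]⟩, ⟨b, by simp, ?_⟩⟩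
          simpa [A] using hbr
      · rintro ⟨f, hf⟩ - hfe
        induction f using Sym2.ind with
        | _ c d =>
          by_contra hne
          have hcut := (ite_ne_right_iff.1 hne).1
          have hzf := (ite_ne_right_iff.1 hne).2
          have hcd : H'.Adj c d := by
            rw [hH', SimpleGraph.deleteEdges_adj]
            exact ⟨(SimpleGraph.fromEdgeSet_adj S).2 ⟨⟨hf, hzf⟩, G.ne_of_adj hf⟩,
              fun h => hfe (Subtype.ext h)⟩
          have hiff : H'.Reachable a c ↔ H'.Reachable a d :=
            ⟨fun h => h.trans hcd.reachable, fun h => h.trans hcd.symm.reachable⟩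
          simp only [A, Sym2.mem_iff, Finset.mem_filter, Finset.mem_univ, true_and,
            exists_eq_or_imp, exists_eq_left, hiff] at hcut
          tauto
      · simp
  unfold SimpleGraph.IsAcyclic at hcyc
  push Not at hcyc
  obtain ⟨v, w, hw⟩ := hcyc
  have h1 : g ≤ w.length := by
    have := SimpleGraph.le_egirth.1 hg v (w.mapLe hHG) (hw.mapLe hHG)
    rw [SimpleGraph.Walk.length_map] at this
    exact_mod_cast this
  refine h1.trans ?_
  rw [← SimpleGraph.Walk.length_edges, ← List.toFinset_card_of_nodup hw.edges_nodup,
    ← Finset.card_map (Function.Embedding.subtype _)]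
  refine Finset.card_le_card fun e he => ?_
  have := w.edges_subset_edgeSet (List.mem_toFinset.1 he)
  rw [SimpleGraph.edgeSet_fromEdgeSet] at this
  obtain ⟨h, hz⟩ := this.1
  exact Finset.mem_map.2 ⟨⟨e, h⟩, by simpa using hz, rfl⟩

/-- A family of edge sets, the faces, that generates the cycle space modulo two, covers every edge
at most twice, and has sum zero. -/
structure FaceFamily {V : Type*} [Fintype V] (G : SimpleGraph V) (Φ : Type*) [Fintype Φ] where
  face : Φ → G.edgeSet → ZMod 2
  face_ne_zero : ∀ i, face i ≠ 0
  boundary_eq_zero : ∀ i, edgeBoundary G (face i) = 0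
  card_le_two : ∀ e, ∀ i j k, face i e ≠ 0 → face j e ≠ 0 → face k e ≠ 0 → i = j ∨ i = k ∨ j = k
  sum_eq_zero : ∑ i, face i = 0
  exists_eq_sum : ∀ z, edgeBoundary G z = 0 → ∃ f : Φ → ZMod 2, ∑ i, f i • face i = z

-- The boundary of a face consists of the edges that have it on exactly one side; a combination with
-- coefficients `f` takes the value `f (left e) + f (right e)` at `e`. Faces with empty boundary are
-- dropped; the others lie beside some edge, so they are finitely many.
open Classical in
theorem AbstractDual.exists_faceFamily {V : Type*} [Fintype V] {G : SimpleGraph V} {ι : Type}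
    (D : AbstractDual G ι) : ∃ (Φ : Type) (_ : Fintype Φ), Nonempty (FaceFamily G Φ) := by
  let y : ι → G.edgeSet → ZMod 2 := fun F e =>
    (if D.left e = F then 1 else 0) + if D.right e = F then 1 else 0
  have hy : ∀ F e, y F e ≠ 0 ↔ D.left e ≠ D.right e ∧ (D.left e = F ∨ D.right e = F) := by
    intro F e
    by_cases h1 : D.left e = F <;> by_cases h2 : D.right e = F
    · simp [y, h1, h2, CharTwo.add_self_eq_zero]
    · simp [y, h1, h2]; exact fun h => h2 h.symm
    · simp [y, h1, h2]
    · simp [y, h1, h2]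
  have hfin : Finite {F : ι // ∃ e, y F e ≠ 0} := by
    refine Set.Finite.subset ((Set.finite_range D.left).union (Set.finite_range D.right)) ?_
    rintro F ⟨e, he⟩
    rcases ((hy F e).1 he).2 with rfl | rfl
    · exact Or.inl ⟨e, rfl⟩
    · exact Or.inr ⟨e, rfl⟩
  have : Fintype {F : ι // ∃ e, y F e ≠ 0} := Fintype.ofFinite _
  have hsum : ∀ (f : ι → ZMod 2) e, ∑ i : {F : ι // ∃ e, y F e ≠ 0}, f i.1 * y i.1 e =
      f (D.left e) + f (D.right e) := by
    intro f e
    by_cases h : D.left e = D.right e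
    · rw [h, CharTwo.add_self_eq_zero]
      refine Finset.sum_eq_zero fun i _ => ?_
      have : y i.1 e = 0 := by
        by_contra hne
        exact ((hy _ _).1 hne).1 h
      rw [this, mul_zero]
    · have hl : y (D.left e) e ≠ 0 := (hy _ _).2 ⟨h, Or.inl rfl⟩
      have hr : y (D.right e) e ≠ 0 := (hy _ _).2 ⟨h, Or.inr rfl⟩
      have split : ∀ i : {F : ι // ∃ e, y F e ≠ 0}, f i.1 * y i.1 e =
          (if i = ⟨D.left e, e, hl⟩ then f i.1 else 0) +
            if i = ⟨D.right e, e, hr⟩ then f i.1 else 0 := by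
        rintro ⟨F, hF⟩
        simp only [y, Subtype.mk.injEq, mul_add, mul_ite, mul_one, mul_zero, eq_comm (a := F)]
      simp_rw [split, Finset.sum_add_distrib]
      simp
  refine ⟨_, this, ⟨⟨fun i => y i.1, ?_, ?_, ?_, ?_, ?_⟩⟩⟩
  · rintro ⟨F, e, he⟩ h
    exact he (congrFun h e)
  · intro i
    convert D.boundary_eq_zero (fun F => if F = i.1 then 1 else 0) using 3
  · intro e i j k hi hj hk
    have hi := ((hy _ _).1 hi).2
    have hj := ((hy _ _).1 hj).2
    have hk := ((hy _ _).1 hk).2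
    simp only [Subtype.ext_iff]
    rcases hi with hi | hi <;> rcases hj with hj | hj <;> rcases hk with hk | hk <;>
      simp [← hi, ← hj, ← hk]
  · ext e
    have := hsum (fun _ => 1) e
    simp only [one_mul, CharTwo.add_self_eq_zero] at this
    rw [Finset.sum_apply]
    exact this
  · intro z hz
    obtain ⟨f, hf⟩ := D.exists_eq z hz
    refine ⟨fun i => f i.1, ?_⟩
    ext e
    rw [Finset.sum_apply, ← hf, ← hsum]
    rfl

/-- A set of vertices that is closed under adjacency is everything; a form of connectedness. -/
def SimpleGraph.ClosedSetsTrivial {V : Type*} (G : SimpleGraph V) : Prop :=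
  ∀ A : Set V, A.Nonempty → (∀ u ∈ A, ∀ v, G.Adj u v → v ∈ A) → A = Set.univ

-- Boundaries are killed by the sum of all coordinates, a nonzero functional as `V` is nonempty.
open Module in
theorem finrank_range_edgeBoundary_lt {V : Type*} [Fintype V] [Nonempty V] (G : SimpleGraph V) :
    finrank (ZMod 2) (LinearMap.range (edgeBoundary G)) + 1 ≤ Fintype.card V := by
  classical
  let L : (V → ZMod 2) →ₗ[ZMod 2] ZMod 2 := ∑ v, LinearMap.proj v
  have hL : ∀ r, L r = ∑ v, r v := fun r => by simp [L]
  have hsurj : Function.Surjective L := by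
    intro c
    refine ⟨Pi.single (Classical.arbitrary V) c, ?_⟩
    rw [hL]; simp
  have h1 : LinearMap.range (edgeBoundary G) ≤ LinearMap.ker L := by
    rintro _ ⟨z, rfl⟩
    rw [LinearMap.mem_ker, hL, sum_edgeBoundary]
    simp
  have h2 := L.finrank_range_add_finrank_ker
  rw [LinearMap.range_eq_top.2 hsurj, finrank_top, finrank_self, Module.finrank_pi] at h2
  have := Submodule.finrank_mono h1
  lia

-- For a proper nonempty `A` closed under adjacency, the sums over `A` and over `Aᶜ` are two
-- independent functionals that vanish on boundaries, so the rank would be at most `|V| - 2`.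
open Module in
theorem SimpleGraph.closedSetsTrivial_of_rank {V : Type*} [Fintype V] (G : SimpleGraph V)
    (h : Fintype.card V ≤ finrank (ZMod 2) (LinearMap.range (edgeBoundary G)) + 1) :
    G.ClosedSetsTrivial := by
  classical
  rintro A ⟨a, ha⟩ hA
  by_contra hne
  obtain ⟨b, hb⟩ := (Set.ne_univ_iff_exists_notMem A).1 hne
  let L : Set V → (V → ZMod 2) →ₗ[ZMod 2] ZMod 2 := fun B => ∑ v with v ∈ B, LinearMap.proj v
  have hL : ∀ B r, L B r = ∑ v with v ∈ B, r v := fun B r => by simp [L]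
  have hsurj : Function.Surjective ((L A).prod (L Aᶜ)) := by
    rintro ⟨c, d⟩
    refine ⟨Pi.single a c + Pi.single b d, ?_⟩
    have hab : a ≠ b := fun h => hb (h ▸ ha)
    simp [hL, Finset.sum_add_distrib, Pi.single_apply, ha, hb]
  have hcl : ∀ B : Set V, (∀ u ∈ B, ∀ v, G.Adj u v → v ∈ B) → ∀ z, L B (edgeBoundary G z) = 0 := by
    intro B hB z
    rw [hL, sum_edgeBoundary]
    refine Finset.sum_eq_zero fun e _ => if_neg ?_
    rintro ⟨⟨u, hu, huB⟩, ⟨v, hv, hvB⟩⟩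
    simp only [Finset.mem_filter, Finset.mem_univ, true_and] at huB hvB
    have huv : u ≠ v := fun h => hvB (h ▸ huB)
    refine hvB (hB u huB v ?_)
    have := (Sym2.mem_and_mem_iff huv).1 ⟨hu, hv⟩
    have he := e.2
    rwa [this] at he
  have h1 : LinearMap.range (edgeBoundary G) ≤ LinearMap.ker ((L A).prod (L Aᶜ)) := by
    rintro _ ⟨z, rfl⟩
    rw [LinearMap.mem_ker]
    refine Prod.ext (hcl A hA z) (hcl Aᶜ ?_ z)
    exact fun u hu v huv hv => hu (hA v hv u huv.symm)
  have h2 := ((L A).prod (L Aᶜ)).finrank_range_add_finrank_ker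
  rw [LinearMap.range_eq_top.2 hsurj, finrank_top, finrank_prod, finrank_self,
    Module.finrank_pi] at h2
  have := Submodule.finrank_mono h1
  lia

namespace FaceFamily

variable {V : Type*} [Fintype V] {G : SimpleGraph V} {Φ : Type*} [Fintype Φ] (F : FaceFamily G Φ)

/-- The linear combinations of the faces. -/
def combination : (Φ → ZMod 2) →ₗ[ZMod 2] (G.edgeSet → ZMod 2) :=
  ∑ i, (LinearMap.proj i).smulRight (F.face i)

theorem combination_apply (f : Φ → ZMod 2) : F.combination f = ∑ i, f i • F.face i := by
  simp [combination]

theorem range_combination : LinearMap.range F.combination = LinearMap.ker (edgeBoundary G) := by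
  apply le_antisymm
  · rintro _ ⟨f, rfl⟩
    rw [LinearMap.mem_ker, combination_apply, map_sum]
    exact Finset.sum_eq_zero fun i _ => by rw [map_smul, F.boundary_eq_zero, smul_zero]
  · intro z hz
    obtain ⟨f, hf⟩ := F.exists_eq_sum z hz
    exact ⟨f, by rw [combination_apply, hf]⟩

theorem combination_one : F.combination 1 = 0 := by
  simp [combination_apply, F.sum_eq_zero]

-- Rank–nullity for `combination` and for `edgeBoundary`; the range of the first is the kernel of
-- the second.
open Module in
theorem euler [Fintype G.edgeSet] :
    Fintype.card G.edgeSet + finrank (ZMod 2) (LinearMap.ker F.combination) =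
      Fintype.card Φ + finrank (ZMod 2) (LinearMap.range (edgeBoundary G)) := by
  have h1 := F.combination.finrank_range_add_finrank_ker
  have h2 := (edgeBoundary G).finrank_range_add_finrank_ker
  rw [range_combination, Module.finrank_pi] at h1
  rw [Module.finrank_pi] at h2
  lia

open Module in
theorem one_le_finrank_ker [Nonempty Φ] :
    1 ≤ finrank (ZMod 2) (LinearMap.ker F.combination) := by
  rw [Nat.one_le_iff_ne_zero, Ne, Submodule.finrank_eq_zero]
  intro h
  have : (1 : Φ → ZMod 2) ∈ LinearMap.ker F.combination := F.combination_one
  rw [h, Submodule.mem_bot] at this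
  exact one_ne_zero this

-- The constant `1` is a nonzero relation, so it spans a space of relations of dimension at most
-- one.
open Module in
theorem eq_zero_or_one_of_finrank_ker [Nonempty Φ]
    (h : finrank (ZMod 2) (LinearMap.ker F.combination) ≤ 1) (f : Φ → ZMod 2)
    (hf : F.combination f = 0) : f = 0 ∨ f = 1 := by
  obtain ⟨v, hv⟩ := finrank_le_one_iff.1 h
  have h01 : ∀ c : ZMod 2, c = 0 ∨ c = 1 := by decide
  obtain ⟨c, hc⟩ := hv ⟨f, hf⟩
  obtain ⟨d, hd⟩ := hv ⟨1, F.combination_one⟩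
  rcases h01 c with rfl | rfl
  · left
    simpa using (congrArg Subtype.val hc).symm
  · rcases h01 d with rfl | rfl
    · have := congrArg Subtype.val hd
      simp at this
    · right
      rw [hc] at hd
      exact congrArg Subtype.val hd

end FaceFamily

end Euler

/-! ### The bound on the order and its equality case -/

section Counting

variable {V : Type*} [Fintype V] {G : SimpleGraph V}

open Classical in
theorem FaceFamily.sum_card_support {Φ : Type*} [Fintype Φ] (F : FaceFamily G Φ) :
    ∑ i, (Finset.univ.filter fun e => F.face i e ≠ 0).card =
      ∑ e, (Finset.univ.filter fun i => F.face i e ≠ 0).card :=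
  Finset.sum_card_bipartiteAbove_eq_sum_card_bipartiteBelow fun i e => F.face i e ≠ 0

open Classical in
theorem FaceFamily.card_filter_le_two {Φ : Type*} [Fintype Φ] (F : FaceFamily G Φ)
    (e : G.edgeSet) : (Finset.univ.filter fun i => F.face i e ≠ 0).card ≤ 2 := by
  by_contra! h
  obtain ⟨i, j, k, hi, hj, hk, hij, hik, hjk⟩ := Finset.two_lt_card_iff.1 h
  simp only [Finset.mem_filter, Finset.mem_univ, true_and] at hi hj hk
  rcases F.card_le_two e i j k hi hj hk with h | h | h
  · exact hij h
  · exact hik h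
  · exact hjk h

open Classical in
theorem IsPlanarKGGraph.nonempty {k g : ℕ} (h : IsPlanarKGGraph G k g) : Nonempty V := by
  by_contra hV
  rw [not_nonempty_iff] at hV
  have : G.IsAcyclic := fun v => (hV.false v).elim
  have h2 := h.2.1
  rw [SimpleGraph.egirth_eq_top.2 this] at h2
  exact absurd h2 (ENat.top_ne_natCast g)

open Classical in
theorem IsPlanarKGGraph.mul_card_eq {k g : ℕ} (h : IsPlanarKGGraph G k g) :
    k * Fintype.card V = 2 * Fintype.card G.edgeSet := by
  have h1 := G.sum_degrees_eq_twice_card_edges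
  rw [Finset.sum_congr rfl fun v _ => h.1 v, Finset.sum_const, smul_eq_mul, Finset.card_univ,
    mul_comm] at h1
  rw [h1, ← SimpleGraph.edgeFinset_card]

theorem IsPlanarKGGraph.three_le {k g : ℕ} (h : IsPlanarKGGraph G k g) : 3 ≤ g := by
  have := G.three_le_egirth
  rw [h.2.1] at this
  exact_mod_cast this

open Classical Module in
theorem IsPlanarKGGraph.exists_count {k g : ℕ} (h : IsPlanarKGGraph G k g) (hk : 3 ≤ k) :
    ∃ (Φ : Type) (_ : Fintype Φ) (F : FaceFamily G Φ), Nonempty Φ ∧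
      (∀ i, g ≤ (Finset.univ.filter fun e => F.face i e ≠ 0).card) ∧
      Fintype.card G.edgeSet + finrank (ZMod 2) (LinearMap.ker F.combination) =
        Fintype.card Φ + finrank (ZMod 2) (LinearMap.range (edgeBoundary G)) := by
  have := h.nonempty
  obtain ⟨ι, ⟨D⟩⟩ := h.2.2.exists_abstractDual
  obtain ⟨Φ, hΦ, ⟨F⟩⟩ := D.exists_faceFamily
  have hE := F.euler
  refine ⟨Φ, hΦ, F, ?_, fun i => le_card_support_of_edgeBoundary_eq_zero h.2.1.ge
    (F.boundary_eq_zero i) (F.face_ne_zero i), hE⟩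
  -- Without faces the cycle space is zero and there are fewer edges than vertices, against `2E = kV
  -- ≥ 3V`.
  by_contra hne
  rw [not_nonempty_iff] at hne
  have h1 : Fintype.card Φ = 0 := Fintype.card_eq_zero
  have h2 := finrank_range_edgeBoundary_lt G
  have h3 := h.mul_card_eq
  nlinarith [Nat.mul_le_mul_right (Fintype.card V) hk]

/-- The order of a planar `(k, g)`-graph is bounded below by the count of its faces. -/
theorem IsPlanarKGGraph.card_bound {k g : ℕ} (h : IsPlanarKGGraph G k g) (hk : 3 ≤ k) :
    Fintype.card V * (g * k) + 4 * g ≤ Fintype.card V * (2 * k + 2 * g) := by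
  classical
  obtain ⟨Φ, hΦ, F, hne, hg, hE⟩ := h.exists_count hk
  have := h.nonempty
  have h1 := finrank_range_edgeBoundary_lt G
  have h2 := F.one_le_finrank_ker
  have h3 := h.mul_card_eq
  -- Incidences of faces and edges: at least `g` for each face, at most two for each edge.
  have h4 : g * Fintype.card Φ ≤ 2 * Fintype.card G.edgeSet := by
    calc g * Fintype.card Φ = ∑ _i : Φ, g := by simp [mul_comm]
      _ ≤ _ := Finset.sum_le_sum fun i _ => hg i
      _ = _ := F.sum_card_support
      _ ≤ ∑ _e : G.edgeSet, 2 := Finset.sum_le_sum fun e _ => F.card_filter_le_two e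
      _ = _ := by simp [mul_comm]
  -- Euler's inequality: one unit comes from the rank of the boundary map, the other from the
  -- relation between the faces.
  have h5 : Fintype.card G.edgeSet + 2 ≤ Fintype.card Φ + Fintype.card V := by lia
  have h6 := Nat.mul_le_mul_left g h5
  nlinarith

/-- The faces of a planar `(k, g)`-graph that attains the bound on the order. -/
structure TightFaces (G : SimpleGraph V) (g : ℕ) (Φ : Type*) [Fintype Φ]
    extends FaceFamily G Φ where
  closedSetsTrivial : G.ClosedSetsTrivial
  card_support : ∀ i, Nat.card {e // face i e ≠ 0} = g
  card_faces : ∀ e, Nat.card {i // face i e ≠ 0} = 2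
  eq_zero_or_one : ∀ f : Φ → ZMod 2, ∑ i, f i • face i = 0 → f = 0 ∨ f = 1

-- The bound combines four inequalities: `g` edges per face, two faces per edge, rank of the
-- boundary at most `|V| - 1`, at least one relation between faces. Equality in the bound forces
-- equality in all four, and the rank then gives connectedness.
open Classical in
theorem IsPlanarKGGraph.exists_tightFaces {k g : ℕ} (h : IsPlanarKGGraph G k g) (hk : 3 ≤ k)
    (heq : Fintype.card V * (2 * k + 2 * g) ≤ Fintype.card V * (g * k) + 4 * g) :
    ∃ (Φ : Type) (_ : Fintype Φ), Nonempty (TightFaces G g Φ) ∧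
      g * Fintype.card Φ = k * Fintype.card V := by
  obtain ⟨Φ, hΦ, F, hne, hg, hE⟩ := h.exists_count hk
  have := h.nonempty
  have h1 := finrank_range_edgeBoundary_lt G
  have h2 := F.one_le_finrank_ker
  have h3 := h.mul_card_eq
  have c1 : ∑ _i : Φ, g ≤ ∑ i, (Finset.univ.filter fun e => F.face i e ≠ 0).card :=
    Finset.sum_le_sum fun i _ => hg i
  have c2 : ∑ e, (Finset.univ.filter fun i => F.face i e ≠ 0).card ≤ ∑ _e : G.edgeSet, 2 :=
    Finset.sum_le_sum fun e _ => F.card_filter_le_two e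
  have c3 := F.sum_card_support
  have e1 : ∑ _i : Φ, g = g * Fintype.card Φ := by simp [mul_comm]
  have e2 : ∑ _e : G.edgeSet, 2 = 2 * Fintype.card G.edgeSet := by simp [mul_comm]
  have h5 : Fintype.card G.edgeSet + 2 ≤ Fintype.card Φ + Fintype.card V := by lia
  have h6 := Nat.mul_le_mul_left g h5
  have hg3 := h.three_le
  have h7 : g * Fintype.card Φ = 2 * Fintype.card G.edgeSet := by nlinarith
  have h8 : Fintype.card Φ + Fintype.card V ≤ Fintype.card G.edgeSet + 2 := by
    refine le_of_mul_le_mul_left ?_ (by lia : 0 < g)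
    nlinarith
  have s1 := (Finset.sum_eq_sum_iff_of_le (s := Finset.univ) fun (i : Φ) _ => hg i).1 (by lia)
  have s2 := (Finset.sum_eq_sum_iff_of_le (s := Finset.univ)
    fun (e : G.edgeSet) _ => F.card_filter_le_two e).1 (by lia)
  refine ⟨Φ, hΦ, ⟨⟨F, G.closedSetsTrivial_of_rank (by lia), fun i => ?_, fun e => ?_,
    fun f hf => F.eq_zero_or_one_of_finrank_ker (by lia) f ?_⟩⟩, by lia⟩
  · rw [Nat.card_eq_fintype_card, Fintype.card_subtype]
    exact (s1 i (Finset.mem_univ i)).symm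
  · rw [Nat.card_eq_fintype_card, Fintype.card_subtype]
    exact s2 e (Finset.mem_univ e)
  · rw [F.combination_apply, hf]

end Counting

/-! ### Homomorphisms of regular graphs that are isomorphisms -/

section Isomorphism

-- The neighbours of `x` go injectively to neighbours of `φ x`; both sets have `k` elements, so none
-- is missed and adjacency is reflected.
open Classical in
theorem SimpleGraph.nonempty_iso_of_bijective {V W : Type*} [Fintype V] [Fintype W]
    {G : SimpleGraph V} {P : SimpleGraph W} [G.LocallyFinite] [P.LocallyFinite] {k : ℕ}
    (hG : G.IsRegularOfDegree k)
    (hP : P.IsRegularOfDegree k) (φ : W → V) (hφ : Function.Bijective φ)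
    (hadj : ∀ x y, P.Adj x y → G.Adj (φ x) (φ y)) : Nonempty (G ≃g P) := by
  refine ⟨SimpleGraph.Iso.symm ⟨Equiv.ofBijective φ hφ, ?_⟩⟩
  intro x y
  refine ⟨fun h => ?_, hadj x y⟩
  have hsub : (P.neighborFinset x).image φ ⊆ G.neighborFinset (φ x) := by
    intro u hu
    obtain ⟨z, hz, rfl⟩ := Finset.mem_image.1 hu
    rw [SimpleGraph.mem_neighborFinset] at hz ⊢
    exact hadj x z hz
  have hcard : (G.neighborFinset (φ x)).card ≤ ((P.neighborFinset x).image φ).card := by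
    rw [Finset.card_image_of_injective _ hφ.1, SimpleGraph.card_neighborFinset_eq_degree,
      SimpleGraph.card_neighborFinset_eq_degree, hG (φ x), hP x]
  have hmem : φ y ∈ G.neighborFinset (φ x) := (SimpleGraph.mem_neighborFinset _ _ _).2 h
  rw [← Finset.eq_of_subset_of_card_le hsub hcard] at hmem
  obtain ⟨z, hz, hzy⟩ := Finset.mem_image.1 hmem
  rw [hφ.1 hzy, SimpleGraph.mem_neighborFinset] at hz
  exact hz

open Classical in
/-- A homomorphism between regular graphs of equal degree and order is an isomorphism if its image
is closed under adjacency and the target is connected. -/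
theorem SimpleGraph.ClosedSetsTrivial.nonempty_iso {V W : Type*} [Fintype V] [Fintype W]
    [Nonempty W] {G : SimpleGraph V} {P : SimpleGraph W} [G.LocallyFinite] [P.LocallyFinite] {k : ℕ}
    (hc : G.ClosedSetsTrivial)
    (hG : G.IsRegularOfDegree k) (hP : P.IsRegularOfDegree k)
    (hcard : Fintype.card W = Fintype.card V) (φ : W → V)
    (hadj : ∀ x y, P.Adj x y → G.Adj (φ x) (φ y))
    (hcov : ∀ x u, G.Adj (φ x) u → u ∈ Set.range φ) : Nonempty (G ≃g P) := by
  have hsurj : Function.Surjective φ := by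
    rw [← Set.range_eq_univ]
    refine hc _ (Set.range_nonempty φ) ?_
    rintro _ ⟨x, rfl⟩ u hu
    exact hcov x u hu
  exact SimpleGraph.nonempty_iso_of_bijective hG hP φ
    ((Fintype.bijective_iff_surjective_and_card φ).2 ⟨hsurj, hcard⟩) hadj

end Isomorphism

/-! ### Walking around a face -/

namespace TightFaces

variable {V : Type*} [Fintype V] {G : SimpleGraph V} {g : ℕ} {Φ : Type*} [Fintype Φ]
  (T : TightFaces G g Φ)

/-- The edge between two vertices lies on a face. -/
def On (i : Φ) (x y : V) : Prop := ∃ h : G.Adj x y, T.face i ⟨s(x, y), h⟩ ≠ 0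

variable {T}

theorem On.adj {i : Φ} {x y : V} (h : T.On i x y) : G.Adj x y := h.1

theorem On.symm {i : Φ} {x y : V} (h : T.On i x y) : T.On i y x := by
  obtain ⟨h, hf⟩ := h
  refine ⟨h.symm, ?_⟩
  have : (⟨s(y, x), h.symm⟩ : G.edgeSet) = ⟨s(x, y), h⟩ := Subtype.ext Sym2.eq_swap
  rwa [this]

theorem exists_faces {x y : V} (h : G.Adj x y) :
    ∃ i j, i ≠ j ∧ T.On i x y ∧ T.On j x y ∧ ∀ k, T.On k x y → k = i ∨ k = j := by
  have h2 := T.card_faces ⟨s(x, y), h⟩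
  obtain ⟨i, j, hij, huniv⟩ := Nat.card_eq_two_iff.1 h2
  refine ⟨i.1, j.1, fun h => hij (Subtype.ext h), ⟨h, i.2⟩, ⟨h, j.2⟩, ?_⟩
  rintro k ⟨_, hk⟩
  have : (⟨k, hk⟩ : {i // T.face i ⟨s(x, y), h⟩ ≠ 0}) ∈ ({i, j} : Set _) := by
    rw [huniv]; trivial
  rcases this with h | h
  · exact Or.inl (congrArg Subtype.val h)
  · exact Or.inr (congrArg Subtype.val h)

-- This is the vanishing of the boundary of face `i` at `v`.
open Classical in
theorem even_card_on (i : Φ) (v : V) : Even (Finset.univ.filter fun w => T.On i v w).card := by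
  have h := congrFun (T.boundary_eq_zero i) v
  change (∑ e : G.edgeSet, if v ∈ e.1 then T.face i e else 0) = 0 at h
  have h01 : ∀ c : ZMod 2, c ≠ 0 → c = 1 := by decide
  rw [← ZMod.natCast_eq_zero_iff_even, ← h, Finset.card_eq_sum_ones, Nat.cast_sum]
  symm
  rw [← Finset.sum_filter, ← Finset.sum_filter_ne_zero]
  symm
  refine Finset.sum_bij (fun w hw => ⟨s(v, w), (Finset.mem_filter.1 hw).2.1⟩) ?_ ?_ ?_ ?_
  · intro w hw
    have := (Finset.mem_filter.1 hw).2.2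
    simpa using this
  · intro w hw w' hw' h
    exact Sym2.congr_right.1 (congrArg Subtype.val h)
  · rintro ⟨e, he⟩ hm
    simp only [Finset.mem_filter, Finset.mem_univ, true_and] at hm
    obtain ⟨w, rfl⟩ := hm.1
    exact ⟨w, by simpa using ⟨he, hm.2⟩, rfl⟩
  · intro w hw
    have := (Finset.mem_filter.1 hw).2.2
    rw [h01 _ this, Nat.cast_one]

/-- The even degree of the face at `y` is not zero, so a second edge exists. This lets one walk on
along a face. -/
theorem exists_next {i : Φ} {x y : V} (h : T.On i x y) : ∃ z, z ≠ x ∧ T.On i y z := by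
  classical
  by_contra! hno
  have he := T.even_card_on i y
  have : (Finset.univ.filter fun w => T.On i y w) = {x} := by
    ext w
    simp only [Finset.mem_filter, Finset.mem_univ, true_and, Finset.mem_singleton]
    exact ⟨fun hw => by_contra fun hne => hno w hne hw, fun hw => hw ▸ h.symm⟩
  rw [this] at he
  simp at he

/-- A list of `g` different edges of a face contains all of its edges. -/
theorem mem_of_on {i : Φ} {L : List (Sym2 V)} (hL : L.Nodup) (hlen : L.length = g)
    (hon : ∀ e ∈ L, ∃ h : e ∈ G.edgeSet, T.face i ⟨e, h⟩ ≠ 0) {x y : V} (h : T.On i x y) :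
    s(x, y) ∈ L := by
  classical
  let S : Set (Sym2 V) := Subtype.val '' {e : G.edgeSet | T.face i e ≠ 0}
  have hS : S.ncard = g := by
    rw [Set.ncard_image_of_injective _ Subtype.val_injective]
    exact T.card_support i
  have hsub : (L.toFinset : Set (Sym2 V)) ⊆ S := by
    intro e he
    obtain ⟨h, hf⟩ := hon e (by simpa using he)
    exact ⟨⟨e, h⟩, hf, rfl⟩
  have heq := Set.eq_of_subset_of_ncard_le hsub (by
    rw [Set.ncard_coe_finset, List.toFinset_card_of_nodup hL, hlen, hS])
  have : s(x, y) ∈ S := ⟨⟨s(x, y), h.1⟩, h.2, rfl⟩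
  rw [← heq] at this
  simpa using this

/-- Walk on along the face beyond `c`. If the walk does not return to `a`, its three edges are
different, hence all edges of the face, and there is none left to continue with. -/
theorem on_triangle {T : TightFaces G 3 Φ} {i : Φ} {a b c : V} (h1 : T.On i a b)
    (h2 : T.On i b c) (hac : a ≠ c) : T.On i c a := by
  obtain ⟨d, hdb, h3⟩ := exists_next h2
  obtain ⟨e, hec, h4⟩ := exists_next h3
  by_cases hda : d = a
  · exact hda ▸ h3
  have n1 := h1.adj.ne
  have n2 := h2.adj.ne
  have n3 := h3.adj.ne
  have n4 := h4.adj.ne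
  exfalso
  have := mem_of_on (L := [s(a, b), s(b, c), s(c, d)]) (by simp; grind) rfl
    (by simp only [List.forall_mem_cons, List.not_mem_nil]; exact ⟨h1, h2, h3, by simp⟩) h4
  simp at this
  grind

/-- The walk of `on_triangle` with one more edge; the absence of triangles keeps its four edges
different. -/
theorem on_quadrilateral {T : TightFaces G 4 Φ} (h3 : ∀ x y z, G.Adj x y → G.Adj y z → ¬ G.Adj z x)
    {i : Φ} {a b c : V} (h1 : T.On i a b) (h2 : T.On i b c) (hac : a ≠ c) :
    ∃ d, d ≠ b ∧ T.On i c d ∧ T.On i d a := by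
  obtain ⟨d, hdb, h3'⟩ := exists_next h2
  obtain ⟨e, hec, h4⟩ := exists_next h3'
  obtain ⟨f, hfd, h5⟩ := exists_next h4
  by_cases hea : e = a
  · exact ⟨d, hdb, h3', hea ▸ h4⟩
  have n1 := h1.adj.ne
  have n2 := h2.adj.ne
  have n3 := h3'.adj.ne
  have n4 := h4.adj.ne
  have n5 := h5.adj.ne
  have m1 : d ≠ a := fun h => h3 a b c h1.adj h2.adj (h ▸ h3'.adj)
  have m2 : e ≠ b := fun h => h3 b c d h2.adj h3'.adj (h ▸ h4.adj)
  exfalso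
  have := mem_of_on (L := [s(a, b), s(b, c), s(c, d), s(d, e)]) (by simp; grind) rfl
    (by simp only [List.forall_mem_cons, List.not_mem_nil]; exact ⟨h1, h2, h3', h4, by simp⟩) h5
  simp at this
  grind

/-- Here the absence of triangles and quadrilaterals keeps the five edges of the walk different. -/
theorem on_pentagon {T : TightFaces G 5 Φ} (h3 : ∀ x y z, G.Adj x y → G.Adj y z → ¬ G.Adj z x)
    (h4 : ∀ x y z w, G.Adj x y → G.Adj y z → G.Adj z w → G.Adj w x → x = z ∨ y = w)
    {i : Φ} {a b c : V} (h1 : T.On i a b) (h2 : T.On i b c) (hac : a ≠ c) :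
    ∃ d e, d ≠ b ∧ T.On i c d ∧ T.On i d e ∧ T.On i e a := by
  obtain ⟨d, hdb, o3⟩ := exists_next h2
  obtain ⟨e, hec, o4⟩ := exists_next o3
  obtain ⟨f, hfd, o5⟩ := exists_next o4
  obtain ⟨x, hxe, o6⟩ := exists_next o5
  by_cases hfa : f = a
  · exact ⟨d, e, hdb, o3, o4, hfa ▸ o5⟩
  have n1 := h1.adj.ne
  have n2 := h2.adj.ne
  have n3 := o3.adj.ne
  have n4 := o4.adj.ne
  have n5 := o5.adj.ne
  have n6 := o6.adj.ne
  have m1 : d ≠ a := fun h => h3 a b c h1.adj h2.adj (h ▸ o3.adj)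
  have m2 : e ≠ b := fun h => h3 b c d h2.adj o3.adj (h ▸ o4.adj)
  have m3 : f ≠ c := fun h => h3 c d e o3.adj o4.adj (h ▸ o5.adj)
  have m4 : e ≠ a := fun h => by
    rcases h4 a b c d h1.adj h2.adj o3.adj (h ▸ o4.adj) with h | h
    · exact hac h
    · exact hdb h.symm
  have m5 : f ≠ b := fun h => by
    rcases h4 b c d e h2.adj o3.adj o4.adj (h ▸ o5.adj) with h | h
    · exact hdb h.symm
    · exact hec h.symm
  exfalso
  have := mem_of_on (L := [s(a, b), s(b, c), s(c, d), s(d, e), s(e, f)]) (by simp; grind) rfl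
    (by simp only [List.forall_mem_cons, List.not_mem_nil]; exact ⟨h1, h2, o3, o4, o5, by simp⟩) o6
  simp at this
  grind

end TightFaces

/-! ### Corners of faces in cubic graphs -/

section Cubic

variable {V : Type*} {G : SimpleGraph V}

/-- Every vertex has exactly three neighbours. -/
def SimpleGraph.Cubic (G : SimpleGraph V) : Prop :=
  ∀ v, ∃ p q r, p ≠ q ∧ p ≠ r ∧ q ≠ r ∧ ∀ w, G.Adj v w ↔ w = p ∨ w = q ∨ w = r

open Classical in
theorem SimpleGraph.IsRegularOfDegree.cubic [Fintype V] (h : G.IsRegularOfDegree 3) : G.Cubic := by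
  intro v
  have hv := h v
  rw [← SimpleGraph.card_neighborFinset_eq_degree] at hv
  obtain ⟨p, q, r, h1, h2, h3, hN⟩ := Finset.card_eq_three.1 hv
  refine ⟨p, q, r, h1, h2, h3, fun w => ?_⟩
  rw [← SimpleGraph.mem_neighborFinset, hN]
  simp

theorem SimpleGraph.Cubic.eq_of_adj (hG : G.Cubic) {v a b c : V} (ha : G.Adj v a) (hb : G.Adj v b)
    (hc : G.Adj v c) (hab : a ≠ b) (hac : a ≠ c) (hbc : b ≠ c) {u : V} (hu : G.Adj v u) :
    u = a ∨ u = b ∨ u = c := by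
  obtain ⟨p, q, r, -, -, -, hN⟩ := hG v
  rw [hN] at ha hb hc hu
  grind

theorem SimpleGraph.Cubic.exists_third (hG : G.Cubic) (v a b : V) :
    ∃ c, c ≠ a ∧ c ≠ b ∧ G.Adj v c := by
  obtain ⟨p, q, r, h1, h2, h3, hN⟩ := hG v
  have hp := (hN p).2 (by simp)
  have hq := (hN q).2 (by simp)
  have hr := (hN r).2 (by simp)
  grind

variable [Fintype V] {g : ℕ} {Φ : Type*} [Fintype Φ] {T : TightFaces G g Φ}

namespace TightFaces

/-- A face of a cubic graph has at most two edges at a vertex. -/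
theorem eq_or_eq_of_on (hG : G.Cubic) {i : Φ} {v a b c : V} (ha : T.On i v a) (hb : T.On i v b)
    (hc : T.On i v c) (hab : a ≠ b) : c = a ∨ c = b := by
  classical
  by_contra! hne
  have he := T.even_card_on i v
  have : (Finset.univ.filter fun w => T.On i v w) = {a, b, c} := by
    ext w
    simp only [Finset.mem_filter, Finset.mem_univ, true_and, Finset.mem_insert,
      Finset.mem_singleton]
    refine ⟨fun hw => hG.eq_of_adj ha.adj hb.adj hc.adj hab hne.1.symm hne.2.symm hw.adj, ?_⟩
    rintro (rfl | rfl | rfl) <;> assumption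
  rw [this, Finset.card_eq_three.2 ⟨a, b, c, hab, hne.1.symm, hne.2.symm, rfl⟩] at he
  exact absurd he (by decide)

/-- Otherwise every face through `va` or `vb` leaves `v` along the third edge `vc`. The two faces of
`va` are then the two faces of `vc`, so a face of `vb` is one of them after all. -/
theorem exists_corner (hG : G.Cubic) {v a b : V} (ha : G.Adj v a) (hb : G.Adj v b) (hab : a ≠ b) :
    ∃ i, T.On i v a ∧ T.On i v b := by
  obtain ⟨c, hca, hcb, hc⟩ := hG.exists_third v a b
  by_contra! hno
  have key : ∀ i, T.On i v a ∨ T.On i v b → T.On i v c := by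
    rintro i (h | h)
    · obtain ⟨x, hx, hvx⟩ := exists_next h.symm
      rcases hG.eq_of_adj ha hb hc hab hca.symm hcb.symm hvx.adj with rfl | rfl | rfl
      · exact absurd rfl hx
      · exact absurd hvx (hno i h)
      · exact hvx
    · obtain ⟨x, hx, hvx⟩ := exists_next h.symm
      rcases hG.eq_of_adj ha hb hc hab hca.symm hcb.symm hvx.adj with rfl | rfl | rfl
      · exact absurd h (hno i hvx)
      · exact absurd rfl hx
      · exact hvx
  obtain ⟨i, j, hij, hi, hj, -⟩ := exists_faces (T := T) ha
  obtain ⟨k, -, -, hk, -, -⟩ := exists_faces (T := T) hb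
  obtain ⟨l, m, -, -, -, hall⟩ := exists_faces (T := T) hc
  have hi' := hall i (key i (Or.inl hi))
  have hj' := hall j (key j (Or.inl hj))
  have hk' := hall k (key k (Or.inr hk))
  have : k = i ∨ k = j := by grind
  rcases this with rfl | rfl
  · exact hno _ hi hk
  · exact hno _ hj hk

/-- Two such faces would be all the faces at `va` and at `vb`. A face through `vc` has a second edge
at `v`, so it is one of them and has three edges at `v`, against parity. -/
theorem corner_unique (hG : G.Cubic) {i j : Φ} {v a b : V} (hia : T.On i v a) (hib : T.On i v b)
    (hja : T.On j v a) (hjb : T.On j v b) (hab : a ≠ b) : i = j := by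
  by_contra hij
  obtain ⟨c, hca, hcb, hc⟩ := hG.exists_third v a b
  have full : ∀ x, T.On i v x → T.On j v x → ∀ k, T.On k v x → k = i ∨ k = j := by
    intro x hi hj k hk
    obtain ⟨l, m, -, -, -, hall⟩ := exists_faces (T := T) hi.adj
    have := hall i hi
    have := hall j hj
    have := hall k hk
    grind
  obtain ⟨k, -, -, hk, -, -⟩ := exists_faces (T := T) hc
  have hkij : k = i ∨ k = j := by
    obtain ⟨x, hx, hvx⟩ := exists_next hk.symm
    rcases hG.eq_of_adj hia.adj hib.adj hc hab hca.symm hcb.symm hvx.adj with rfl | rfl | rfl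
    · exact full _ hia hja k hvx
    · exact full _ hib hjb k hvx
    · exact absurd rfl hx
  rcases hkij with rfl | rfl
  · rcases eq_or_eq_of_on hG hia hib hk hab with h | h
    · exact hca h
    · exact hcb h
  · rcases eq_or_eq_of_on hG hja hjb hk hab with h | h
    · exact hca h
    · exact hcb h

end TightFaces

end Cubic

/-! ### Uniqueness of the cube and the dodecahedron -/

instance : DecidableRel cubeGraph.Adj := fun x y => inferInstanceAs (Decidable (hammingDist x y = 1))

instance : DecidableRel octahedronGraph.Adj := fun x y => inferInstanceAs (Decidable (x.1 ≠ y.1))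

instance : DecidableRel tetrahedronGraph.Adj := fun x y => inferInstanceAs (Decidable (x ≠ y))

instance : DecidableRel dodecahedronGraph.Adj := fun x y => by
  unfold dodecahedronGraph SimpleGraph.fromRel; infer_instance

theorem cubeGraph_isRegularOfDegree : cubeGraph.IsRegularOfDegree 3 := by
  unfold SimpleGraph.IsRegularOfDegree
  decide

theorem dodecahedronGraph_isRegularOfDegree : dodecahedronGraph.IsRegularOfDegree 3 := by
  unfold SimpleGraph.IsRegularOfDegree
  decide +kernel

theorem cubeGraph_adj_iff : ∀ x y, cubeGraph.Adj x y ↔ ∃ i, y = Function.update x i (!x i) := by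
  decide +kernel

namespace TightFaces

variable {V : Type*} [Fintype V] {G : SimpleGraph V} {Φ : Type*} [Fintype Φ]

open Classical in
theorem nonempty_iso_cubeGraph [Nonempty V] (T : TightFaces G 4 Φ) (hG : G.IsRegularOfDegree 3)
    (h3 : ∀ x y z, G.Adj x y → G.Adj y z → ¬ G.Adj z x) (hcard : Fintype.card V = 8) :
    Nonempty (G ≃g cubeGraph) := by
  have hC := hG.cubic
  have e11 : ∀ k : Fin 3, k + 1 + 1 = k + 2 := by decide
  have e12 : ∀ k : Fin 3, k + 1 + 2 = k := by decide
  have e21 : ∀ k : Fin 3, k + 2 + 1 = k := by decide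
  have e22 : ∀ k : Fin 3, k + 2 + 2 = k + 1 := by decide
  have etot : ∀ x y : Fin 3, x = y ∨ y = x + 1 ∨ x = y + 1 := by decide
  have hinj : ∀ f : Fin 3 → V, (∀ k, f k ≠ f (k + 1)) → Function.Injective f := by
    intro f hf x y hxy
    rcases etot x y with h | rfl | rfl
    · exact h
    · exact absurd hxy (hf x)
    · exact absurd hxy.symm (hf y)
  have s1 : ∀ k : Fin 3, k ≠ k + 1 := by decide
  have s2 : ∀ k : Fin 3, k ≠ k + 2 := by decide
  have s3 : ∀ k : Fin 3, k + 1 ≠ k + 2 := by decide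
  obtain ⟨v⟩ := ‹Nonempty V›
  obtain ⟨a, ha, hNv⟩ : ∃ a : Fin 3 → V, Function.Injective a ∧
      ∀ u, G.Adj v u ↔ u = a 0 ∨ u = a 1 ∨ u = a 2 := by
    obtain ⟨p, q, r, h1, h2, h3, hN⟩ := hC v
    refine ⟨![p, q, r], hinj _ ?_, hN⟩
    intro k; fin_cases k
    · exact h1
    · exact h3
    · exact h2.symm
  have hav : ∀ k, G.Adj v (a k) := by
    intro k; rw [hNv]; fin_cases k <;> simp
  -- `F k` is the face at `v` between `a (k + 1)` and `a (k + 2)`; its fourth vertex will be `b k`.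
  -- Indices modulo three keep the construction symmetric.
  choose F A1 A2 using fun k : Fin 3 =>
    exists_corner (T := T) hC (hav (k + 1)) (hav (k + 2)) (ha.ne (s3 k))
  choose b hbv B2 B1 using fun k : Fin 3 =>
    on_quadrilateral h3 (A1 k).symm (A2 k) (ha.ne (s3 k))
  replace B1 := fun k => (B1 k).symm
  have hF : ∀ k, F k ≠ F (k + 1) := by
    intro k h
    have h1 := A2 (k + 1)
    rw [e12, ← h] at h1
    rcases eq_or_eq_of_on hC (A1 k) (A2 k) h1 (ha.ne (s3 k)) with h | h
    · exact s1 k (ha h)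
    · exact s2 k (ha h)
  have hb : Function.Injective b := by
    refine hinj b fun k h => hF k ?_
    have h1 := A1 (k + 1)
    have h2 := B1 (k + 1)
    rw [e11] at h1 h2
    rw [← h] at h2
    exact corner_unique hC (A2 k).symm (B2 k) h1.symm h2 (hbv k).symm
  have C1 : ∀ k, T.On (F (k + 1)) (a k) (b (k + 1)) := fun k => by
    have := B2 (k + 1); rwa [e12] at this
  have C2 : ∀ k, T.On (F (k + 2)) (a k) (b (k + 2)) := fun k => by
    have := B1 (k + 2); rwa [e21] at this
  -- `E k` is the face at `a k` away from `v`; its fourth vertex will be `w k`, and all three `w k`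
  -- turn out to be the vertex opposite to `v`.
  choose E D1 D2 using fun k : Fin 3 =>
    exists_corner (T := T) hC (C1 k).adj (C2 k).adj (hb.ne (s3 k))
  choose w hwa W2 W1 using fun k : Fin 3 =>
    on_quadrilateral h3 (D1 k).symm (D2 k) (hb.ne (s3 k))
  replace W1 := fun k => (W1 k).symm
  -- Otherwise `E (k + 1)` and `F k` share their corner at `b k`, so they coincide, and `F k` gets a
  -- third edge at `a (k + 1)`.
  have q1 : ∀ k, w (k + 1) ≠ a (k + 2) := by
    intro k h
    have h1 := W2 (k + 1)
    have h2 := D2 (k + 1)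
    have h4 := D1 (k + 1)
    rw [e12] at h1 h2
    rw [e11] at h4
    rw [h] at h1
    have h5 := corner_unique hC h2.symm h1 (B1 k).symm (B2 k).symm (ha.ne (s3 k))
    rw [h5] at h4
    rcases eq_or_eq_of_on hC (A1 k).symm (B1 k) h4 (hbv k).symm with h | h
    · exact hbv _ h
    · exact s2 k (hb h).symm
  have q2 : ∀ k, w (k + 2) ≠ a (k + 1) := by
    intro k h
    have h1 := W1 (k + 2)
    have h2 := D1 (k + 2)
    have h4 := D2 (k + 2)
    rw [e21] at h1 h2
    rw [e22] at h4
    rw [h] at h1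
    have h5 := corner_unique hC h1 h2.symm (B1 k).symm (B2 k).symm (ha.ne (s3 k))
    rw [h5] at h4
    rcases eq_or_eq_of_on hC (A2 k).symm (B2 k) h4 (hbv k).symm with h | h
    · exact hbv _ h
    · exact s1 k (hb h).symm
  have w1 : ∀ k, G.Adj (b k) (w (k + 1)) := fun k => by
    have := W2 (k + 1); rw [e12] at this; exact this.adj
  have w2 : ∀ k, G.Adj (b k) (w (k + 2)) := fun k => by
    have := W1 (k + 2); rw [e21] at this; exact this.adj
  have hNb : ∀ k u, G.Adj (b k) u → u = a (k + 1) ∨ u = a (k + 2) ∨ u = w (k + 1) :=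
    fun k u hu => hC.eq_of_adj (B1 k).adj.symm (B2 k).adj.symm (w1 k) (ha.ne (s3 k))
      (hwa (k + 1)).symm (q1 k).symm hu
  -- Besides `a (k + 1)` and `a (k + 2)` the vertex `b k` has only one neighbour, so `w (k + 1) = w
  -- (k + 2)`.
  have hw : ∀ k, w k = w 0 := by
    have h : ∀ k, w (k + 2) = w (k + 1) := by
      intro k
      rcases hNb k _ (w2 k) with h | h | h
      · exact absurd h (q2 k)
      · exact absurd h (hwa (k + 2))
      · exact h
    have h0 := h 0
    have h1 := h 1
    simp only [Fin.isValue, zero_add, show (1 : Fin 3) + 2 = 0 from rfl,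
      show (1 : Fin 3) + 1 = 2 from rfl] at h0 h1
    intro k; fin_cases k
    · rfl
    · exact (h1.trans h0).symm
    · exact h1.symm
  have hbw : ∀ k, G.Adj (b k) (w 0) := fun k => hw (k + 1) ▸ w1 k
  have hNa : ∀ k u, G.Adj (a k) u → u = v ∨ u = b (k + 1) ∨ u = b (k + 2) := fun k u hu =>
    hC.eq_of_adj (hav k).symm (C1 k).adj (C2 k).adj (hbv _).symm (hbv _).symm (hb.ne (s3 k)) hu
  have hNw : ∀ u, G.Adj (w 0) u → u = b 0 ∨ u = b 1 ∨ u = b 2 := fun u hu =>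
    hC.eq_of_adj (hbw 0).symm (hbw 1).symm (hbw 2).symm (hb.ne (by decide)) (hb.ne (by decide))
      (hb.ne (by decide)) hu
  let f : Bool → Bool → Bool → V := fun x y z => match x, y, z with
    | false, false, false => v
    | true, false, false => a 0
    | false, true, false => a 1
    | false, false, true => a 2
    | false, true, true => b 0
    | true, false, true => b 1
    | true, true, false => b 2
    | true, true, true => w 0
  let φ : (Fin 3 → Bool) → V := fun x => f (x 0) (x 1) (x 2)
  have hf : ∀ x y z, f x y z ∈ Set.range φ := fun x y z => ⟨![x, y, z], rfl⟩
  refine T.closedSetsTrivial.nonempty_iso hG cubeGraph_isRegularOfDegree (by simp [hcard]) φ ?_ ?_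
  · intro x y hxy
    obtain ⟨i, rfl⟩ := (cubeGraph_adj_iff x y).1 hxy
    have c1 := fun k => (C1 k).adj
    have c2 := fun k => (C2 k).adj
    have c10 : G.Adj (a 0) (b 1) := c1 0
    have c11 : G.Adj (a 1) (b 2) := c1 1
    have c12 : G.Adj (a 2) (b 0) := c1 2
    have c20 : G.Adj (a 0) (b 2) := c2 0
    have c21 : G.Adj (a 1) (b 0) := c2 1
    have c22 : G.Adj (a 2) (b 1) := c2 2
    have key : ∀ x y z, G.Adj (f x y z) (f (!x) y z) ∧ G.Adj (f x y z) (f x (!y) z) ∧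
        G.Adj (f x y z) (f x y (!z)) := by
      intro x y z
      cases x <;> cases y <;> cases z <;>
        simp [f, hav, (hav _).symm, hbw, (hbw _).symm, c10, c11, c12, c20, c21, c22, c10.symm,
          c11.symm, c12.symm, c20.symm, c21.symm, c22.symm]
    fin_cases i
    · exact (key _ _ _).1
    · exact (key _ _ _).2.1
    · exact (key _ _ _).2.2
  · intro x u hu
    have rv : v ∈ Set.range φ := hf false false false
    have rw' : w 0 ∈ Set.range φ := hf true true true
    have ra : ∀ k, a k ∈ Set.range φ := by
      intro k; fin_cases k
      · exact hf true false false
      · exact hf false true false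
      · exact hf false false true
    have rb : ∀ k, b k ∈ Set.range φ := by
      intro k; fin_cases k
      · exact hf false true true
      · exact hf true false true
      · exact hf true true false
    have na : ∀ k, G.Adj (a k) u → u ∈ Set.range φ := by
      intro k h
      rcases hNa k u h with rfl | rfl | rfl <;> simp only [rv, rb]
    have nb : ∀ k, G.Adj (b k) u → u ∈ Set.range φ := by
      intro k h
      rcases hNb k u h with rfl | rfl | rfl <;> simp only [ra, hw, rw']
    change G.Adj (f (x 0) (x 1) (x 2)) u at hu
    revert hu
    cases x 0 <;> cases x 1 <;> cases x 2 <;> intro hu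
    · rcases (hNv u).1 hu with rfl | rfl | rfl <;> exact ra _
    · exact na _ hu
    · exact na _ hu
    · exact nb _ hu
    · exact na _ hu
    · exact nb _ hu
    · exact nb _ hu
    · rcases hNw u hu with rfl | rfl | rfl <;> exact rb _

-- The graph is rebuilt in layers from one face `F₀` with vertices `a j`: their third neighbours `b
-- j`, the vertex `c j` completing the face across the edge `a j`, `a (j + 1)`, and the third
-- neighbours `d j` of the `c j`, which close up to the last pentagon.
open Classical in
theorem nonempty_iso_dodecahedronGraph [Nonempty V] (T : TightFaces G 5 Φ)
    (hG : G.IsRegularOfDegree 3) (h3 : ∀ x y z, G.Adj x y → G.Adj y z → ¬ G.Adj z x)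
    (h4 : ∀ x y z w, G.Adj x y → G.Adj y z → G.Adj z w → G.Adj w x → x = z ∨ y = w)
    (hcard : Fintype.card V = 20) : Nonempty (G ≃g dodecahedronGraph) := by
  have hC := hG.cubic
  obtain ⟨F₀, a, ha, ha2⟩ : ∃ (F₀ : Φ) (a : ZMod 5 → V), (∀ j, T.On F₀ (a j) (a (j + 1))) ∧
      ∀ j, a j ≠ a (j + 2) := by
    obtain ⟨v⟩ := ‹Nonempty V›
    obtain ⟨p, q, r, hpq, -, -, hN⟩ := hC v
    have hp := (hN p).2 (by simp)
    have hq := (hN q).2 (by simp)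
    obtain ⟨i, hi1, hi2⟩ := exists_corner (T := T) hC hp hq hpq
    obtain ⟨d, e, hd, o1, o2, o3⟩ := on_pentagon h3 h4 hi1.symm hi2 hpq
    have n1 : q ≠ e := fun h => h3 _ _ _ o1.adj o2.adj (h ▸ SimpleGraph.Adj.symm (by
      exact absurd (h ▸ o3.adj) (fun h' => h3 _ _ _ hi1.adj.symm hi2.adj h')))
    have n2 : d ≠ p := fun h => h3 _ _ _ hi1.adj.symm hi2.adj (h ▸ o1.adj)
    have n3 : e ≠ v := fun h => h3 _ _ _ hi2.adj o1.adj (h ▸ o2.adj)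
    refine ⟨i, (![p, v, q, d, e] : Fin 5 → V), ?_, ?_⟩
    · intro j
      change Fin 5 at j
      fin_cases j
      · exact hi1.symm
      · exact hi2
      · exact o1
      · exact o2
      · exact o3
    · intro j
      change Fin 5 at j
      fin_cases j
      · exact hpq
      · exact hd.symm
      · exact n1
      · exact n2
      · exact n3
  have em : ∀ j : ZMod 5, j - 1 + 1 = j := fun j => sub_add_cancel j 1
  have em2 : ∀ j : ZMod 5, j - 1 + 2 = j + 1 := fun j => by ring
  have ha' : ∀ j, T.On F₀ (a j) (a (j - 1)) := fun j => by
    have := ha (j - 1); rw [em] at this; exact this.symm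
  have haa : ∀ j, a (j - 1) ≠ a (j + 1) := fun j => by
    have := ha2 (j - 1); rwa [em2] at this
  choose b hb1 hb2 hb using fun j => hC.exists_third (a j) (a (j - 1)) (a (j + 1))
  choose F f1 f2 using fun j => exists_corner (T := T) hC (hb j) (ha j).adj (hb2 j)
  have hF₀ : ∀ j, F j ≠ F₀ := by
    intro j h
    have := f1 j
    rw [h] at this
    rcases eq_or_eq_of_on hC (ha' j) (ha j) this (haa j) with h | h
    · exact hb1 j h
    · exact hb2 j h
  obtain ⟨c, f3, f4, f5⟩ : ∃ c : ZMod 5 → V, (∀ j, T.On (F j) (a (j + 1)) (b (j + 1))) ∧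
      (∀ j, T.On (F j) (b (j + 1)) (c j)) ∧ ∀ j, T.On (F j) (c j) (b j) := by
    choose x c hx o1 o2 o3 using fun j => on_pentagon h3 h4 (f1 j).symm (f2 j) (hb2 j)
    -- The face `F j` leaves `a (j + 1)` along a new edge; leaving towards `a (j + 2)` it would
    -- share a corner with `F₀`.
    have hxb : ∀ j, x j = b (j + 1) := by
      intro j
      have e : j + 1 + 1 = j + 2 := by ring
      have e' : j + 1 - 1 = j := by ring
      have n2 := hb1 (j + 1)
      have n3 := hb2 (j + 1)
      have n1 := ha (j + 1)
      rw [e'] at n2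
      rw [e] at n3 n1
      rcases hC.eq_of_adj (ha j).adj.symm n1.adj (hb (j + 1)) (ha2 j) n2.symm n3.symm (o1 j).adj
        with h | h | h
      · exact absurd h (hx j)
      · exact absurd (corner_unique hC (f2 j).symm (h ▸ o1 j) (ha j).symm n1 (ha2 j)) (hF₀ j)
      · exact h
    exact ⟨c, fun j => hxb j ▸ o1 j, fun j => hxb j ▸ o2 j, o3⟩
  have hNa : ∀ j u, G.Adj (a j) u → u = a (j - 1) ∨ u = a (j + 1) ∨ u = b j := fun j u hu =>
    hC.eq_of_adj (ha' j).adj (ha j).adj (hb j) (haa j) (hb1 j).symm (hb2 j).symm hu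
  have f3' : ∀ j, T.On (F (j - 1)) (a j) (b j) := fun j => by
    have := f3 (j - 1); rwa [em] at this
  have f2' : ∀ j, T.On (F (j - 1)) (a j) (a (j - 1)) := fun j => by
    have := f2 (j - 1); rw [em] at this; exact this.symm
  have f4' : ∀ j, T.On (F (j - 1)) (b j) (c (j - 1)) := fun j => by
    have := f4 (j - 1); rwa [em] at this
  have hFF : ∀ j, F j ≠ F (j - 1) := by
    intro j h
    have := f2' j
    rw [← h] at this
    rcases eq_or_eq_of_on hC (f1 j) (f2 j) this (hb2 j) with h | h
    · exact hb1 j h.symm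
    · exact haa j h
  have n1 : ∀ j, c j ≠ a j := fun j h =>
    h3 _ _ _ (ha j).adj (hb (j + 1)) (h ▸ (f4 j).adj)
  have n2 : ∀ j, c (j - 1) ≠ a j := fun j h =>
    h3 _ _ _ (ha' j).adj (hb (j - 1)) (h ▸ (f5 (j - 1)).adj.symm)
  have n3 : ∀ j, c j ≠ c (j - 1) := fun j h => hFF j
    (corner_unique hC (f1 j).symm (f5 j).symm (f3' j).symm (h ▸ f4' j) (n1 j).symm)
  have hNb : ∀ j u, G.Adj (b j) u → u = a j ∨ u = c j ∨ u = c (j - 1) := fun j u hu =>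
    hC.eq_of_adj (hb j).symm (f5 j).adj.symm (f4' j).adj (n1 j).symm (n2 j).symm (n3 j) hu
  have n4 : ∀ j, b j ≠ b (j + 1) := fun j h =>
    h3 _ _ _ (hb j) (h ▸ (hb (j + 1)).symm) (ha j).adj.symm
  choose d hd1 hd2 hd using fun j => hC.exists_third (c j) (b j) (b (j + 1))
  have hNc : ∀ j u, G.Adj (c j) u → u = b j ∨ u = b (j + 1) ∨ u = d j := fun j u hu =>
    hC.eq_of_adj (f5 j).adj (f4 j).adj.symm (hd j) (n4 j) (hd1 j).symm (hd2 j).symm hu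
  -- `E j` is the face at `b j` away from `a j`; its two further vertices will be `d j` and `d (j -
  -- 1)`.
  choose E e1 e2 using fun j =>
    exists_corner (T := T) hC (f5 j).adj.symm (f4' j).adj (n3 j)
  have hEF : ∀ j, E j ≠ F j := by
    intro j h
    have := e2 j
    rw [h] at this
    rcases eq_or_eq_of_on hC (f1 j).symm (f5 j).symm this (n1 j).symm with h | h
    · exact n2 j h
    · exact n3 j h.symm
  have hEF' : ∀ j, E j ≠ F (j - 1) := by
    intro j h
    have := e1 j
    rw [h] at this
    rcases eq_or_eq_of_on hC (f3' j).symm (f4' j) this (n2 j).symm with h | h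
    · exact n1 j h
    · exact n3 j h
  have hE : ∀ j, T.On (E j) (c j) (d j) ∧ T.On (E j) (c (j - 1)) (d (j - 1)) ∧
      T.On (E j) (d j) (d (j - 1)) := by
    intro j
    obtain ⟨x, y, hxb, o1, o2, o3⟩ := on_pentagon h3 h4 (e2 j).symm (e1 j) (n3 j).symm
    have hx : x = d j := by
      rcases hNc j x o1.adj with h | h | h
      · exact absurd h hxb
      · exact absurd (corner_unique hC (e1 j).symm (h ▸ o1) (f5 j) (f4 j).symm (n4 j)) (hEF j)
      · exact h
    have hy : y = d (j - 1) := by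
      rcases hNc (j - 1) y o3.adj.symm with h | h | h
      · have h5 := f5 (j - 1)
        have h6 := (f4' j).symm
        have h7 := n4 (j - 1)
        rw [em] at h7
        exact absurd (corner_unique hC (e2 j).symm (h ▸ o3.symm) h6 h5 h7.symm) (hEF' j)
      · rw [em] at h
        exact absurd (h ▸ o2.adj.symm) fun h' => h3 _ _ _ h' o1.adj.symm (e1 j).adj.symm
      · exact h
    exact ⟨hx ▸ o1, hy ▸ o3.symm, hx ▸ hy ▸ o2⟩
  have hE' : ∀ j, T.On (E (j + 1)) (c j) (d j) ∧ T.On (E (j + 1)) (d j) (d (j + 1)) ∧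
      T.On (E (j + 1)) (c j) (b (j + 1)) := by
    intro j
    have h1 := (hE (j + 1)).2
    have h2 := (e2 (j + 1)).symm
    rw [add_sub_cancel_right] at h1 h2
    exact ⟨h1.1, h1.2.symm, h2⟩
  have hEE : ∀ j, E j ≠ E (j + 1) := by
    intro j h
    have := (hE' j).2.2
    rw [← h] at this
    rcases eq_or_eq_of_on hC (e1 j).symm (hE j).1 this (hd1 j).symm with h | h
    · exact n4 j h.symm
    · exact hd2 j h.symm
  have n5 : ∀ j, c j ≠ d (j - 1) := fun j h =>
    h3 _ _ _ (hE j).2.1.adj (h ▸ (e1 j).adj.symm) (e2 j).adj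
  have n6 : ∀ j, c j ≠ d (j + 1) := fun j h => by
    have h1 := (hE (j + 1)).1.adj
    rw [← h] at h1
    have h2 := (e2 (j + 1)).adj
    rw [add_sub_cancel_right] at h2
    exact h3 _ _ _ h1 h2.symm (e1 (j + 1)).adj
  have n7 : ∀ j, d (j - 1) ≠ d (j + 1) := fun j h => hEE j
    (corner_unique hC (hE j).1.symm (hE j).2.2 (hE' j).1.symm (h ▸ (hE' j).2.1) (n5 j))
  have hNd : ∀ j u, G.Adj (d j) u → u = c j ∨ u = d (j - 1) ∨ u = d (j + 1) := fun j u hu =>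
    hC.eq_of_adj (hd j).symm (hE j).2.2.adj (hE' j).2.1.adj (n5 j) (n6 j) (n7 j) hu
  -- The shift matches the model, where `(1, j)` is adjacent to `(2, j)` and `(2, j + 1)`, whereas
  -- `b j` is adjacent to `c (j - 1)` and `c j`.
  let φ : Fin 4 × ZMod 5 → V := fun x =>
    (![a x.2, b x.2, c (x.2 - 1), d (x.2 - 1)] : Fin 4 → V) x.1
  have ra : ∀ j, a j ∈ Set.range φ := fun j => ⟨(0, j), rfl⟩
  have rb : ∀ j, b j ∈ Set.range φ := fun j => ⟨(1, j), rfl⟩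
  have rc : ∀ j, c j ∈ Set.range φ := fun j => ⟨(2, j + 1), by simp [φ]⟩
  have rd : ∀ j, d j ∈ Set.range φ := fun j => ⟨(3, j + 1), by simp [φ]⟩
  refine T.closedSetsTrivial.nonempty_iso hG dodecahedronGraph_isRegularOfDegree
    (by simp [hcard]) φ ?_ ?_
  · have key : ∀ x y : Fin 4 × ZMod 5, ((x.1 = 0 ∧ y.1 = 0 ∧ y.2 = x.2 + 1) ∨
        (x.1 = 0 ∧ y.1 = 1 ∧ y.2 = x.2) ∨
        (x.1 = 1 ∧ y.1 = 2 ∧ (y.2 = x.2 ∨ y.2 = x.2 + 1)) ∨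
        (x.1 = 2 ∧ y.1 = 3 ∧ y.2 = x.2) ∨
        (x.1 = 3 ∧ y.1 = 3 ∧ y.2 = x.2 + 1)) → G.Adj (φ x) (φ y) := by
      rintro ⟨l, j⟩ ⟨l', j'⟩ h
      simp only at h
      rcases h with ⟨rfl, rfl, rfl⟩ | ⟨rfl, rfl, rfl⟩ | ⟨rfl, rfl, rfl | rfl⟩ | ⟨rfl, rfl, rfl⟩ |
        ⟨rfl, rfl, rfl⟩
      · exact (ha j).adj
      · exact hb _
      · exact (f4' _).adj
      · have := (f5 j).adj.symm
        simpa [φ] using this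
      · exact hd _
      · have := (hE j).2.2.adj.symm
        simpa [φ] using this
    intro x y hxy
    rw [dodecahedronGraph, SimpleGraph.fromRel_adj] at hxy
    rcases hxy.2 with h | h
    · exact key x y h
    · exact (key y x h).symm
  · rintro ⟨l, j⟩ u hu
    fin_cases l
    · rcases hNa _ u hu with rfl | rfl | rfl <;> simp only [ra, rb]
    · rcases hNb _ u hu with rfl | rfl | rfl <;> simp only [ra, rc]
    · rcases hNc _ u hu with rfl | rfl | rfl <;> simp only [rb, rd]
    · rcases hNd _ u hu with rfl | rfl | rfl <;> simp only [rc, rd]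

end TightFaces

/-! ### Triangulations and uniqueness of the icosahedron -/

instance : DecidableRel icosahedronGraph.Adj := fun x y => by
  unfold icosahedronGraph SimpleGraph.fromRel
  rcases x with b | p <;> rcases y with c | q <;> dsimp only <;> infer_instance

theorem icosahedronGraph_isRegularOfDegree : icosahedronGraph.IsRegularOfDegree 5 := by
  unfold SimpleGraph.IsRegularOfDegree
  decide +kernel

theorem octahedronGraph_isRegularOfDegree : octahedronGraph.IsRegularOfDegree 4 := by
  unfold SimpleGraph.IsRegularOfDegree
  decide

theorem tetrahedronGraph_isRegularOfDegree : tetrahedronGraph.IsRegularOfDegree 3 := by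
  unfold SimpleGraph.IsRegularOfDegree
  decide

/-- In a simple graph on five vertices in which every vertex has degree two, a path of four vertices
closes up to a pentagon. -/
theorem exists_pentagon_of_path {V : Type*} [DecidableEq V] {N : Finset V} (hN : N.card = 5)
    {R : V → V → Prop} (hR : ∀ x y, R x y → R y x) (hirr : ∀ x, ¬ R x x)
    (hmem : ∀ x y, R x y → x ∈ N)
    (hdeg : ∀ x ∈ N, ∃ y z, y ≠ z ∧ R x y ∧ R x z ∧ ∀ w, R x w → w = y ∨ w = z)
    {p q r s : V} (hpq : R p q) (hqr : R q r) (hrs : R r s) (hpr : p ≠ r) (hqs : q ≠ s) :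
    ∃ t, R s t ∧ R t p ∧ p ≠ s ∧ t ≠ p ∧ t ≠ q ∧ t ≠ r ∧ t ≠ s ∧
      ∀ u ∈ N, u = p ∨ u = q ∨ u = r ∨ u = s ∨ u = t := by
  have two : ∀ {x a b c : V}, R x a → R x b → a ≠ b → R x c → c = a ∨ c = b := by
    intro x a b c ha hb hab hc
    obtain ⟨y, z, -, -, -, h⟩ := hdeg x (hmem _ _ ha)
    have := h _ ha
    have := h _ hb
    have := h _ hc
    grind
  have hpqne : p ≠ q := fun h => hirr q (h ▸ hpq)
  have hqrne : q ≠ r := fun h => hirr r (h ▸ hqr)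
  have hrsne : r ≠ s := fun h => hirr s (h ▸ hrs)
  have hp := hmem _ _ hpq
  have hq := hmem _ _ hqr
  have hr := hmem _ _ hrs
  have hs := hmem _ _ (hR _ _ hrs)
  -- If `p = s`, the triangle `p q r` is saturated, and the two vertices left over cannot have
  -- degree two.
  have hps : p ≠ s := by
    rintro rfl
    have hc : (N \ {p, q, r}).card = 2 := by
      rw [Finset.card_sdiff_of_subset (by simp [Finset.insert_subset_iff, hp, hq, hr]), hN,
        Finset.card_eq_three.2 ⟨p, q, r, hpqne, hpr, hqrne, rfl⟩]
    obtain ⟨x, y, hxy, hX⟩ := Finset.card_eq_two.1 hc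
    have hmemX : ∀ w, w ∈ N ∧ w ≠ p ∧ w ≠ q ∧ w ≠ r ↔ w = x ∨ w = y := by
      intro w
      have : w ∈ N \ {p, q, r} ↔ w ∈ ({x, y} : Finset V) := by rw [hX]
      simpa using this
    have hx := (hmemX x).2 (Or.inl rfl)
    have key : ∀ w, R x w → w = y := by
      intro w hw
      have h1 : w ≠ p := by
        rintro rfl
        rcases two hpq (hR _ _ hrs) hqrne (hR _ _ hw) with h | h
        · exact hx.2.2.1 h
        · exact hx.2.2.2 h
      have h2 : w ≠ q := by
        rintro rfl
        rcases two (hR _ _ hpq) hqr hpr (hR _ _ hw) with h | h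
        · exact hx.2.1 h
        · exact hx.2.2.2 h
      have h3 : w ≠ r := by
        rintro rfl
        rcases two (hR _ _ hqr) hrs hqs (hR _ _ hw) with h | h
        · exact hx.2.2.1 h
        · exact hx.2.1 h
      rcases (hmemX w).1 ⟨hmem _ _ (hR _ _ hw), h1, h2, h3⟩ with rfl | h
      · exact absurd hw (hirr _)
      · exact h
    obtain ⟨y', z', hyz, h1, h2, -⟩ := hdeg x hx.1
    exact hyz ((key _ h1).trans (key _ h2).symm)
  -- As `q` and `r` are saturated, the one vertex `t` left over must have `p` and `s` as its two
  -- neighbours.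
  have hc : (N \ {p, q, r, s}).card = 1 := by
    rw [Finset.card_sdiff_of_subset (by simp [Finset.insert_subset_iff, hp, hq, hr, hs]), hN]
    have : ({p, q, r, s} : Finset V).card = 4 := by
      rw [Finset.card_insert_of_notMem (by simp [hpqne, hpr, hps]),
        Finset.card_eq_three.2 ⟨q, r, s, hqrne, hqs, hrsne, rfl⟩]
    rw [this]
  obtain ⟨t, hX⟩ := Finset.card_eq_one.1 hc
  have hmemX : ∀ w, w ∈ N ∧ w ≠ p ∧ w ≠ q ∧ w ≠ r ∧ w ≠ s ↔ w = t := by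
    intro w
    have : w ∈ N \ {p, q, r, s} ↔ w ∈ ({t} : Finset V) := by rw [hX]
    simpa using this
  have ht := (hmemX t).2 rfl
  have key : ∀ w, R t w → w = p ∨ w = s := by
    intro w hw
    have h1 : w ≠ q := by
      rintro rfl
      rcases two (hR _ _ hpq) hqr hpr (hR _ _ hw) with h | h
      · exact ht.2.1 h
      · exact ht.2.2.2.1 h
    have h2 : w ≠ r := by
      rintro rfl
      rcases two (hR _ _ hqr) hrs hqs (hR _ _ hw) with h | h
      · exact ht.2.2.1 h
      · exact ht.2.2.2.2 h
    by_contra! hne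
    have := (hmemX w).1 ⟨hmem _ _ (hR _ _ hw), hne.1, h1, h2, hne.2⟩
    exact hirr t (this ▸ hw)
  obtain ⟨y, z, hyz, h1, h2, -⟩ := hdeg t ht.1
  have hR2 : R t p ∧ R t s := by
    rcases key _ h1 with rfl | rfl <;> rcases key _ h2 with rfl | rfl
    · exact absurd rfl hyz
    · exact ⟨h1, h2⟩
    · exact ⟨h2, h1⟩
    · exact absurd rfl hyz
  refine ⟨t, hR _ _ hR2.2, hR2.1, hps, ht.2.1, ht.2.2.1, ht.2.2.2.1, ht.2.2.2.2, fun u hu => ?_⟩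
  by_contra! hne
  exact hne.2.2.2.2 ((hmemX u).1 ⟨hu, hne.1, hne.2.1, hne.2.2.1, hne.2.2.2.1⟩)

namespace TightFaces

variable {V : Type*} [Fintype V] {G : SimpleGraph V} {Φ : Type*} [Fintype Φ]

/-- Three vertices that form a face of a triangulation. -/
def Tri (T : TightFaces G 3 Φ) (x y z : V) : Prop :=
  ∃ i, T.On i x y ∧ T.On i y z ∧ T.On i z x

variable {T : TightFaces G 3 Φ}

theorem Tri.rotate {x y z : V} (h : T.Tri x y z) : T.Tri y z x := by
  obtain ⟨i, h1, h2, h3⟩ := h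
  exact ⟨i, h2, h3, h1⟩

theorem Tri.swap {x y z : V} (h : T.Tri x y z) : T.Tri x z y := by
  obtain ⟨i, h1, h2, h3⟩ := h
  exact ⟨i, h3.symm, h2.symm, h1.symm⟩

theorem Tri.adj {x y z : V} (h : T.Tri x y z) : G.Adj x y := by
  obtain ⟨i, h1, -, -⟩ := h
  exact h1.adj

theorem exists_third {i : Φ} {x y : V} (h : T.On i x y) :
    ∃ z, T.On i y z ∧ T.On i z x ∧ z ≠ x ∧ z ≠ y := by
  obtain ⟨z, hz, hyz⟩ := exists_next h
  exact ⟨z, hyz, on_triangle h hyz hz.symm, hz, hyz.adj.ne'⟩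

theorem face_eq_iff_of_triangle {i : Φ} {x y z : V} (h1 : T.On i x y) (h2 : T.On i y z)
    (h3 : T.On i z x) (u v : V) (huv : G.Adj u v) :
    T.face i ⟨s(u, v), huv⟩ ≠ 0 ↔ s(u, v) ∈ [s(x, y), s(y, z), s(z, x)] := by
  have n1 := h1.adj.ne
  have n2 := h2.adj.ne
  have n3 := h3.adj.ne
  refine ⟨fun h => mem_of_on (by simp; grind) rfl (by
    simp only [List.forall_mem_cons, List.not_mem_nil]; exact ⟨h1, h2, h3, by simp⟩)
    (⟨huv, h⟩ : T.On i u v), fun h => ?_⟩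
  simp only [List.mem_cons, List.not_mem_nil, or_false] at h
  obtain ⟨h1', h1⟩ := h1
  obtain ⟨h2', h2⟩ := h2
  obtain ⟨h3', h3⟩ := h3
  rcases h with h | h | h
  · rwa [show (⟨s(u, v), huv⟩ : G.edgeSet) = ⟨s(x, y), h1'⟩ from Subtype.ext h]
  · rwa [show (⟨s(u, v), huv⟩ : G.edgeSet) = ⟨s(y, z), h2'⟩ from Subtype.ext h]
  · rwa [show (⟨s(u, v), huv⟩ : G.edgeSet) = ⟨s(z, x), h3'⟩ from Subtype.ext h]

/-- Different faces with the same three edges would add up to zero. The only nontrivial relation is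
the sum of all faces, so there would be just two faces. -/
theorem eq_of_triangle (hΦ : 2 < Fintype.card Φ) {i j : Φ} {x y z : V} (h1 : T.On i x y)
    (h2 : T.On i y z) (h3 : T.On i z x) (k1 : T.On j x y) (k2 : T.On j y z) (k3 : T.On j z x) :
    i = j := by
  classical
  by_contra hij
  have h01 : ∀ c d : ZMod 2, (c ≠ 0 ↔ d ≠ 0) → c = d := by decide
  have hface : T.face i = T.face j := by
    ext ⟨e, he⟩
    induction e using Sym2.ind with
    | _ u v =>
      exact h01 _ _ ((face_eq_iff_of_triangle h1 h2 h3 u v he).trans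
        (face_eq_iff_of_triangle k1 k2 k3 u v he).symm)
  have hsum : ∑ k, (Pi.single i 1 + Pi.single j 1 : Φ → ZMod 2) k • T.face k = 0 := by
    simp only [Pi.add_apply, add_smul, Finset.sum_add_distrib, Pi.single_apply, ite_smul, one_smul,
      zero_smul, Finset.sum_ite_eq', Finset.mem_univ, if_true, hface]
    ext e
    exact CharTwo.add_self_eq_zero _
  rcases T.eq_zero_or_one _ hsum with h | h
  · have := congrFun h i
    simp [hij] at this
  · have hle : Fintype.card Φ ≤ ({i, j} : Finset Φ).card := by
      rw [← Finset.card_univ]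
      refine Finset.card_le_card fun k _ => ?_
      by_contra hk
      simp only [Finset.mem_insert, Finset.mem_singleton, not_or] at hk
      have := congrFun h k
      simp [hk.1, hk.2] at this
    exact absurd (hle.trans Finset.card_le_two) hΦ.not_ge

/-- The apexes of the two faces at the edge differ, since faces with a common apex would have the
same edges. Hence the neighbours of a vertex, joined when they span a face with it, form a graph in
which all degrees are two. -/
theorem exists_two_tri (hΦ : 2 < Fintype.card Φ) {x y : V} (h : G.Adj x y) :
    ∃ z w, z ≠ w ∧ T.Tri x y z ∧ T.Tri x y w ∧ ∀ u, T.Tri x y u → u = z ∨ u = w := by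
  obtain ⟨i, j, hij, hi, hj, hall⟩ := exists_faces (T := T) h
  obtain ⟨z, i2, i3, hz1, hz2⟩ := exists_third hi
  obtain ⟨w, j2, j3, hw1, hw2⟩ := exists_third hj
  refine ⟨z, w, fun h => hij (eq_of_triangle hΦ hi i2 i3 hj (h ▸ j2) (h ▸ j3)), ⟨i, hi, i2, i3⟩,
    ⟨j, hj, j2, j3⟩, ?_⟩
  have key : ∀ {k : Φ} {z u : V}, T.On k x y → T.On k y z → T.On k z x → z ≠ x → T.On k y u →
      T.On k u x → u = z := by
    intro k z u k1 k2 k3 hzx k4 k5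
    have n1 := k1.adj.ne
    have n2 := k4.adj.ne'
    have n3 := k5.adj.ne
    have := (face_eq_iff_of_triangle k1 k2 k3 y u k4.adj).1 k4.2
    simp only [List.mem_cons, List.not_mem_nil, or_false, Sym2.eq_iff] at this
    grind
  rintro u ⟨k, k1, k2, k3⟩
  rcases hall k k1 with rfl | rfl
  · exact Or.inl (key hi i2 i3 hz1 k2 k3)
  · exact Or.inr (key hj j2 j3 hw1 k2 k3)

theorem tri_eq_or_eq (hΦ : 2 < Fintype.card Φ) {x y a b c : V} (ha : T.Tri x y a)
    (hb : T.Tri x y b) (hab : a ≠ b) (hc : T.Tri x y c) : c = a ∨ c = b := by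
  obtain ⟨z, w, -, -, -, h⟩ := exists_two_tri (T := T) hΦ ha.adj
  have := h _ ha
  have := h _ hb
  have := h _ hc
  grind

open Classical in
/-- Four consecutive neighbours of a vertex of a `5`-regular triangulation determine the fifth. -/
theorem exists_fan (hΦ : 2 < Fintype.card Φ) (hG : G.IsRegularOfDegree 5) {v p q r s : V}
    (hpq : T.Tri v p q) (hqr : T.Tri v q r) (hrs : T.Tri v r s) (hpr : p ≠ r) (hqs : q ≠ s) :
    ∃ t, T.Tri v s t ∧ T.Tri v t p ∧ p ≠ s ∧ t ≠ p ∧ t ≠ q ∧ t ≠ r ∧ t ≠ s ∧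
      ∀ u, G.Adj v u → u = p ∨ u = q ∨ u = r ∨ u = s ∨ u = t := by
  have := exists_pentagon_of_path (N := G.neighborFinset v) (R := fun x y => T.Tri v x y)
    (by rw [SimpleGraph.card_neighborFinset_eq_degree]; exact hG v) (fun x y h => h.swap)
    (fun x h => h.rotate.adj.ne rfl)
    (fun x y h => (SimpleGraph.mem_neighborFinset _ _ _).2 h.adj)
    (fun x hx => exists_two_tri hΦ ((SimpleGraph.mem_neighborFinset _ _ _).1 hx)) hpq hqr hrs hpr hqs
  simpa only [SimpleGraph.mem_neighborFinset] using this

-- The graph grows in layers: a vertex `o`, its neighbours `a j` in cyclic order, the apex `b j`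
-- other than `o` over the edge `a j`, `a (j + 1)`, and a last vertex `c 0`. At each vertex four
-- consecutive neighbours are known, and `exists_fan` supplies the fifth.
open Classical in
theorem nonempty_iso_icosahedronGraph [Nonempty V] (T : TightFaces G 3 Φ)
    (hΦ : 2 < Fintype.card Φ) (hG : G.IsRegularOfDegree 5) (hcard : Fintype.card V = 12) :
    Nonempty (G ≃g icosahedronGraph) := by
  obtain ⟨o, a, ha, haa, hNo⟩ : ∃ (o : V) (a : ZMod 5 → V), (∀ j, T.Tri o (a j) (a (j + 1))) ∧
      (∀ j, a (j - 1) ≠ a (j + 1)) ∧ ∀ u, G.Adj o u → u ∈ Set.range a := by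
    obtain ⟨o⟩ := ‹Nonempty V›
    obtain ⟨q, hq⟩ : ∃ q, G.Adj o q := by
      have h : 0 < (G.neighborFinset o).card := by
        rw [SimpleGraph.card_neighborFinset_eq_degree, hG o]; norm_num
      obtain ⟨q, hq⟩ := Finset.card_pos.1 h
      exact ⟨q, (SimpleGraph.mem_neighborFinset _ _ _).1 hq⟩
    obtain ⟨p, r, hpr, h1, h2, -⟩ := exists_two_tri (T := T) hΦ hq
    obtain ⟨s, s', hss, h3, h4, -⟩ := exists_two_tri (T := T) hΦ h2.swap.adj
    obtain ⟨s, hs, hqs⟩ : ∃ s, T.Tri o r s ∧ q ≠ s := by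
      by_cases h : q = s
      · exact ⟨s', h4, fun h' => hss (h.symm.trans h')⟩
      · exact ⟨s, h3, h⟩
    obtain ⟨t, h5, h6, n1, n2, n3, n4, n5, hN⟩ := exists_fan hΦ hG h1.swap h2 hs hpr hqs
    have npq := h1.rotate.adj.ne
    refine ⟨o, (![p, q, r, s, t] : Fin 5 → V), ?_, ?_, ?_⟩
    · intro j
      change Fin 5 at j
      fin_cases j
      · exact h1.swap
      · exact h2
      · exact hs
      · exact h5
      · exact h6
    · intro j
      change Fin 5 at j
      fin_cases j
      · exact n3
      · exact hpr
      · exact hqs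
      · exact n4.symm
      · exact n1.symm
    · intro u hu
      rcases hN u hu with rfl | rfl | rfl | rfl | rfl
      · exact ⟨(0 : Fin 5), rfl⟩
      · exact ⟨(1 : Fin 5), rfl⟩
      · exact ⟨(2 : Fin 5), rfl⟩
      · exact ⟨(3 : Fin 5), rfl⟩
      · exact ⟨(4 : Fin 5), rfl⟩
  have em : ∀ j : ZMod 5, j - 1 + 1 = j := fun j => sub_add_cancel j 1
  have hother : ∀ j, ∃ b, b ≠ o ∧ T.Tri (a j) (a (j + 1)) b := by
    intro j
    obtain ⟨z, w, hzw, h1, h2, -⟩ := exists_two_tri (T := T) hΦ (ha j).rotate.adj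
    by_cases h : z = o
    · exact ⟨w, fun h' => hzw (h.trans h'.symm), h2⟩
    · exact ⟨z, h, h1⟩
  choose b hbo hb using hother
  have ha' : ∀ j, T.Tri (a j) (a (j - 1)) o := fun j => by
    have := (ha (j - 1)).rotate.rotate.swap
    rwa [em] at this
  have hb' : ∀ j, T.Tri (a j) (b (j - 1)) (a (j - 1)) := fun j => by
    have := (hb (j - 1)).rotate
    rwa [em] at this
  have fanA : ∀ j, T.Tri (a j) (b j) (b (j - 1)) ∧ b (j - 1) ≠ a (j + 1) ∧ b j ≠ b (j - 1) ∧
      b j ≠ a (j - 1) ∧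
      ∀ u, G.Adj (a j) u → u = b (j - 1) ∨ u = a (j - 1) ∨ u = o ∨ u = a (j + 1) ∨ u = b j := by
    intro j
    obtain ⟨t, h1, h2, n1, n2, n3, n4, n5, hN⟩ := exists_fan hΦ hG (hb' j) (ha' j)
      (ha j).rotate.swap (hbo (j - 1)) (haa j)
    have ht : t = b j := by
      rcases tri_eq_or_eq hΦ (ha j).rotate (hb j) (hbo j).symm h1 with h | h
      · exact absurd h n4
      · exact h
    subst ht
    exact ⟨h2, n1, n2, n3, hN⟩
  have hbb : ∀ j, T.Tri (b j) (b (j - 1)) (a j) := fun j => (fanA j).1.rotate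
  have hbb' : ∀ j, T.Tri (b j) (a (j + 1)) (b (j + 1)) := fun j => by
    have := (hbb (j + 1)).rotate
    rwa [add_sub_cancel_right] at this
  have hfanB : ∀ j, ∃ c, T.Tri (b j) (b (j + 1)) c ∧ T.Tri (b j) c (b (j - 1)) ∧
      b (j - 1) ≠ b (j + 1) ∧ c ≠ a j ∧ c ≠ a (j + 1) ∧
      ∀ u, G.Adj (b j) u → u = b (j - 1) ∨ u = a j ∨ u = a (j + 1) ∨ u = b (j + 1) ∨ u = c := by
    intro j
    have n : a j ≠ b (j + 1) := fun h => by
      have := (fanA (j + 1)).2.2.2.1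
      rw [add_sub_cancel_right] at this
      exact this h.symm
    obtain ⟨t, h1, h2, n1, n2, n3, n4, n5, hN⟩ := exists_fan hΦ hG (hbb j) (hb j).rotate.rotate
      (hbb' j) (fanA j).2.1 n
    exact ⟨t, h1, h2, n1, n3, n4, hN⟩
  choose c hc1 hc2 hbne hca hca' hNb using hfanB
  -- The edge from `b j` to `b (j + 1)` has the two apexes `a (j + 1)` and `c j`; `c (j + 1)` is
  -- also an apex, and it is not `a (j + 1)`.
  have hcc : ∀ j, c (j + 1) = c j := by
    intro j
    have h1 := (hc2 (j + 1)).swap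
    rw [add_sub_cancel_right] at h1
    have h2 : T.Tri (b (j + 1)) (b j) (a (j + 1)) := by
      have := hbb (j + 1)
      rwa [add_sub_cancel_right] at this
    have h3 : T.Tri (b (j + 1)) (b j) (c j) := (hc1 j).rotate.swap
    rcases tri_eq_or_eq hΦ h2 h3 (hca' j).symm h1 with h | h
    · exact absurd h (hca (j + 1))
    · exact h
  have hc : ∀ j, c j = c 0 := by
    have h0 := hcc 0
    have h1 := hcc 1
    have h2 := hcc 2
    have h3 := hcc 3
    intro j
    change Fin 5 at j
    fin_cases j
    · rfl
    · exact h0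
    · exact h1.trans h0
    · exact h2.trans (h1.trans h0)
    · exact h3.trans (h2.trans (h1.trans h0))
  have hcb : ∀ j, T.Tri (c 0) (b j) (b (j + 1)) := fun j => by
    have := (hc1 j).rotate.rotate
    rwa [hc j] at this
  have hNc : ∀ u, G.Adj (c 0) u → u ∈ Set.range b := by
    intro u hu
    obtain ⟨t, h1, h2, n1, n2, n3, n4, n5, hN⟩ := exists_fan hΦ hG (hcb 0) (hcb 1) (hcb 2)
      (hbne 1) (hbne 2)
    have ht : t = b 4 := by
      have h6 : T.Tri (c 0) (b 3) (b 4) := hcb 3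
      have h7 : T.Tri (c 0) (b 3) (b 2) := (hcb 2).swap
      rcases tri_eq_or_eq hΦ h7 h6 (hbne 3) h1 with h | h
      · exact absurd h n4
      · exact h
    rcases hN u hu with rfl | rfl | rfl | rfl | rfl
    · exact ⟨_, rfl⟩
    · exact ⟨_, rfl⟩
    · exact ⟨_, rfl⟩
    · exact ⟨_, rfl⟩
    · exact ⟨4, ht.symm⟩
  -- The shift matches the model, where `(false, j)` is adjacent to `(true, j)` and `(true, j + 1)`,
  -- whereas `a j` is adjacent to `b (j - 1)` and `b j`.
  let φ : Bool ⊕ (Bool × ZMod 5) → V := fun x => match x with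
    | Sum.inl false => o
    | Sum.inl true => c 0
    | Sum.inr (false, j) => a j
    | Sum.inr (true, j) => b (j - 1)
  have ro : o ∈ Set.range φ := ⟨Sum.inl false, rfl⟩
  have rc : ∀ j, c j ∈ Set.range φ := fun j => ⟨Sum.inl true, (hc j).symm⟩
  have ra : ∀ j, a j ∈ Set.range φ := fun j => ⟨Sum.inr (false, j), rfl⟩
  have rb : ∀ j, b j ∈ Set.range φ := fun j => ⟨Sum.inr (true, j + 1), by simp [φ]⟩
  refine T.closedSetsTrivial.nonempty_iso hG icosahedronGraph_isRegularOfDegree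
    (by simp [hcard]) φ ?_ ?_
  · have apex : ∀ e p, p.1 = e → G.Adj (φ (Sum.inl e)) (φ (Sum.inr p)) := by
      rintro e ⟨e', j⟩ rfl
      cases e'
      · exact (ha j).adj
      · exact (hcb _).adj
    have key : ∀ p q : Bool × ZMod 5, ((p.1 = q.1 ∧ q.2 = p.2 + 1) ∨
        (p.1 = false ∧ q.1 = true ∧ (q.2 = p.2 ∨ q.2 = p.2 + 1))) →
        G.Adj (φ (Sum.inr p)) (φ (Sum.inr q)) := by
      rintro ⟨e, j⟩ ⟨e', j'⟩ h
      simp only at h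
      rcases h with ⟨rfl, rfl⟩ | ⟨rfl, rfl, rfl | rfl⟩
      · cases e
        · exact (ha j).rotate.adj
        · have := (hbb j).adj.symm
          simpa [φ] using this
      · exact (hb' _).adj
      · have := (hb j).swap.adj
        simpa [φ] using this
    intro x y hxy
    rw [icosahedronGraph, SimpleGraph.fromRel_adj] at hxy
    rcases x with e | p <;> rcases y with e' | q
    · simp at hxy
    · exact apex _ _ (by simpa using hxy.2)
    · exact (apex _ _ (by simpa using hxy.2)).symm
    · rcases hxy.2 with h | h
      · exact key _ _ h
      · exact (key _ _ h).symm
  · rintro (e | ⟨e, j⟩) u hu <;> cases e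
    · obtain ⟨j, rfl⟩ := hNo u hu
      exact ra j
    · obtain ⟨j, rfl⟩ := hNc u hu
      exact rb j
    · rcases (fanA j).2.2.2.2 u hu with rfl | rfl | rfl | rfl | rfl <;> simp only [ro, ra, rb]
    · rcases hNb _ u hu with rfl | rfl | rfl | rfl | rfl <;> simp only [ra, rb, rc]

end TightFaces

/-! ### Uniqueness of the tetrahedron and the octahedron -/

section Small

variable {V : Type*} [Fintype V] {G : SimpleGraph V}

open Classical in
theorem nonempty_iso_tetrahedronGraph (hG : G.IsRegularOfDegree 3) (hcard : Fintype.card V = 4) :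
    Nonempty (G ≃g tetrahedronGraph) := by
  have e : Fin 4 ≃ V := (Fintype.equivFinOfCardEq hcard).symm
  refine SimpleGraph.nonempty_iso_of_bijective hG tetrahedronGraph_isRegularOfDegree e e.bijective ?_
  intro x y hxy
  have hsub : G.neighborFinset (e x) ⊆ Finset.univ.erase (e x) := fun u hu =>
    Finset.mem_erase.2 ⟨((SimpleGraph.mem_neighborFinset _ _ _).1 hu).ne', Finset.mem_univ u⟩
  have heq := Finset.eq_of_subset_of_card_le hsub (by
    rw [SimpleGraph.card_neighborFinset_eq_degree, hG, Finset.card_erase_of_mem (Finset.mem_univ _),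
      Finset.card_univ, hcard])
  rw [← SimpleGraph.mem_neighborFinset, heq]
  exact Finset.mem_erase.2 ⟨fun h => hxy (e.injective h).symm, Finset.mem_univ _⟩

-- Each vertex `v` has exactly one non-neighbour `t v` besides itself. The map `t` is an involution
-- without fixed points, so the graph is complete up to a perfect matching.
open Classical in
theorem nonempty_iso_octahedronGraph (hG : G.IsRegularOfDegree 4) (hcard : Fintype.card V = 6) :
    Nonempty (G ≃g octahedronGraph) := by
  have hanti : ∀ v, ∃ w, w ≠ v ∧ ∀ u, ¬ G.Adj v u ↔ u = v ∨ u = w := by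
    intro v
    have hc : (Finset.univ.erase v \ G.neighborFinset v).card = 1 := by
      rw [Finset.card_sdiff_of_subset, SimpleGraph.card_neighborFinset_eq_degree, hG,
        Finset.card_erase_of_mem (Finset.mem_univ _), Finset.card_univ, hcard]
      exact fun u hu =>
        Finset.mem_erase.2 ⟨((SimpleGraph.mem_neighborFinset _ _ _).1 hu).ne', Finset.mem_univ u⟩
    obtain ⟨w, hw⟩ := Finset.card_eq_one.1 hc
    have hmem : ∀ u, u ≠ v ∧ ¬ G.Adj v u ↔ u = w := by
      intro u
      have : u ∈ Finset.univ.erase v \ G.neighborFinset v ↔ u ∈ ({w} : Finset V) := by rw [hw]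
      simpa using this
    refine ⟨w, ((hmem w).2 rfl).1, fun u => ?_⟩
    by_cases huv : u = v
    · simp [huv]
    · simpa [huv] using hmem u
  choose t ht hadj using hanti
  have htt : ∀ v, t (t v) = v := by
    intro v
    have h1 : ¬ G.Adj v (t v) := (hadj v _).2 (Or.inr rfl)
    rcases (hadj (t v) v).1 fun h => h1 h.symm with h | h
    · exact absurd h.symm (ht v)
    · exact h.symm
  have hout : ∀ s : Finset V, s.card < 6 → ∃ v, v ∉ s := fun s hs => by
    by_contra! h
    rw [Finset.eq_univ_iff_forall.2 h, Finset.card_univ, hcard] at hs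
    exact lt_irrefl _ hs
  obtain ⟨p⟩ : Nonempty V := Fintype.card_pos_iff.1 (by lia)
  obtain ⟨q, hq⟩ := hout {p, t p} (Finset.card_le_two.trans_lt (by norm_num))
  obtain ⟨r, hr⟩ := hout {p, t p, q, t q} (Finset.card_le_four.trans_lt (by norm_num))
  simp only [Finset.mem_insert, Finset.mem_singleton, not_or] at hq hr
  let u : Fin 3 → V := ![p, q, r]
  have hu : ∀ i j, i ≠ j → u i ≠ u j ∧ u i ≠ t (u j) := by
    have hsymm : ∀ x y, x ≠ t y → y ≠ t x := fun x y h h' => h (by rw [h', htt])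
    intro i j hij
    fin_cases i <;> fin_cases j <;> first | exact absurd rfl hij | skip
    · exact ⟨Ne.symm hq.1, hsymm _ _ hq.2⟩
    · exact ⟨Ne.symm hr.1, hsymm _ _ hr.2.1⟩
    · exact ⟨hq.1, hq.2⟩
    · exact ⟨Ne.symm hr.2.2.1, hsymm _ _ hr.2.2.2⟩
    · exact ⟨hr.1, hr.2.1⟩
    · exact ⟨hr.2.2.1, hr.2.2.2⟩
  let φ : Fin 3 × Bool → V := fun x => if x.2 then u x.1 else t (u x.1)
  have hφ : ∀ x y : Fin 3 × Bool, x.1 ≠ y.1 → φ x ≠ φ y ∧ φ x ≠ t (φ y) := by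
    rintro ⟨i, b⟩ ⟨j, c⟩ hij
    have h1 := hu i j hij
    have h2 := hu j i hij.symm
    have hinj : ∀ x y, t x = t y → x = y := fun x y h => by rw [← htt x, h, htt]
    cases b <;> cases c <;> simp only [φ, htt, Bool.false_eq_true, if_false, if_true]
    · exact ⟨fun h => h1.1 (hinj _ _ h), fun h => h2.2 h.symm⟩
    · exact ⟨fun h => h2.2 h.symm, fun h => h1.1 (hinj _ _ h)⟩
    · exact ⟨h1.2, h1.1⟩
    · exact ⟨h1.1, h1.2⟩
  have hinj : Function.Injective φ := by
    intro x y hxy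
    by_cases h : x.1 = y.1
    · obtain ⟨i, b⟩ := x
      obtain ⟨j, c⟩ := y
      obtain rfl : i = j := h
      cases b <;> cases c <;> simp only [φ, Bool.false_eq_true, if_false, if_true] at hxy
      · rfl
      · exact absurd hxy (ht _)
      · exact absurd hxy.symm (ht _)
      · rfl
    · exact absurd hxy (hφ x y h).1
  refine SimpleGraph.nonempty_iso_of_bijective hG octahedronGraph_isRegularOfDegree φ
    ((Fintype.bijective_iff_injective_and_card φ).2 ⟨hinj, by simp [hcard]⟩) ?_
  intro x y hxy
  by_contra h
  rcases (hadj _ _).1 h with h | h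
  · exact (hφ y x (Ne.symm hxy)).1 h
  · exact (hφ y x (Ne.symm hxy)).2 h

end Small

/-! ### Short cycles and the girth -/

section Girth

variable {V : Type*} {G : SimpleGraph V}

theorem SimpleGraph.egirth_le_three {a b c : V} (hab : G.Adj a b) (hbc : G.Adj b c)
    (hca : G.Adj c a) : G.egirth ≤ 3 := by
  let w : G.Walk a a := .cons hab (.cons hbc (.cons hca .nil))
  have n1 := hab.ne
  have n2 := hbc.ne
  have n3 := hca.ne
  have hw : w.IsCycle := by
    simp only [w, SimpleGraph.Walk.isCycle_def, SimpleGraph.Walk.isTrail_def]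
    simp; grind
  exact (SimpleGraph.egirth_le_length hw).trans (by simp [w])

theorem SimpleGraph.egirth_le_four {a b c d : V} (hab : G.Adj a b) (hbc : G.Adj b c)
    (hcd : G.Adj c d) (hda : G.Adj d a) (hac : a ≠ c) (hbd : b ≠ d) : G.egirth ≤ 4 := by
  let w : G.Walk a a := .cons hab (.cons hbc (.cons hcd (.cons hda .nil)))
  have n1 := hab.ne
  have n2 := hbc.ne
  have n3 := hcd.ne
  have n4 := hda.ne
  have hw : w.IsCycle := by
    simp only [w, SimpleGraph.Walk.isCycle_def, SimpleGraph.Walk.isTrail_def]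
    simp; grind
  exact (SimpleGraph.egirth_le_length hw).trans (by simp [w])

theorem SimpleGraph.egirth_le_five {a b c d e : V} (hab : G.Adj a b) (hbc : G.Adj b c)
    (hcd : G.Adj c d) (hde : G.Adj d e) (hea : G.Adj e a) (hac : a ≠ c) (had : a ≠ d)
    (hbd : b ≠ d) (hbe : b ≠ e) (hce : c ≠ e) : G.egirth ≤ 5 := by
  let w : G.Walk a a := .cons hab (.cons hbc (.cons hcd (.cons hde (.cons hea .nil))))
  have n1 := hab.ne
  have n2 := hbc.ne
  have n3 := hcd.ne
  have n4 := hde.ne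
  have n5 := hea.ne
  have hw : w.IsCycle := by
    simp only [w, SimpleGraph.Walk.isCycle_def, SimpleGraph.Walk.isTrail_def]
    simp; grind
  exact (SimpleGraph.egirth_le_length hw).trans (by simp [w])

/-- Interleaving the quantifiers with the adjacencies lets a decision procedure drop non-adjacent
pairs early. -/
theorem SimpleGraph.four_le_egirth (h3 : ∀ x y, G.Adj x y → ∀ z, G.Adj y z → ¬ G.Adj z x) :
    4 ≤ G.egirth := by
  rw [SimpleGraph.le_egirth]
  intro a w hw
  by_contra hlt
  have h3' := hw.three_le_length
  have hl : w.length = 3 := by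
    have : w.length < 4 := by exact_mod_cast not_le.1 hlt
    lia
  have h0 := w.adj_getVert_succ (i := 0) (by lia)
  have h1 := w.adj_getVert_succ (i := 1) (by lia)
  have h2 := w.adj_getVert_succ (i := 2) (by lia)
  have e : w.getVert (2 + 1) = w.getVert 0 := by
    rw [show 2 + 1 = w.length by lia, w.getVert_length, w.getVert_zero]
  rw [e] at h2
  exact h3 _ _ h0 _ h1 h2

theorem SimpleGraph.five_le_egirth (h3 : ∀ x y, G.Adj x y → ∀ z, G.Adj y z → ¬ G.Adj z x)
    (h4 : ∀ x y, G.Adj x y → ∀ z, G.Adj y z → ∀ w, G.Adj z w → G.Adj w x → x = z ∨ y = w) :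
    5 ≤ G.egirth := by
  have h := SimpleGraph.four_le_egirth h3
  rw [SimpleGraph.le_egirth] at h ⊢
  intro a w hw
  by_contra hlt
  have hge : 4 ≤ w.length := by exact_mod_cast h a w hw
  have hl : w.length = 4 := by
    have : w.length < 5 := by exact_mod_cast not_le.1 hlt
    lia
  have h0 := w.adj_getVert_succ (i := 0) (by lia)
  have h1 := w.adj_getVert_succ (i := 1) (by lia)
  have h2 := w.adj_getVert_succ (i := 2) (by lia)
  have h5 := w.adj_getVert_succ (i := 3) (by lia)
  have e : w.getVert (3 + 1) = w.getVert 0 := by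
    rw [show 3 + 1 = w.length by lia, w.getVert_length, w.getVert_zero]
  rw [e] at h5
  have hinj := hw.getVert_injOn'
  rcases h4 _ _ h0 _ h1 _ h2 h5 with h | h
  · have := hinj (by rw [Set.mem_ofPred_eq]; lia) (by rw [Set.mem_ofPred_eq]; lia) h
    lia
  · have := hinj (by rw [Set.mem_ofPred_eq]; lia) (by rw [Set.mem_ofPred_eq]; lia) h
    lia

end Girth

/-! ### Straight-line drawings with integer coordinates -/

section StraightLine

/-- Twice the signed area of a triangle. -/
def area {R : Type*} [CommRing R] (p q r : R × R) : R :=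
  (q.1 - p.1) * (r.2 - p.2) - (q.2 - p.2) * (r.1 - p.1)

theorem area_swap {R : Type*} [CommRing R] (p q r : R × R) : area q p r = - area p q r := by
  simp only [area]; ring

theorem area_lineMap (p q x y : ℝ × ℝ) (t : ℝ) :
    area p q (AffineMap.lineMap x y t) = (1 - t) * area p q x + t * area p q y := by
  simp only [area, AffineMap.lineMap_apply, vsub_eq_sub, vadd_eq_add, Prod.fst_add, Prod.snd_add,
    Prod.smul_fst, Prod.smul_snd, Prod.fst_sub, Prod.snd_sub, smul_eq_mul]
  ring

theorem area_eq_zero_of_mem_segment {p q r : ℝ × ℝ} (h : r ∈ segment ℝ p q) : area p q r = 0 := by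
  rw [segment_eq_image_lineMap] at h
  obtain ⟨t, -, rfl⟩ := h
  rw [area_lineMap]
  simp only [area]
  ring

/-- `x` and `y` lie strictly on the same side of the line through `p` and `q`, and the area is
affine along the segment between them. -/
theorem notMem_segment_of_area {p q x y z : ℝ × ℝ} (h : 0 < area p q x * area p q y)
    (hz : z ∈ segment ℝ p q) : z ∉ segment ℝ x y := by
  intro hz'
  have h0 := area_eq_zero_of_mem_segment hz
  rw [segment_eq_image_lineMap] at hz'
  obtain ⟨t, ht, rfl⟩ := hz'
  rw [area_lineMap] at h0
  have hx : area p q x ≠ 0 := fun h' => by simp [h'] at h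
  have h1 : (1 - t) * area p q x ^ 2 + t * (area p q x * area p q y) = 0 := by
    linear_combination area p q x * h0
  have h2 : 0 < area p q x ^ 2 := by positivity
  have h3 : 0 ≤ (1 - t) * area p q x ^ 2 := mul_nonneg (by linarith [ht.2]) h2.le
  have h4 : 0 ≤ t * (area p q x * area p q y) := mul_nonneg ht.1 h.le
  have h5 : t = 0 := by
    have : t * (area p q x * area p q y) = 0 := by linarith
    exact (mul_eq_zero.1 this).resolve_right h.ne'
  subst h5
  linarith

theorem eq_of_mem_segment_of_mem_segment {p q r z : ℝ × ℝ} (h : area p q r ≠ 0)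
    (h1 : z ∈ segment ℝ p q) (h2 : z ∈ segment ℝ p r) : z = p := by
  have h0 := area_eq_zero_of_mem_segment h1
  rw [segment_eq_image_lineMap] at h2
  obtain ⟨t, ht, rfl⟩ := h2
  rw [area_lineMap] at h0
  have : area p q p = 0 := by simp [area]
  rw [this, mul_zero, zero_add] at h0
  rw [(mul_eq_zero.1 h0).resolve_right h, AffineMap.lineMap_apply_zero]

/-- The combinatorial condition that the segments between two pairs of points do not cross. -/
def Uncrossed {V : Type*} (pt : V → ℤ × ℤ) (e f : V × V) : Prop :=
  (e.1 = f.1 ∨ e.1 = f.2 ∨ e.2 = f.1 ∨ e.2 = f.2) ∨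
    0 < area (pt e.1) (pt e.2) (pt f.1) * area (pt e.1) (pt e.2) (pt f.2) ∨
    0 < area (pt f.1) (pt f.2) (pt e.1) * area (pt f.1) (pt f.2) (pt e.2)

instance {V : Type*} [DecidableEq V] (pt : V → ℤ × ℤ) (e f : V × V) :
    Decidable (Uncrossed pt e f) := by
  unfold Uncrossed; infer_instance

/-- Two edges with a common end meet only there, because no other vertex lies on the line of an
edge. Edges without a common end are separated by the line through one of them. All conditions are
integer inequalities, so they can be decided. -/
theorem isPlanarGraph_of_uncrossed {V : Type*} {G : SimpleGraph V} (pt : V → ℤ × ℤ)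
    (hpt : Function.Injective pt) (L : List (V × V))
    (hL : ∀ u v, G.Adj u v → (u, v) ∈ L ∨ (v, u) ∈ L)
    (harea : ∀ e ∈ L, ∀ w, w = e.1 ∨ w = e.2 ∨ area (pt e.1) (pt e.2) (pt w) ≠ 0)
    (hcross : ∀ e ∈ L, ∀ f ∈ L, Uncrossed pt e f) : IsPlanarGraph G := by
  let P : V → ℝ × ℝ := fun v => ((pt v).1, (pt v).2)
  have hP : Function.Injective P := by
    intro u v h
    refine hpt (Prod.ext ?_ ?_)
    · exact Int.cast_injective (α := ℝ) (congrArg Prod.fst h)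
    · exact Int.cast_injective (α := ℝ) (congrArg Prod.snd h)
  have cast : ∀ u v w, area (P u) (P v) (P w) = (area (pt u) (pt v) (pt w) : ℤ) := by
    intro u v w
    simp only [area, P]
    push_cast
    ring
  have harea' : ∀ u v, G.Adj u v → ∀ w, w ≠ u → w ≠ v → area (P u) (P v) (P w) ≠ 0 := by
    intro u v huv w hu hv
    rcases hL u v huv with h | h
    · rw [cast]
      exact_mod_cast ((harea _ h w).resolve_left hu).resolve_left hv
    · rw [area_swap, cast, neg_ne_zero]
      exact_mod_cast ((harea _ h w).resolve_left hv).resolve_left hu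
  have meet : ∀ u v w, G.Adj u v → w ≠ u → w ≠ v → ∀ z, z ∈ segment ℝ (P u) (P v) →
      z ∈ segment ℝ (P u) (P w) → z = P u := fun u v w huv hu hv z =>
    eq_of_mem_segment_of_mem_segment (harea' u v huv w hu hv)
  have hcross' : ∀ e ∈ L, ∀ f ∈ L, G.Adj e.1 e.2 → G.Adj f.1 f.2 → s(e.1, e.2) ≠ s(f.1, f.2) →
      ∀ z ∈ segment ℝ (P e.1) (P e.2), z ∈ segment ℝ (P f.1) (P f.2) →
      z ∈ P '' {w | w ∈ s(e.1, e.2) ∧ w ∈ s(f.1, f.2)} := by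
    rintro ⟨a, b⟩ he ⟨c, d⟩ hf hab hcd hne z hz hz'
    simp only at *
    have nab := hab.ne
    have ncd := hcd.ne
    rcases hcross _ he _ hf with (h | h | h | h) | h | h
    · obtain rfl : a = c := h
      refine ⟨a, by simp, (meet a b d hab ncd.symm ?_ z hz hz').symm⟩
      rintro rfl; exact hne rfl
    · obtain rfl : a = d := h
      refine ⟨a, by simp, (meet a b c hab ncd ?_ z hz (by rwa [segment_symm])).symm⟩
      rintro rfl; exact hne Sym2.eq_swap
    · obtain rfl : b = c := h
      refine ⟨b, by simp, (meet b a d hab.symm ncd.symm ?_ z (by rwa [segment_symm]) hz').symm⟩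
      rintro rfl; exact hne Sym2.eq_swap
    · obtain rfl : b = d := h
      refine ⟨b, by simp, (meet b a c hab.symm ncd ?_ z (by rwa [segment_symm])
        (by rwa [segment_symm])).symm⟩
      rintro rfl; exact hne rfl
    · refine absurd hz' (notMem_segment_of_area ?_ hz)
      rw [cast, cast]
      exact_mod_cast h
    · refine absurd hz (notMem_segment_of_area ?_ hz')
      rw [cast, cast]
      exact_mod_cast h
  have harc : ∀ u v : V, {z | ∃ a b, s(u, v) = s(a, b) ∧ z ∈ segment ℝ (P a) (P b)} =
      segment ℝ (P u) (P v) := by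
    intro u v
    ext z
    constructor
    · rintro ⟨a, b, h, hz⟩
      rcases Sym2.eq_iff.1 h with ⟨rfl, rfl⟩ | ⟨rfl, rfl⟩
      · exact hz
      · rwa [segment_symm]
    · exact fun hz => ⟨u, v, rfl, hz⟩
  refine ⟨⟨P, hP, fun e => {z | ∃ a b, e = s(a, b) ∧ z ∈ segment ℝ (P a) (P b)}, ?_, ?_, ?_⟩⟩
  · intro u v huv
    rw [harc]
    have hne : P u ≠ P v := hP.ne huv.ne
    refine ⟨⟨⟨fun t => AffineMap.lineMap (P u) (P v) (t : ℝ), ?_⟩, by simp, by simp⟩, ?_, ?_⟩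
    · exact AffineMap.lineMap_continuous.comp continuous_subtype_val
    · intro s t hst
      exact Subtype.ext (AffineMap.lineMap_injective ℝ hne hst)
    · rw [segment_eq_image_lineMap]
      ext z
      constructor
      · rintro ⟨t, rfl⟩
        exact ⟨t, t.2, rfl⟩
      · rintro ⟨t, ht, rfl⟩
        exact ⟨⟨t, ht⟩, rfl⟩
  · intro e he w hw
    induction e using Sym2.ind with
    | _ u v =>
      rw [harc] at hw
      by_contra hmem
      rw [Sym2.mem_iff, not_or] at hmem
      exact harea' u v he w hmem.1 hmem.2 (area_eq_zero_of_mem_segment hw)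
  · have orient : ∀ e ∈ G.edgeSet, ∃ p ∈ L, e = s(p.1, p.2) ∧ G.Adj p.1 p.2 := by
      intro e he
      induction e using Sym2.ind with
      | _ u v =>
        rcases hL u v he with h | h
        · exact ⟨_, h, rfl, he⟩
        · exact ⟨_, h, Sym2.eq_swap, SimpleGraph.Adj.symm he⟩
    intro e he f hf hef z hz
    obtain ⟨p, hp, rfl, hpa⟩ := orient e he
    obtain ⟨q, hq, rfl, hqa⟩ := orient f hf
    rw [harc, harc] at hz
    exact hcross' p hp q hq hpa hqa hef z hz.1 hz.2

end StraightLine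

/-! ### Drawings of the five Platonic graphs -/

section PlatonicDrawings

/-- Membership decided by the decidable equality of the components, also where these carry a boolean
equality of their own. -/
instance {α β : Type*} [DecidableEq α] [DecidableEq β] (L : List (α × β)) (p : α × β) :
    Decidable (p ∈ L) := inferInstance

/-- In this drawing and the next ones an outer face encloses the other vertices; the coordinates are
skewed so that no vertex lies on the line through an edge not containing it. -/
theorem isPlanarGraph_tetrahedronGraph : IsPlanarGraph tetrahedronGraph := by
  refine isPlanarGraph_of_uncrossed ![(5, 1), (-4, 3), (-1, -5), (0, 0)] (by decide)
    [(0, 1), (0, 2), (0, 3), (1, 2), (1, 3), (2, 3)] (by decide) (by decide +kernel)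
    (by decide +kernel)

theorem isPlanarGraph_cubeGraph : IsPlanarGraph cubeGraph := by
  let b : Bool → Fin 2 := fun x => if x then 1 else 0
  refine isPlanarGraph_of_uncrossed (fun x =>
    (![![![(5, 1), (2, 1)], ![(1, -5), (0, -2)]], ![![(-1, 5), (0, 2)], ![(-5, -1), (-2, -1)]]] :
      Fin 2 → Fin 2 → Fin 2 → ℤ × ℤ) (b (x 0)) (b (x 1)) (b (x 2))) (by decide +kernel)
    ([(false, false), (false, true), (true, false), (true, true)].flatMap fun p =>
      [(![false, p.1, p.2], ![true, p.1, p.2]), (![p.1, false, p.2], ![p.1, true, p.2]),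
        (![p.1, p.2, false], ![p.1, p.2, true])]) (by decide +kernel) (by decide +kernel)
    (by decide +kernel)

theorem isPlanarGraph_octahedronGraph : IsPlanarGraph octahedronGraph := by
  refine isPlanarGraph_of_uncrossed (fun x =>
    (![![(5, 1), (-1, -1)], ![(-4, 3), (1, -1)], ![(-1, -5), (0, 0)]] :
      Fin 3 → Fin 2 → ℤ × ℤ) x.1 (if x.2 then 1 else 0)) (by decide +kernel)
    ([(false, false), (false, true), (true, false), (true, true)].flatMap fun p =>
      [((0, p.1), (1, p.2)), ((0, p.1), (2, p.2)), ((1, p.1), (2, p.2))]) (by decide +kernel)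
    (by decide +kernel) (by decide +kernel)

theorem isPlanarGraph_dodecahedronGraph : IsPlanarGraph dodecahedronGraph := by
  refine isPlanarGraph_of_uncrossed (fun x =>
    (![![(19, 6), (0, 20), (-19, 6), (-12, -16), (12, -16)],
      ![(9, 3), (-1, 10), (-11, 4), (-7, -7), (5, -8)],
      ![(6, -1), (2, 5), (-5, 6), (-7, -1), (0, -5)],
      ![(2, 0), (1, 2), (-3, 3), (-4, 0), (-1, -2)]] : Fin 4 → Fin 5 → ℤ × ℤ) x.1 x.2)
    (by decide +kernel)
    (([0, 1, 2, 3, 4] : List (ZMod 5)).flatMap fun j =>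
      [((0, j), (0, j + 1)), ((0, j), (1, j)), ((1, j), (2, j)), ((1, j), (2, j + 1)),
        ((2, j), (3, j)), ((3, j), (3, j + 1))]) (by decide +kernel) (by decide +kernel)
    (by decide +kernel)

/-- The thirty edges of the icosahedron. -/
def icosahedronEdges : List ((Bool ⊕ (Bool × ZMod 5)) × (Bool ⊕ (Bool × ZMod 5))) :=
  ([0, 1, 2, 3, 4] : List (ZMod 5)).flatMap fun j =>
    [(Sum.inl false, Sum.inr (false, j)), (Sum.inl true, Sum.inr (true, j)),
      (Sum.inr (false, j), Sum.inr (false, j + 1)), (Sum.inr (true, j), Sum.inr (true, j + 1)),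
      (Sum.inr (false, j), Sum.inr (true, j)), (Sum.inr (false, j), Sum.inr (true, j + 1))]

set_option synthInstance.maxSize 2000 in
theorem isPlanarGraph_icosahedronGraph : IsPlanarGraph icosahedronGraph := by
  refine isPlanarGraph_of_uncrossed (fun x => match x with
    | Sum.inl false => (14, 4)
    | Sum.inl true => (-2, 0)
    | Sum.inr (false, j) =>
      (![(-11, 10), (-3, -15), (3, -3), (3, 1), (0, 4)] : Fin 5 → ℤ × ℤ) j
    | Sum.inr (true, j) =>
      (![(-4, 3), (-4, -1), (-1, -4), (1, -1), (0, 2)] : Fin 5 → ℤ × ℤ) j)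
    (by decide +kernel)
    icosahedronEdges
    (by decide +kernel) (by decide +kernel) (by decide +kernel)

end PlatonicDrawings

/-! ### Degree and girth of the Platonic graphs -/

section PlatonicKG

theorem IsPlanarKGGraph.of_decidable {V : Type*} [Fintype V] {G : SimpleGraph V} [G.LocallyFinite]
    {k g : ℕ} (h1 : G.IsRegularOfDegree k) (h2 : G.egirth = g) (h3 : IsPlanarGraph G) :
    IsPlanarKGGraph G k g := by
  refine ⟨fun v => ?_, h2, h3⟩
  convert h1 v

theorem isPlanarKGGraph_tetrahedronGraph : IsPlanarKGGraph tetrahedronGraph 3 3 := by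
  refine .of_decidable tetrahedronGraph_isRegularOfDegree (le_antisymm ?_ ?_)
    isPlanarGraph_tetrahedronGraph
  · exact SimpleGraph.egirth_le_three (a := 0) (b := 1) (c := 2) (by decide) (by decide) (by decide)
  · exact SimpleGraph.three_le_egirth

theorem isPlanarKGGraph_octahedronGraph : IsPlanarKGGraph octahedronGraph 4 3 := by
  refine .of_decidable octahedronGraph_isRegularOfDegree (le_antisymm ?_ ?_)
    isPlanarGraph_octahedronGraph
  · exact SimpleGraph.egirth_le_three (a := (0, true)) (b := (1, true)) (c := (2, true))
      (by decide) (by decide) (by decide)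
  · exact SimpleGraph.three_le_egirth

theorem isPlanarKGGraph_icosahedronGraph : IsPlanarKGGraph icosahedronGraph 5 3 := by
  refine .of_decidable icosahedronGraph_isRegularOfDegree (le_antisymm ?_ ?_)
    isPlanarGraph_icosahedronGraph
  · exact SimpleGraph.egirth_le_three (a := Sum.inl true) (b := Sum.inr (true, 0))
      (c := Sum.inr (true, 1)) (by decide +kernel) (by decide +kernel) (by decide +kernel)
  · exact SimpleGraph.three_le_egirth

theorem isPlanarKGGraph_cubeGraph : IsPlanarKGGraph cubeGraph 3 4 := by
  refine .of_decidable cubeGraph_isRegularOfDegree (le_antisymm ?_ ?_)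
    isPlanarGraph_cubeGraph
  · exact SimpleGraph.egirth_le_four (a := ![false, false, false]) (b := ![true, false, false])
      (c := ![true, true, false]) (d := ![false, true, false]) (by decide) (by decide) (by decide)
      (by decide) (by decide) (by decide)
  · exact SimpleGraph.four_le_egirth (by decide +kernel)

theorem isPlanarKGGraph_dodecahedronGraph : IsPlanarKGGraph dodecahedronGraph 3 5 := by
  refine .of_decidable dodecahedronGraph_isRegularOfDegree (le_antisymm ?_ ?_)
    isPlanarGraph_dodecahedronGraph
  · exact SimpleGraph.egirth_le_five (a := (0, 0)) (b := (0, 1)) (c := (0, 2)) (d := (0, 3))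
      (e := (0, 4)) (by decide +kernel) (by decide +kernel) (by decide +kernel) (by decide +kernel)
      (by decide +kernel) (by decide) (by decide) (by decide) (by decide) (by decide)
  · exact SimpleGraph.five_le_egirth (by decide +kernel) (by decide +kernel)

end PlatonicKG

/-! ### Cages and the classification -/

section Cages

variable {V W : Type*}

/-- A drawing is carried over by an isomorphism. -/
theorem IsPlanarGraph.of_iso {G : SimpleGraph V} {H : SimpleGraph W} (f : G ≃g H)
    (h : IsPlanarGraph H) : IsPlanarGraph G := by
  obtain ⟨D⟩ := h
  have hedge : ∀ e ∈ G.edgeSet, e.map f ∈ H.edgeSet := by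
    intro e he
    induction e using Sym2.ind with
    | _ u v => exact f.map_adj_iff.2 he
  have hmem : ∀ (e : Sym2 V) w, f w ∈ e.map f → w ∈ e := by
    intro e w hw
    obtain ⟨x, hx, hxw⟩ := Sym2.mem_map.1 hw
    rwa [f.injective hxw] at hx
  refine ⟨⟨fun v => D.point (f v), D.point_injective.comp f.injective, fun e => D.arc (e.map f),
    fun u v huv => D.isArc _ _ (f.map_adj_iff.2 huv),
    fun e he w hw => hmem e w (D.mem_of_point_mem_arc _ (hedge e he) _ hw),
    fun e he e' he' hne z hz => ?_⟩⟩
  obtain ⟨w, hw, rfl⟩ := D.arc_inter_arc _ (hedge e he) _ (hedge e' he')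
    (fun h => hne (Sym2.map.injective f.injective h)) hz
  refine ⟨f.symm w, ⟨hmem _ _ ?_, hmem _ _ ?_⟩, ?_⟩
  · rw [f.apply_symm_apply]; exact hw.1
  · rw [f.apply_symm_apply]; exact hw.2
  · exact congrArg D.point (f.apply_symm_apply w)

theorem IsPlanarKGGraph.of_iso [Fintype V] [Fintype W] {G : SimpleGraph V} {H : SimpleGraph W}
    {k g : ℕ} (f : G ≃g H) (h : IsPlanarKGGraph H k g) : IsPlanarKGGraph G k g := by
  classical
  refine ⟨fun v => ?_, f.egirth_eq.trans h.2.1, h.2.2.of_iso f⟩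
  rw [← f.degree_eq]
  exact h.1 _

/-- Transport of a graph on a finite type to the standard type with the same number of elements. -/
theorem SimpleGraph.exists_fin_iso [Fintype V] (G : SimpleGraph V) :
    ∃ H : SimpleGraph (Fin (Fintype.card V)), Nonempty (H ≃g G) :=
  ⟨_, ⟨SimpleGraph.Iso.comap (Fintype.equivFin V).symm G⟩⟩

/-- The graph `P` attains the numerical lower bound on the order, so it is a cage and every cage has
its order; uniqueness is only needed at that order. -/
theorem isPlanarCage_iff [Fintype V] [Fintype W] {P : SimpleGraph W} {k g : ℕ} (hk : 3 ≤ k)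
    (hP : IsPlanarKGGraph P k g)
    (hbound : ∀ n, n * (g * k) + 4 * g ≤ n * (2 * k + 2 * g) → Fintype.card W ≤ n)
    {G : SimpleGraph V}
    (huniq : IsPlanarKGGraph G k g → Fintype.card V = Fintype.card W → Nonempty (G ≃g P)) :
    (IsPlanarCage G k g ↔ Nonempty (G ≃g P)) ∧
      (IsPlanarCage G k g → Fintype.card V = Fintype.card W) := by
  have hcard : IsPlanarCage G k g → Fintype.card V = Fintype.card W := by
    intro h
    obtain ⟨H, ⟨f⟩⟩ := P.exists_fin_iso
    exact le_antisymm (h.2 _ H (hP.of_iso f)) (hbound _ (h.1.card_bound hk))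
  refine ⟨⟨fun h => huniq h.1 (hcard h), fun ⟨f⟩ => ⟨hP.of_iso f, fun n H hH => ?_⟩⟩, hcard⟩
  rw [Fintype.card_congr f.toEquiv]
  simpa using hbound _ (hH.card_bound hk)

theorem not_adj_of_egirth {G : SimpleGraph V} (h : 4 ≤ G.egirth) (x y z : V) (h1 : G.Adj x y)
    (h2 : G.Adj y z) : ¬ G.Adj z x := fun h3 =>
  absurd (h.trans (SimpleGraph.egirth_le_three h1 h2 h3)) (by norm_num)

theorem eq_or_eq_of_egirth {G : SimpleGraph V} (h : 5 ≤ G.egirth) (x y z w : V) (h1 : G.Adj x y)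
    (h2 : G.Adj y z) (h3 : G.Adj z w) (h4 : G.Adj w x) : x = z ∨ y = w := by
  by_contra! hne
  exact absurd (h.trans (SimpleGraph.egirth_le_four h1 h2 h3 h4 hne.1 hne.2)) (by norm_num)

variable [Fintype V] (G : SimpleGraph V)

/-- Uniqueness uses only degree and order; girth and planarity enter through the bound on the order.
-/
theorem isPlanarCage_three_three : (IsPlanarCage G 3 3 ↔ Nonempty (G ≃g tetrahedronGraph)) ∧
    (IsPlanarCage G 3 3 → Fintype.card V = 4) :=
  isPlanarCage_iff le_rfl isPlanarKGGraph_tetrahedronGraph (by simp; lia)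
    fun h hc => nonempty_iso_tetrahedronGraph h.1 hc

theorem isPlanarCage_four_three : (IsPlanarCage G 4 3 ↔ Nonempty (G ≃g octahedronGraph)) ∧
    (IsPlanarCage G 4 3 → Fintype.card V = 6) :=
  isPlanarCage_iff (by norm_num) isPlanarKGGraph_octahedronGraph (by simp; lia)
    fun h hc => nonempty_iso_octahedronGraph h.1 hc

theorem isPlanarCage_three_four : (IsPlanarCage G 3 4 ↔ Nonempty (G ≃g cubeGraph)) ∧
    (IsPlanarCage G 3 4 → Fintype.card V = 8) := by
  refine isPlanarCage_iff le_rfl isPlanarKGGraph_cubeGraph (by simp; lia) fun h hc => ?_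
  have hV : Fintype.card V = 8 := hc
  have := h.nonempty
  -- With eight vertices both sides of the order bound are 112, so the faces are tight.
  obtain ⟨Φ, _, ⟨T⟩, -⟩ := h.exists_tightFaces le_rfl (by rw [hV])
  exact T.nonempty_iso_cubeGraph h.1 (not_adj_of_egirth h.2.1.ge) hV

theorem isPlanarCage_three_five : (IsPlanarCage G 3 5 ↔ Nonempty (G ≃g dodecahedronGraph)) ∧
    (IsPlanarCage G 3 5 → Fintype.card V = 20) := by
  refine isPlanarCage_iff le_rfl isPlanarKGGraph_dodecahedronGraph (by simp; lia) fun h hc => ?_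
  have hV : Fintype.card V = 20 := hc
  have := h.nonempty
  have h5 : 5 ≤ G.egirth := h.2.1.ge
  obtain ⟨Φ, _, ⟨T⟩, -⟩ := h.exists_tightFaces le_rfl (by rw [hV])
  exact T.nonempty_iso_dodecahedronGraph h.1 (not_adj_of_egirth (le_trans (by norm_num) h5))
    (eq_or_eq_of_egirth h5) hV

theorem isPlanarCage_five_three : (IsPlanarCage G 5 3 ↔ Nonempty (G ≃g icosahedronGraph)) ∧
    (IsPlanarCage G 5 3 → Fintype.card V = 12) := by
  refine isPlanarCage_iff (by norm_num) isPlanarKGGraph_icosahedronGraph (by simp; lia)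
    fun h hc => ?_
  have hV : Fintype.card V = 12 := hc
  have := h.nonempty
  obtain ⟨Φ, _, ⟨T⟩, hΦ⟩ := h.exists_tightFaces (by norm_num) (by rw [hV])
  -- `hΦ` says `3 * |Φ| = 5 * 12`, so there are twenty faces, more than two.
  exact T.nonempty_iso_icosahedronGraph (by lia) h.1 hV

variable {G}

/-- The positive term `4 * g` makes the order bound strict after division by `|V|`, which gives (k -
2)(g - 2) < 4. -/
theorem IsPlanarKGGraph.mem_platonic {k g : ℕ} (h : IsPlanarKGGraph G k g) (hk : 3 ≤ k) :
    (k, g) ∈ ({(3, 3), (3, 4), (3, 5), (4, 3), (5, 3)} : Set (ℕ × ℕ)) := by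
  have hg := h.three_le
  have hb := h.card_bound hk
  have hlt : g * k < 2 * k + 2 * g := by
    by_contra! hle
    have := Nat.mul_le_mul_left (Fintype.card V) hle
    lia
  have hk5 : k ≤ 5 := by nlinarith
  have hg5 : g ≤ 5 := by nlinarith
  interval_cases k <;> interval_cases g <;> simp_all

theorem exists_isPlanarCage_of_iff [Fintype W] {P : SimpleGraph W} {k g : ℕ}
    (h : ∀ (n : ℕ) (G : SimpleGraph (Fin n)), IsPlanarCage G k g ↔ Nonempty (G ≃g P)) :
    ∃ (n : ℕ) (G : SimpleGraph (Fin n)), IsPlanarCage G k g := by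
  obtain ⟨H, hH⟩ := P.exists_fin_iso
  exact ⟨_, H, (h _ H).2 hH⟩

end Cages

theorem mainTheorem1 :
    (∀ k g : ℕ, 3 ≤ k →
      ((∃ (n : ℕ) (G : SimpleGraph (Fin n)), IsPlanarCage G k g) ↔
        (k, g) ∈ ({(3, 3), (3, 4), (3, 5), (4, 3), (5, 3)} : Set (ℕ × ℕ)))) ∧
    (∀ (V : Type*) [Fintype V] (G : SimpleGraph V),
      ((IsPlanarCage G 3 3 ↔ Nonempty (G ≃g tetrahedronGraph)) ∧
        (IsPlanarCage G 3 3 → Fintype.card V = 4)) ∧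
      ((IsPlanarCage G 3 4 ↔ Nonempty (G ≃g cubeGraph)) ∧
        (IsPlanarCage G 3 4 → Fintype.card V = 8)) ∧
      ((IsPlanarCage G 3 5 ↔ Nonempty (G ≃g dodecahedronGraph)) ∧
        (IsPlanarCage G 3 5 → Fintype.card V = 20)) ∧
      ((IsPlanarCage G 4 3 ↔ Nonempty (G ≃g octahedronGraph)) ∧
        (IsPlanarCage G 4 3 → Fintype.card V = 6)) ∧
      ((IsPlanarCage G 5 3 ↔ Nonempty (G ≃g icosahedronGraph)) ∧
        (IsPlanarCage G 5 3 → Fintype.card V = 12))) := by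
  refine ⟨fun k g hk => ⟨fun ⟨n, G, h⟩ => h.1.mem_platonic hk, fun h => ?_⟩, fun V _ G =>
    ⟨isPlanarCage_three_three G, isPlanarCage_three_four G, isPlanarCage_three_five G,
      isPlanarCage_four_three G, isPlanarCage_five_three G⟩⟩
  simp only [Set.mem_insert_iff, Set.mem_singleton_iff, Prod.mk.injEq] at h
  rcases h with ⟨rfl, rfl⟩ | ⟨rfl, rfl⟩ | ⟨rfl, rfl⟩ | ⟨rfl, rfl⟩ | ⟨rfl, rfl⟩
  · exact exists_isPlanarCage_of_iff fun n G => (isPlanarCage_three_three G).1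
  · exact exists_isPlanarCage_of_iff fun n G => (isPlanarCage_three_four G).1
  · exact exists_isPlanarCage_of_iff fun n G => (isPlanarCage_three_five G).1
  · exact exists_isPlanarCage_of_iff fun n G => (isPlanarCage_four_three G).1
  · exact exists_isPlanarCage_of_iff fun n G => (isPlanarCage_five_three G).1
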